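/- **Conventions.** An algorithm is a randomized algorithm in a standard model of computation (all reasonable models are polynomially related, which does not affect the bounds below); it is run with a time bound $T$, and on an $n$-vertex graph it gives an answer only if it halts within $T(n)$ steps. $\mathcal G(n,\frac12)$ denotes the Erdős–Rényi distribution on graphs with $n$ labelled vertices, each edge being present independently with probability $\frac12$; $\mathcal G(n,\frac12,\kappa)$ denotes the same distribution with a clique added on an independent, uniformly random set of $\kappa$ vertices. **Strongish Planted Clique Hypothesis (SPCH).** There is a constant $\delta\in(0,\frac12)$ such that no algorithm $\mathcal A$ with time bound $n^{o(\log n)}$ satisfies, for all sufficiently large $n$, both $\Pr_{G\sim\mathcal G(n,\frac12,\lceil n^\delta\rceil)}[\mathcal A(G)=1]\ge \frac23$ and $\Pr_{G\sim\mathcal G(n,\frac12)}[\mathcal A(G)=1]\le\frac13$ (probabilities over $G$ and the coin tosses of $\mathcal A$; $\mathcal A(G)=1$ means that $\mathcal A$ halts on $G$ within the time bound with answer $1$). **Pattern detection.** For a fixed graph $H$ on $k$ vertices, an algorithm solves the not-necessarily-induced pattern detection problem for $H$ in time $T(n)$ if for every $n\ge1$ and every graph $G$ on $n$ vertices, with probability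 at least $\frac23$ it halts within $T(n)$ steps and answers correctly whether $G$ contains a (not necessarily induced) subgraph isomorphic to $H$. **Statement.** Assume SPCH. Let $f:\mathbb N\to\mathbb R$ be any function and let $g:\mathbb N\to\mathbb R$ satisfy $g(k)=o(k)$ as $k\to\infty$. Then $$\Pr_{H\sim\mathcal G(k,\frac12)}\bigl[\text{no algorithm solves not-necessarily-induced pattern detection for } H \text{ in time } f(k)\cdot n^{g(k)}\bigr]\longrightarrow 1\qquad (k\to\infty).$$ -/

import Mathlib

open Filter Topology Asymptotics
open scoped ENNReal

noncomputable section

namespace PatternDetection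

/-! ### Model of computation: randomized WHILE programs on binary trees

This is the textbook WHILE language (one program variable, holding a binary tree) with a coin-flip
instruction. Every step inspects or builds only a bounded number of tree nodes; subtrees are
shared pointers, and the only test is whether a tree is a leaf. Running times are therefore
polynomially related to those of randomized Turing machines and RAMs, so bounds of the form
`n ^ o(log n)` and `f k * n ^ o(k)` do not depend on which of these models is used. -/

/-- The data of the programs: unlabelled binary trees. -/
inductive BTree : Type
  | leaf : BTree
  | node : BTree → BTree → BTree

namespace BTree

/-- Left subtree (a leaf for a leaf). -/
def left : BTree → BTree
  | leaf => leaf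
  | node l _ => l

/-- Right subtree (a leaf for a leaf). -/
def right : BTree → BTree
  | leaf => leaf
  | node _ r => r

/-- The truth value of a tree: leaves are false, all other trees are true. -/
def truth : BTree → Bool
  | leaf => false
  | node _ _ => true

/-- The two bits as trees. -/
def ofBool : Bool → BTree
  | false => leaf
  | true => node leaf leaf

/-- Lists as trees. -/
def ofList : List BTree → BTree
  | [] => leaf
  | a :: l => node a (ofList l)

end BTree

/-- Expressions in the program variable. -/
inductive Expr : Type
  | var : Expr
  | leaf : Expr
  | node : Expr → Expr → Expr
  | left : Expr → Expr
  | right : Expr → Expr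

/-- The value of an expression when the program variable holds `s`. -/
def Expr.eval (s : BTree) : Expr → BTree
  | .var => s
  | .leaf => .leaf
  | .node a b => .node (a.eval s) (b.eval s)
  | .left a => (a.eval s).left
  | .right a => (a.eval s).right

/-- Programs (finite objects, independent of the input). -/
inductive Prog : Type
  /-- Replace the content of the program variable by the value of an expression. -/
  | assign : Expr → Prog
  /-- Toss a fair coin and attach the resulting bit on the left of the current tree. -/
  | flip : Prog
  | seq : Prog → Prog → Prog
  | ite : Expr → Prog → Prog → Prog
  /-- Repeat the body as long as the expression is true. -/
  | loop : Expr → Prog → Prog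

/-- A configuration: the programs that remain to be executed, in order, and the current value of
the program variable. The machine has halted when nothing remains to be executed. -/
abbrev Config : Type := List Prog × BTree

/-- One step of the computation, as a probability distribution on the next configuration. -/
def step : Config → PMF Config
  | ([], s) => PMF.pure ([], s)
  | (.assign e :: c, s) => PMF.pure (c, e.eval s)
  | (.flip :: c, s) =>
      (PMF.uniformOfFintype Bool).map fun b => (c, BTree.node (BTree.ofBool b) s)
  | (.seq p q :: c, s) => PMF.pure (p :: q :: c, s)
  | (.ite e p q :: c, s) =>
      PMF.pure (if (e.eval s).truth then (p :: c, s) else (q :: c, s))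
  | (.loop e p :: c, s) =>
      PMF.pure (if (e.eval s).truth then (p :: .loop e p :: c, s) else (c, s))

/-- The distribution of the configuration after `t` steps. -/
def run : ℕ → Config → PMF Config
  | 0, c => PMF.pure c
  | t + 1, c => (step c).bind (run t)

/-- The answer given in a configuration: none if the machine has not halted. -/
def answer : Config → Option Bool
  | ([], s) => some s.truth
  | (_ :: _, _) => none

/-- The distribution of the answer of the program `P` on the input `x` within `t` steps:
`some b` if `P` halts on `x` within `t` steps with answer `b`, and `none` if it has not halted. -/
def output (P : Prog) (t : ℕ) (x : BTree) : PMF (Option Bool) :=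
  (run t ([P], x)).map answer

/-! ### Graphs, random graphs and the planted clique hypothesis -/

open Classical in
/-- A graph on `n` labelled vertices as an input: the list of the rows of its adjacency matrix. -/
def encode {n : ℕ} (G : SimpleGraph (Fin n)) : BTree :=
  BTree.ofList (List.ofFn fun i : Fin n =>
    BTree.ofList (List.ofFn fun j : Fin n => BTree.ofBool (decide (G.Adj i j))))

/-- The Erdős–Rényi distribution with edge probability `1/2`: the uniform distribution on the
graphs on `n` labelled vertices. -/
def erdosRenyi (n : ℕ) : PMF (SimpleGraph (Fin n)) :=
  PMF.uniformOfFintype (SimpleGraph (Fin n))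

/-- The graph `G` with all edges inside the vertex set `S` added. -/
def addClique {n : ℕ} (G : SimpleGraph (Fin n)) (S : Finset (Fin n)) : SimpleGraph (Fin n) :=
  G ⊔ SimpleGraph.fromRel fun u v => u ∈ S ∧ v ∈ S

/-- The Erdős–Rényi distribution with edge probability `1/2` and a clique planted on an
independent, uniformly random set of `κ` vertices. -/
def plantedClique (n κ : ℕ) (h : κ ≤ n) : PMF (SimpleGraph (Fin n)) :=
  (erdosRenyi n).bind fun G =>
    (PMF.uniformOfFinset ((Finset.univ : Finset (Fin n)).powersetCard κ)
      (Finset.powersetCard_nonempty.2 (by simpa using h))).map (addClique G)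

theorem ceil_rpow_le (n : ℕ) {δ : ℝ} (h₀ : 0 < δ) (h₁ : δ < 1 / 2) :
    ⌈(n : ℝ) ^ δ⌉₊ ≤ n := by
  rw [Nat.ceil_le]
  rcases Nat.eq_zero_or_pos n with rfl | hn
  · simp [Real.zero_rpow h₀.ne']
  · calc (n : ℝ) ^ δ ≤ (n : ℝ) ^ (1 : ℝ) :=
          Real.rpow_le_rpow_of_exponent_le (by exact_mod_cast hn) (by linarith)
      _ = n := Real.rpow_one _

/-- The Strongish Planted Clique Hypothesis: for some constant `δ ∈ (0, 1/2)`, no randomized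
algorithm `A` with time bound `T n = n ^ h n`, `h n = o(log n)`, distinguishes, for all large `n`,
the two distributions in the sense that `A` answers `1` with probability at least `2/3` under the
planted and at most `1/3` under the Erdős–Rényi distribution. The computation of `A` is cut off
after `T n` steps: `A` answers `1` if it halts with that answer within `T n` steps. -/
def SPCH : Prop :=
  ∃ (δ : ℝ) (h₀ : 0 < δ) (h₁ : δ < 1 / 2),
    ¬ ∃ (A : Prog) (h : ℕ → ℝ), h =o[atTop] (fun n : ℕ => Real.log n) ∧
      ∀ᶠ n : ℕ in atTop,
        2 / 3 ≤ ((plantedClique n ⌈(n : ℝ) ^ δ⌉₊ (ceil_rpow_le n h₀ h₁)).bind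
          fun G => output A ⌊(n : ℝ) ^ h n⌋₊ (encode G)) (some true) ∧
        ((erdosRenyi n).bind
          fun G => output A ⌊(n : ℝ) ^ h n⌋₊ (encode G)) (some true) ≤ 1 / 3

/-! ### Pattern detection -/

open Classical in
/-- The randomized algorithm `P` solves the not-necessarily-induced pattern detection problem for
the fixed pattern `H` in time `T`: for every `n ≥ 1` and every host graph `G` on `n` vertices, with
probability at least `2/3` it halts within `T n` steps and answers correctly whether `G` contains a
(not necessarily induced) subgraph isomorphic to `H`. -/
def SolvesPattern {k : ℕ} (P : Prog) (H : SimpleGraph (Fin k)) (T : ℕ → ℝ) : Prop :=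
  ∀ n : ℕ, 1 ≤ n → ∀ G : SimpleGraph (Fin n),
    2 / 3 ≤ output P ⌊T n⌋₊ (encode G) (some (decide (H.IsContained G)))

end PatternDetection

end

/-! Planted clique reduces to detecting any dense pattern `H`, through a search for a certificate
whose form does not mention `H`. Fix `a` such that the planted clique has size at least `n ^ (1 /
a)`. Draw `N` random blocks of `4 * a * s` vertices each, where `s` is a large multiple of `log n /
k + 1`, and form the graph of blocks, two blocks being adjacent when they are completely joined in
`G`. Cut a large clique into `k` parts: for `N = n ^ O(s)` every part is likely to contain a block,
so the graph of blocks contains every pattern on `k` vertices (`pr_no_block`, `hasCopy_of_clique`).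

A detector for `H` now serves as an oracle for a self-reduction: discarding blocks as long as a copy
of `H` remains leaves exactly `k` blocks that form a copy (`prune_spec`, `search_hasCopy`). No `k`
of the random blocks have a union of size at most `k * s` (`pr_small_union`), and every large vertex
set of `H` spans a constant fraction of its pairs, so about `k ^ 2 * s ^ 2` pairs of vertices lie in
joined blocks (`Dense.exists_pairs`). By the choice of `s` this exceeds a constant times `(log n) *
k * s + k ^ 2`. In a random graph a union bound shows that no family of blocks covers so many pairs
(`pr_blockPairs_le`, `pr_hasCertificate_le`). Hence certificates distinguish the two distributions.

Since `N = n ^ O(log n / k)` up to lower order terms in the exponent, running the detector on `N`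
vertices takes time `n ^ O((1 + |g k|) / k * log n)`. For `g k = o(k)` a suitable fixed `k` brings
the exponent below `ε * log n`, for any `ε`.

The hypothesis speaks of a single program, whereas `k`, `H` and the detector vary with `ε`.
Therefore the distinguisher is a universal search: stage `t` reads the code of a detector and the
block parameters off random bits, interprets that code under a clock of length `t` (`interp_code`),
and accepts only verified certificates. Wrong guesses are harmless, and a right guess has
probability exponential in minus the length of the description, which more stages compensate
(`exists_universal_search`, `exists_detectsCliques`). Taking for each `n` the least sufficient time
gives one bound `n ^ o(log n)` (`not_spch_of_detectsCliques`). Finally, a random pattern is dense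
except with probability `2 ^ (-k)` (`pr_not_dense_le`). -/

namespace PatternDetection

/-! ### Trees as lists -/

namespace BTree

/-- The number of nodes of a tree, leaves included. -/
def size : BTree → ℕ
  | leaf => 1
  | node l r => l.size + r.size + 1

/-- The list whose `ofList` is the given tree. -/
def toList : BTree → List BTree
  | leaf => []
  | node a l => a :: toList l

/-- The length of a tree read as a list; trees also serve as unary numbers. -/
def len (x : BTree) : ℕ := x.toList.length

@[simp] theorem left_leaf : leaf.left = leaf := rfl
@[simp] theorem right_leaf : leaf.right = leaf := rfl
@[simp] theorem left_node (a b : BTree) : (node a b).left = a := rfl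
@[simp] theorem right_node (a b : BTree) : (node a b).right = b := rfl
@[simp] theorem truth_leaf : leaf.truth = false := rfl
@[simp] theorem truth_node (a b : BTree) : (node a b).truth = true := rfl
@[simp] theorem toList_leaf : leaf.toList = [] := rfl
@[simp] theorem toList_node (a b : BTree) : (node a b).toList = a :: b.toList := rfl
@[simp] theorem ofList_nil : ofList [] = leaf := rfl
@[simp] theorem ofList_cons (a : BTree) (l : List BTree) :
    ofList (a :: l) = node a (ofList l) := rfl
@[simp] theorem size_leaf : leaf.size = 1 := rfl
@[simp] theorem size_node (a b : BTree) : (node a b).size = a.size + b.size + 1 := rfl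
@[simp] theorem len_leaf : leaf.len = 0 := rfl
@[simp] theorem len_node (a b : BTree) : (node a b).len = b.len + 1 := rfl

@[simp] theorem toList_ofList (l : List BTree) : (ofList l).toList = l := by
  induction l with
  | nil => rfl
  | cons a l ih => simp [ih]

@[simp] theorem ofList_toList (x : BTree) : ofList x.toList = x := by
  induction x with
  | leaf => rfl
  | node a l _ ih => simp [ih]

@[simp] theorem len_ofList (l : List BTree) : (ofList l).len = l.length := by simp [len]

@[simp] theorem truth_ofBool (b : Bool) : (ofBool b).truth = b := by cases b <;> rfl

theorem size_ofBool_le (b : Bool) : (ofBool b).size ≤ 3 := by cases b <;> simp [ofBool]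

theorem one_le_size (x : BTree) : 1 ≤ x.size := by cases x <;> simp

theorem truth_ofList (l : List BTree) : (ofList l).truth = true ↔ l ≠ [] := by
  cases l <;> simp

theorem size_left_le (x : BTree) : x.left.size ≤ x.size := by
  cases x <;> simp; omega

theorem size_right_le (x : BTree) : x.right.size ≤ x.size := by
  cases x <;> simp; omega

theorem size_ofList (l : List BTree) : (ofList l).size = (l.map fun a => a.size + 1).sum + 1 := by
  induction l with
  | nil => rfl
  | cons a l ih => simp [ih]; omega

theorem len_lt_size (x : BTree) : x.len < x.size := by
  induction x with
  | leaf => simp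
  | node a b _ ih => simp; omega

theorem size_le_of_mem {a x : BTree} (h : a ∈ x.toList) : a.size < x.size := by
  induction x with
  | leaf => simp at h
  | node b c _ ih =>
    rcases List.mem_cons.1 (by simpa using h) with rfl | h
    · simp only [size_node]; omega
    · have := ih h; simp only [size_node]; omega

theorem size_ofList_le_of_sublist {l l' : List BTree} (h : l.Sublist l') :
    (ofList l).size ≤ (ofList l').size := by
  induction h with
  | slnil => exact le_rfl
  | cons a _ ih => simp only [ofList_cons, size_node]; omega
  | cons_cons a _ ih => simp only [ofList_cons, size_node]; omega

theorem size_ofList_append (l l' : List BTree) :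
    (ofList (l ++ l')).size + 1 = (ofList l).size + (ofList l').size := by
  induction l with
  | nil => simp; omega
  | cons a l ih => simp; omega

theorem size_ofList_reverse (l : List BTree) : (ofList l.reverse).size = (ofList l).size := by
  simp [size_ofList]

end BTree

open BTree

/-! ### Polynomially bounded functions -/

/-- Monotone functions bounded by a polynomial. -/
def PolyBdd (B : ℕ → ℕ) : Prop := Monotone B ∧ ∃ c, ∀ n, B n ≤ (n + 2) ^ c

namespace PolyBdd

theorem const (a : ℕ) : PolyBdd fun _ => a :=
  ⟨monotone_const, a, fun n => (Nat.lt_two_pow_self).le.trans (Nat.pow_le_pow_left (by omega) _)⟩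

theorem id : PolyBdd fun n => n := ⟨monotone_id, 1, fun n => by simp⟩

theorem add {B C : ℕ → ℕ} (hB : PolyBdd B) (hC : PolyBdd C) : PolyBdd fun n => B n + C n := by
  obtain ⟨hB, b, hb⟩ := hB
  obtain ⟨hC, c, hc⟩ := hC
  refine ⟨hB.add hC, b + c + 1, fun n => ?_⟩
  have h1 : (n + 2) ^ b ≤ (n + 2) ^ (b + c) := Nat.pow_le_pow_right (by omega) (by omega)
  have h2 : (n + 2) ^ c ≤ (n + 2) ^ (b + c) := Nat.pow_le_pow_right (by omega) (by omega)
  have := hb n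
  have := hc n
  rw [pow_succ]
  nlinarith

theorem mul {B C : ℕ → ℕ} (hB : PolyBdd B) (hC : PolyBdd C) : PolyBdd fun n => B n * C n := by
  obtain ⟨hB, b, hb⟩ := hB
  obtain ⟨hC, c, hc⟩ := hC
  refine ⟨hB.mul hC (fun _ => Nat.zero_le _) (fun _ => Nat.zero_le _), b + c, fun n => ?_⟩
  rw [pow_add]
  exact Nat.mul_le_mul (hb n) (hc n)

theorem comp {B C : ℕ → ℕ} (hB : PolyBdd B) (hC : PolyBdd C) : PolyBdd fun n => B (C n) := by
  obtain ⟨hB, b, hb⟩ := hB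
  obtain ⟨hC, c, hc⟩ := hC
  refine ⟨hB.comp hC, (c + 2) * b, fun n => (hb _).trans ?_⟩
  rw [pow_mul]
  refine Nat.pow_le_pow_left ?_ _
  have h1 : 1 ≤ (n + 2) ^ c := Nat.one_le_pow _ _ (by omega)
  have h2 : 4 ≤ (n + 2) ^ 2 := by ring_nf; omega
  have := hc n
  rw [pow_add]
  nlinarith

end PolyBdd

/-! ### Big-step semantics of deterministic programs -/

/-- `Ev p s s' τ`: the program `p`, started with `s`, tosses no coins and ends with `s'` after
exactly `τ` steps. -/
inductive Ev : Prog → BTree → BTree → ℕ → Prop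
  | assign (e : Expr) (s : BTree) : Ev (.assign e) s (e.eval s) 1
  | seq {p q : Prog} {s s₁ s₂ : BTree} {a b : ℕ} (hp : Ev p s s₁ a) (hq : Ev q s₁ s₂ b) :
      Ev (.seq p q) s s₂ (1 + a + b)
  | ite_true {e : Expr} {p q : Prog} {s s' : BTree} {a : ℕ} (he : (e.eval s).truth = true)
      (hp : Ev p s s' a) : Ev (.ite e p q) s s' (1 + a)
  | ite_false {e : Expr} {p q : Prog} {s s' : BTree} {a : ℕ} (he : (e.eval s).truth = false)
      (hq : Ev q s s' a) : Ev (.ite e p q) s s' (1 + a)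
  | loop_false {e : Expr} {p : Prog} {s : BTree} (he : (e.eval s).truth = false) :
      Ev (.loop e p) s s 1
  | loop_true {e : Expr} {p : Prog} {s s₁ s₂ : BTree} {a b : ℕ} (he : (e.eval s).truth = true)
      (hp : Ev p s s₁ a) (hl : Ev (.loop e p) s₁ s₂ b) : Ev (.loop e p) s s₂ (1 + a + b)

/-- Substitution of an expression for the program variable. -/
def Expr.subst : Expr → Expr → Expr
  | .var, e' => e'
  | .leaf, _ => .leaf
  | .node a b, e' => .node (a.subst e') (b.subst e')
  | .left a, e' => .left (a.subst e')
  | .right a, e' => .right (a.subst e')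

theorem Expr.eval_subst (e e' : Expr) (s : BTree) :
    (e.subst e').eval s = e.eval (e'.eval s) := by
  induction e <;> simp_all [Expr.subst, Expr.eval]

/-- The expression with a given constant value. -/
def Expr.lit : BTree → Expr
  | .leaf => .leaf
  | .node a b => .node (lit a) (lit b)

theorem Expr.eval_lit (x s : BTree) : (Expr.lit x).eval s = x := by
  induction x <;> simp_all [Expr.lit, Expr.eval]

theorem Expr.exists_size_eval_le (e : Expr) :
    ∃ C, ∀ s : BTree, (e.eval s).size ≤ C * s.size := by
  induction e with
  | var => exact ⟨1, fun s => by simp [Expr.eval]⟩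
  | leaf => exact ⟨1, fun s => by simpa [Expr.eval] using s.one_le_size⟩
  | node a b iha ihb =>
    obtain ⟨C, hC⟩ := iha
    obtain ⟨D, hD⟩ := ihb
    refine ⟨C + D + 1, fun s => ?_⟩
    have := hC s
    have := hD s
    have := s.one_le_size
    simp only [Expr.eval, size_node]
    nlinarith
  | left a ih =>
    obtain ⟨C, hC⟩ := ih
    exact ⟨C, fun s => (size_left_le _).trans (hC s)⟩
  | right a ih =>
    obtain ⟨C, hC⟩ := ih
    exact ⟨C, fun s => (size_right_le _).trans (hC s)⟩

/-- The program that acts on the left subtree of the content of the program variable. The coin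
instruction is irrelevant for deterministic programs. -/
def Prog.onLeft : Prog → Prog
  | .assign e => .assign (.node (e.subst (.left .var)) (.right .var))
  | .flip => .flip
  | .seq p q => .seq p.onLeft q.onLeft
  | .ite e p q => .ite (e.subst (.left .var)) p.onLeft q.onLeft
  | .loop e p => .loop (e.subst (.left .var)) p.onLeft

/-- The right subtree is storage that the program cannot touch. With a single program variable, this
is how intermediate results are kept. -/
theorem Ev.onLeft {p : Prog} {s s' : BTree} {τ : ℕ} (h : Ev p s s' τ) (r : BTree) :
    Ev p.onLeft (.node s r) (.node s' r) τ := by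
  induction h with
  | assign e s =>
    have := Ev.assign (.node (e.subst (.left .var)) (.right .var)) (.node s r)
    simpa [Expr.eval, Expr.eval_subst, Prog.onLeft] using this
  | seq _ _ ih₁ ih₂ => exact .seq ih₁ ih₂
  | ite_true he _ ih => exact .ite_true (by simpa [Expr.eval, Expr.eval_subst] using he) ih
  | ite_false he _ ih => exact .ite_false (by simpa [Expr.eval, Expr.eval_subst] using he) ih
  | loop_false he => exact .loop_false (by simpa [Expr.eval, Expr.eval_subst] using he)
  | loop_true he _ _ ih₁ ih₂ =>
    exact .loop_true (by simpa [Expr.eval, Expr.eval_subst] using he) ih₁ ih₂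

/-- Iterate the program `p` on the left subtree, once for each element of the right subtree. -/
def Prog.iterLeft (p : Prog) : Prog :=
  .loop (.right .var) (.seq p.onLeft (.assign (.node (.left .var) (.right (.right .var)))))

/-- The right subtree is a unary clock. The time bound is asked only of the iterates actually
reached, so `C` may depend on the starting value. -/
theorem Ev.iterLeft {p : Prog} {F : BTree → BTree} {C : ℕ} (c y : BTree)
    (h : ∀ i < c.len, ∃ τ ≤ C, Ev p (F^[i] y) (F^[i + 1] y) τ) :
    ∃ τ ≤ c.len * (C + 3) + 1, Ev p.iterLeft (.node y c) (.node (F^[c.len] y) .leaf) τ := by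
  induction c generalizing y with
  | leaf => exact ⟨1, by simp, .loop_false rfl⟩
  | node a c _ ih =>
    obtain ⟨τ, hτ, h₀⟩ := h 0 (by simp)
    obtain ⟨σ, hσ, h₁⟩ := ih (F y) fun i hi => h (i + 1) (by simpa using hi)
    refine ⟨1 + (1 + τ + 1) + σ, ?_, .loop_true rfl (.seq (h₀.onLeft _) (.assign _ _)) h₁⟩
    simp only [len_node]
    nlinarith

/-! ### Polynomial time functions on trees -/

/-- The function `f` is computed by a deterministic program in polynomial time, and the size of
its values is polynomially bounded. -/
def FP (f : BTree → BTree) : Prop :=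
  ∃ (p : Prog) (B : ℕ → ℕ), PolyBdd B ∧ ∀ x,
    (∃ τ ≤ B x.size, Ev p x (f x) τ) ∧ (f x).size ≤ B x.size

namespace FP

theorem expr (e : Expr) : FP e.eval := by
  obtain ⟨C, hC⟩ := e.exists_size_eval_le
  refine ⟨.assign e, fun n => C * n + 1, ((PolyBdd.const C).mul .id).add (.const 1), fun x =>
    ⟨⟨1, by simp, .assign e x⟩, (hC x).trans (by simp)⟩⟩

protected theorem id : FP fun x => x := expr .var

theorem left {f : BTree → BTree} (hf : FP f) : FP fun x => (f x).left := by
  obtain ⟨p, B, hB, h⟩ := hf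
  refine ⟨.seq p (.assign (.left .var)), fun n => B n + 2, hB.add (.const 2), fun x => ?_⟩
  obtain ⟨⟨τ, hτ, h₁⟩, h₂⟩ := h x
  exact ⟨⟨1 + τ + 1, by simp only; omega, .seq h₁ (.assign _ _)⟩, by
    have := size_left_le (f x); simp only; omega⟩

theorem right {f : BTree → BTree} (hf : FP f) : FP fun x => (f x).right := by
  obtain ⟨p, B, hB, h⟩ := hf
  refine ⟨.seq p (.assign (.right .var)), fun n => B n + 2, hB.add (.const 2), fun x => ?_⟩
  obtain ⟨⟨τ, hτ, h₁⟩, h₂⟩ := h x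
  exact ⟨⟨1 + τ + 1, by simp only; omega, .seq h₁ (.assign _ _)⟩, by
    have := size_right_le (f x); simp only; omega⟩

theorem const (y : BTree) : FP fun _ => y := by
  simpa [funext fun s => Expr.eval_lit y s] using expr (Expr.lit y)

theorem comp {f g : BTree → BTree} (hf : FP f) (hg : FP g) : FP fun x => f (g x) := by
  obtain ⟨p, B, hB, hp⟩ := hf
  obtain ⟨q, C, hC, hq⟩ := hg
  refine ⟨.seq q p, fun n => 1 + C n + B (C n), ((PolyBdd.const 1).add hC).add (hB.comp hC),
    fun x => ?_⟩
  obtain ⟨⟨τ, hτ, h₁⟩, h₂⟩ := hq x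
  obtain ⟨⟨σ, hσ, h₃⟩, h₄⟩ := hp (g x)
  have := hB.1 h₂
  exact ⟨⟨1 + τ + σ, by simp only; omega, .seq h₁ h₃⟩, by simp only; omega⟩

/-- Duplicate the input, run one program on the left copy, swap, and run the other. -/
theorem node {f g : BTree → BTree} (hf : FP f) (hg : FP g) : FP fun x => .node (f x) (g x) := by
  obtain ⟨p, B, hB, hp⟩ := hf
  obtain ⟨q, C, hC, hq⟩ := hg
  refine ⟨.seq (.assign (.node .var .var)) (.seq p.onLeft (.seq
    (.assign (.node (.right .var) (.left .var))) (.seq q.onLeft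
    (.assign (.node (.right .var) (.left .var)))))),
    fun n => B n + C n + 7, (hB.add hC).add (.const _), fun x => ?_⟩
  obtain ⟨⟨τ, hτ, h₁⟩, h₂⟩ := hp x
  obtain ⟨⟨σ, hσ, h₃⟩, h₄⟩ := hq x
  exact ⟨⟨_, by simp only; omega, .seq (.assign _ _) (.seq (h₁.onLeft _) (.seq (.assign _ _)
    (.seq (h₃.onLeft _) (.assign _ _))))⟩, by simp only [size_node]; omega⟩

theorem ite {c f g : BTree → BTree} (hc : FP c) (hf : FP f) (hg : FP g) :
    FP fun x => if (c x).truth then f x else g x := by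
  obtain ⟨p, B, hB, hp⟩ := hf
  obtain ⟨q, C, hC, hq⟩ := hg
  obtain ⟨r, D, hD, hr⟩ := hc.node FP.id
  refine ⟨.seq r (.ite (.left .var) (.seq (.assign (.right .var)) p)
    (.seq (.assign (.right .var)) q)), fun n => D n + B n + C n + 7,
    ((hD.add hB).add hC).add (.const _), fun x => ?_⟩
  obtain ⟨⟨τ, hτ, h₁⟩, h₂⟩ := hr x
  obtain ⟨⟨σ, hσ, h₃⟩, h₄⟩ := hp x
  obtain ⟨⟨ρ, hρ, h₅⟩, h₆⟩ := hq x
  beta_reduce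
  by_cases h : (c x).truth = true
  · rw [if_pos h]
    exact ⟨⟨_, by omega, .seq h₁ (.ite_true h (.seq (.assign _ _) h₃))⟩, by omega⟩
  · rw [if_neg h]
    exact ⟨⟨_, by omega, .seq h₁ (.ite_false (by simpa [Expr.eval] using h)
      (.seq (.assign _ _) h₅))⟩, by omega⟩

theorem comp₂ {F : BTree → BTree → BTree} {f g : BTree → BTree}
    (hF : FP fun z => F z.left z.right) (hf : FP f) (hg : FP g) : FP fun x => F (f x) (g x) :=
  hF.comp (hf.node hg)

theorem comp₃ {F : BTree → BTree → BTree → BTree} {f g h : BTree → BTree}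
    (hF : FP fun z => F z.left z.right.left z.right.right) (hf : FP f) (hg : FP g) (hh : FP h) :
    FP fun x => F (f x) (g x) (h x) :=
  hF.comp (hf.node (hg.node hh))

/-- The size hypothesis cannot be dropped, since a single assignment can double a tree. The input
`x` travels unchanged beside the state, as a parameter of each step. -/
theorem iterate {S : BTree → BTree → BTree} {c f : BTree → BTree}
    (hS : FP fun z => S z.left z.right) (hc : FP c) (hf : FP f)
    (hB : ∃ B, PolyBdd B ∧ ∀ x, ∀ i ≤ (c x).len, ((S x)^[i] (f x)).size ≤ B x.size) :
    FP fun x => (S x)^[(c x).len] (f x) := by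
  obtain ⟨B, hB, hsize⟩ := hB
  obtain ⟨p, C, hC, hp⟩ := (FP.id.left).node hS
  obtain ⟨q, D, hD, hq⟩ := (FP.id.node hf).node hc
  refine ⟨.seq q (.seq p.iterLeft (.assign (.right (.left .var)))),
    fun n => D n + D n * (C (n + B n + 1) + 3) + 4 + B n,
    ((hD.add (hD.mul ((hC.comp ((PolyBdd.id.add hB).add (.const 1))).add (.const 3)))).add
      (.const 4)).add hB, fun x => ?_⟩
  obtain ⟨⟨τ, hτ, h₁⟩, h₂⟩ := hq x
  have hiter : ∀ i, (fun z => BTree.node z.left (S z.left z.right))^[i] (.node x (f x)) =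
      .node x ((S x)^[i] (f x)) := by
    intro i
    induction i with
    | zero => rfl
    | succ i ih => simp [Function.iterate_succ_apply', ih]
  obtain ⟨σ, hσ, h₃⟩ := Ev.iterLeft (p := p) (F := fun z => .node z.left (S z.left z.right))
    (C := C (x.size + B x.size + 1)) (c x) (.node x (f x)) (by
      intro i hi
      rw [Function.iterate_succ_apply', hiter]
      obtain ⟨⟨ρ, hρ, h⟩, -⟩ := hp (.node x ((S x)^[i] (f x)))
      refine ⟨ρ, hρ.trans (hC.1 ?_), h⟩
      have := hsize x i hi.le
      simp only [size_node]; omega)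
  rw [hiter] at h₃
  have hlen := (c x).len_lt_size
  refine ⟨⟨_, ?_, .seq h₁ (.seq h₃ (.assign _ _))⟩, (hsize x _ le_rfl).trans (by simp only; omega)⟩
  have : (c x).len ≤ D x.size := by simp only [size_node] at h₂; omega
  have := Nat.mul_le_mul_right (C (x.size + B x.size + 1) + 3) this
  simp only
  omega

/-- Iteration on the pair of the remaining list and the accumulator, with the list itself as clock.
Only accumulators of prefixes occur, so only these need a size bound. -/
theorem foldl {F : BTree → BTree → BTree → BTree} {l f : BTree → BTree}
    (hF : FP fun z => F z.left z.right.left z.right.right) (hl : FP l) (hf : FP f)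
    (hB : ∃ B, PolyBdd B ∧ ∀ x l', l' <+: (l x).toList →
      (l'.foldl (F x) (f x)).size ≤ B x.size) :
    FP fun x => (l x).toList.foldl (F x) (f x) := by
  obtain ⟨B, hB, hsize⟩ := hB
  let S : BTree → BTree → BTree := fun x y => .node y.left.right (F x y.right y.left.left)
  have hiter : ∀ x i, ∀ l acc : BTree, (S x)^[i] (.node l acc) =
      .node (ofList (l.toList.drop i)) ((l.toList.take i).foldl (F x) acc) ∨ l.len < i := by
    intro x i
    induction i with
    | zero => intro l acc; left; simp
    | succ i ih =>
      intro l acc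
      cases l with
      | leaf => right; simp
      | node a l => simpa [Function.iterate_succ_apply, S] using ih l (F x acc a)
  have hiter' : ∀ x i, i ≤ (l x).len → (S x)^[i] (.node (l x) (f x)) =
      .node (ofList ((l x).toList.drop i)) (((l x).toList.take i).foldl (F x) (f x)) :=
    fun x i hi => (hiter x i _ _).resolve_right (by omega)
  obtain ⟨_, D, hD, hq⟩ := id hl
  have := (iterate (S := S) (c := l) (f := fun x => .node (l x) (f x))
    (FP.id.right.left.right.node (comp₃ hF FP.id.left FP.id.right.right FP.id.right.left.left))
    hl (hl.node hf) ⟨fun n => D n + B n + 1, (hD.add hB).add (.const 1), fun x i hi => by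
      rw [hiter' x i hi]
      have h₁ := size_ofList_le_of_sublist (List.drop_sublist i (l x).toList)
      have h₂ := hsize x _ (List.take_prefix i (l x).toList)
      have h₃ := (hq x).2
      simp only [ofList_toList, size_node] at h₁ ⊢
      omega⟩).right
  convert this using 2 with x
  rw [hiter' x _ le_rfl]
  simp [len]

end FP

/-! ### List operations in polynomial time -/

namespace FP

/-- The size of the values of a polynomial time function is polynomially bounded. -/
theorem exists_size_le {f : BTree → BTree} (hf : FP f) :
    ∃ B, PolyBdd B ∧ ∀ x, (f x).size ≤ B x.size := by
  obtain ⟨_, B, hB, h⟩ := hf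
  exact ⟨B, hB, fun x => (h x).2⟩

theorem reverseAppend {f g : BTree → BTree} (hf : FP f) (hg : FP g) :
    FP fun x => ofList ((f x).toList.reverse ++ (g x).toList) := by
  obtain ⟨B, hB, hfB⟩ := hf.exists_size_le
  obtain ⟨C, hC, hgC⟩ := hg.exists_size_le
  have key : ∀ (l : List BTree) (acc : BTree), l.foldl (fun acc a => BTree.node a acc) acc =
      ofList (l.reverse ++ acc.toList) := by
    intro l
    induction l with
    | nil => simp
    | cons a l ih => intro acc; simp [ih]
  have := foldl (F := fun _ acc a => .node a acc) (l := f) (f := g)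
    (FP.id.right.right.node FP.id.right.left) hf hg ⟨fun n => B n + C n, hB.add hC, by
      intro x l' hl'
      have h₁ := size_ofList_le_of_sublist hl'.sublist
      have h₂ := size_ofList_append l'.reverse (g x).toList
      have h₃ := hfB x
      have h₄ := hgC x
      rw [size_ofList_reverse] at h₂
      simp only [key, ofList_toList] at *
      omega⟩
  simpa only [key] using this

theorem reverse {f : BTree → BTree} (hf : FP f) : FP fun x => ofList (f x).toList.reverse := by
  simpa using hf.reverseAppend (const .leaf)

theorem append {f g : BTree → BTree} (hf : FP f) (hg : FP g) :
    FP fun x => ofList ((f x).toList ++ (g x).toList) := by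
  simpa using hf.reverse.reverseAppend hg

theorem flatMap {F : BTree → BTree → BTree} {l : BTree → BTree}
    (hF : FP fun z => F z.left z.right) (hl : FP l) :
    FP fun x => ofList ((l x).toList.flatMap fun a => (F x a).toList) := by
  obtain ⟨B, hB, hFB⟩ := hF.exists_size_le
  obtain ⟨C, hC, hlC⟩ := hl.exists_size_le
  have key : ∀ x (l : List BTree) (acc : BTree),
      l.foldl (fun acc a => ofList ((F x a).toList.reverse ++ acc.toList)) acc =
      ofList ((l.flatMap fun a => (F x a).toList).reverse ++ acc.toList) := by
    intro x l
    induction l with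
    | nil => simp
    | cons a l ih => intro acc; simp [ih]
  have hsz : ∀ x (b : ℕ) (l : List BTree), (∀ a ∈ l, (F x a).size ≤ b) →
      (ofList (l.flatMap fun a => (F x a).toList)).size ≤ l.length * b + 1 := by
    intro x b l
    induction l with
    | nil => simp
    | cons a l ih =>
      intro h
      have h₁ := ih fun a ha => h a (List.mem_cons_of_mem _ ha)
      have h₂ := h a List.mem_cons_self
      have h₃ := size_ofList_append (F x a).toList (l.flatMap fun a => (F x a).toList)
      simp only [ofList_toList, List.flatMap_cons, List.length_cons] at *
      nlinarith
  have hF' : FP fun z => F z.left z.right.right := comp₂ hF FP.id.left FP.id.right.right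
  have := foldl (F := fun x acc a => ofList ((F x a).toList.reverse ++ acc.toList))
    (l := l) (f := fun _ => .leaf) (hF'.reverseAppend FP.id.right.left) hl (const _)
    ⟨fun n => C n * B (n + C n + 1) + 1,
      (hC.mul (hB.comp ((PolyBdd.id.add hC).add (.const 1)))).add (.const 1), by
      intro x l' hl'
      rw [key]
      simp only [toList_leaf, List.append_nil, size_ofList_reverse]
      refine (hsz x (B (x.size + C x.size + 1)) l' fun a ha => ?_).trans ?_
      · refine (hFB (.node x a)).trans (hB.1 ?_)
        have h₁ := size_le_of_mem (hl'.subset ha)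
        have h₂ := hlC x
        simp only [size_node]
        omega
      · have h₁ := hl'.length_le
        have h₂ := (l x).len_lt_size
        have h₃ := hlC x
        simp only [len] at h₂
        gcongr
        omega⟩
  simpa [key] using this.reverse

theorem map {F : BTree → BTree → BTree} {l : BTree → BTree}
    (hF : FP fun z => F z.left z.right) (hl : FP l) :
    FP fun x => ofList ((l x).toList.map (F x)) := by
  have := flatMap (F := fun x a => .node (F x a) .leaf) (hF.node (const .leaf)) hl
  simpa [← List.map_eq_flatMap] using this

theorem filter {F : BTree → BTree → BTree} {l : BTree → BTree}
    (hF : FP fun z => F z.left z.right) (hl : FP l) :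
    FP fun x => ofList ((l x).toList.filter fun a => (F x a).truth) := by
  have := flatMap (F := fun x a => if (F x a).truth then .node a .leaf else .leaf)
    (hF.ite (FP.id.right.node (const .leaf)) (const .leaf)) hl
  convert this using 3 with x
  induction (l x).toList with
  | nil => rfl
  | cons a l ih => by_cases h : (F x a).truth = true <;> simp_all

/-- Truth of a negation. -/
theorem not {f : BTree → BTree} (hf : FP f) : FP fun x => ofBool (!(f x).truth) := by
  convert hf.ite (const (ofBool false)) (const (ofBool true)) using 2 with x
  cases (f x).truth <;> rfl

theorem any {F : BTree → BTree → Bool} {l : BTree → BTree}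
    (hF : FP fun z => ofBool (F z.left z.right)) (hl : FP l) :
    FP fun x => ofBool ((l x).toList.any (F x)) := by
  have := ((filter (F := fun x a => ofBool (F x a)) hF hl).not).not
  convert this using 3 with x
  induction (l x).toList with
  | nil => rfl
  | cons a l ih => by_cases h : F x a = true <;> simp_all

theorem all {F : BTree → BTree → Bool} {l : BTree → BTree}
    (hF : FP fun z => ofBool (F z.left z.right)) (hl : FP l) :
    FP fun x => ofBool ((l x).toList.all (F x)) := by
  have := (any (F := fun x a => !F x a) (by simpa using hF.not) hl).not
  simpa [List.all_eq_not_any_not] using this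

theorem and {f g : BTree → Bool} (hf : FP fun x => ofBool (f x)) (hg : FP fun x => ofBool (g x)) :
    FP fun x => ofBool (f x && g x) := by
  convert hf.ite hg (const (ofBool false)) using 2 with x
  cases f x <;> simp

theorem drop {f g : BTree → BTree} (hf : FP f) (hg : FP g) :
    FP fun x => ofList ((g x).toList.drop (f x).len) := by
  have key : ∀ (i : ℕ) (y : BTree), BTree.right^[i] y = ofList (y.toList.drop i) := by
    intro i
    induction i with
    | zero => simp
    | succ i ih => intro y; cases y <;> simp [Function.iterate_succ_apply, ih]
  obtain ⟨B, hB, hgB⟩ := hg.exists_size_le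
  have := iterate (S := fun _ => BTree.right) (c := f) (f := g) FP.id.right.right hf hg
    ⟨B, hB, fun x i _ => by
      rw [key]
      refine (size_ofList_le_of_sublist (List.drop_sublist _ _)).trans ?_
      simpa using hgB x⟩
  simpa only [key] using this

theorem take {f g : BTree → BTree} (hf : FP f) (hg : FP g) :
    FP fun x => ofList ((g x).toList.take (f x).len) := by
  let S : BTree → BTree := fun y =>
    if y.left.truth then .node y.left.right (.node y.left.left y.right) else y
  have key : ∀ (i : ℕ) (y acc : BTree), S^[i] (.node y acc) =
      .node (ofList (y.toList.drop i)) (ofList ((y.toList.take i).reverse ++ acc.toList)) := by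
    intro i
    induction i with
    | zero => simp
    | succ i ih =>
      intro y acc
      cases y with
      | leaf => simpa [Function.iterate_succ_apply, S] using ih .leaf acc
      | node a y => simpa [Function.iterate_succ_apply, S] using ih y (.node a acc)
  obtain ⟨B, hB, hgB⟩ := hg.exists_size_le
  have := (iterate (S := fun _ => S) (c := f) (f := fun x => .node (g x) .leaf)
    (FP.id.right.left.ite (FP.id.right.left.right.node (FP.id.right.left.left.node
      FP.id.right.right)) FP.id.right) hf (hg.node (const .leaf))
    ⟨fun n => B n + B n + 1, (hB.add hB).add (.const 1), fun x i _ => by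
      have h₁ := size_ofList_le_of_sublist (List.drop_sublist i (g x).toList)
      have h₂ := size_ofList_le_of_sublist (List.take_sublist i (g x).toList)
      have h₃ := hgB x
      simp only [key, toList_leaf, List.append_nil, size_node, size_ofList_reverse,
        ofList_toList] at *
      omega⟩).right.reverse
  simpa [key] using this

/-- Comparison of unary numbers. -/
theorem len_lt {f g : BTree → BTree} (hf : FP f) (hg : FP g) :
    FP fun x => ofBool (decide ((f x).len < (g x).len)) := by
  convert ((hf.drop hg).not).not using 3 with x
  have := truth_ofList ((g x).toList.drop (f x).len)
  rw [Ne, List.drop_eq_nil_iff, not_le] at this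
  rw [truth_ofBool, Bool.not_not, Bool.eq_iff_iff, decide_eq_true_iff]
  exact this.symm

end FP

/-! ### Loop-free programs -/

/-- The effect of a program without loops and coin tosses. -/
def Prog.evalLF : Prog → BTree → BTree
  | .assign e, s => e.eval s
  | .flip, s => s
  | .seq p q, s => q.evalLF (p.evalLF s)
  | .ite e p q, s => if (e.eval s).truth then p.evalLF s else q.evalLF s
  | .loop _ _, s => s

/-- Programs without loops and coin tosses. -/
def Prog.LoopFree : Prog → Prop
  | .assign _ => True
  | .flip => False
  | .seq p q => p.LoopFree ∧ q.LoopFree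
  | .ite _ p q => p.LoopFree ∧ q.LoopFree
  | .loop _ _ => False

theorem Prog.LoopFree.exists_ev {p : Prog} (hp : p.LoopFree) :
    ∃ C, ∀ s, ∃ τ ≤ C, Ev p s (p.evalLF s) τ := by
  induction p with
  | assign e => exact ⟨1, fun s => ⟨1, le_rfl, .assign e s⟩⟩
  | flip => exact hp.elim
  | seq p q ihp ihq =>
    obtain ⟨C, hC⟩ := ihp hp.1
    obtain ⟨D, hD⟩ := ihq hp.2
    refine ⟨1 + C + D, fun s => ?_⟩
    obtain ⟨τ, hτ, h₁⟩ := hC s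
    obtain ⟨σ, hσ, h₂⟩ := hD (p.evalLF s)
    exact ⟨_, by omega, .seq h₁ h₂⟩
  | ite e p q ihp ihq =>
    obtain ⟨C, hC⟩ := ihp hp.1
    obtain ⟨D, hD⟩ := ihq hp.2
    refine ⟨1 + C + D, fun s => ?_⟩
    obtain ⟨τ, hτ, h₁⟩ := hC s
    obtain ⟨σ, hσ, h₂⟩ := hD s
    by_cases h : (e.eval s).truth = true
    · rw [show (Prog.ite e p q).evalLF s = p.evalLF s from if_pos h]
      exact ⟨_, by omega, .ite_true h h₁⟩
    · rw [show (Prog.ite e p q).evalLF s = q.evalLF s from if_neg h]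
      exact ⟨_, by omega, .ite_false (by simpa using h) h₂⟩
  | loop _ _ => exact hp.elim

/-- Iterating a loop-free program and reading off a bounded amount of information takes polynomial
time, no matter how large the trees become in between. -/
theorem FP.evalLF_iterate {p q : Prog} (hp : p.LoopFree) (hq : q.LoopFree) {a : ℕ}
    (ha : ∀ s, (q.evalLF s).size ≤ a) {c f : BTree → BTree} (hc : FP c) (hf : FP f) :
    FP fun x => q.evalLF (p.evalLF^[(c x).len] (f x)) := by
  obtain ⟨C, hC⟩ := hp.exists_ev
  obtain ⟨D, hD⟩ := hq.exists_ev
  obtain ⟨r, B, hB, hr⟩ := hf.node hc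
  refine ⟨.seq r (.seq p.iterLeft (.seq (.assign (.left .var)) q)),
    fun n => B n + B n * (C + 3) + (D + 5 + a),
    (hB.add (hB.mul (.const (C + 3)))).add (.const _), fun x => ?_⟩
  obtain ⟨⟨τ, hτ, h₁⟩, h₂⟩ := hr x
  obtain ⟨σ, hσ, h₃⟩ := Ev.iterLeft (p := p) (F := p.evalLF) (C := C) (c x) (f x) fun i _ => by
    rw [Function.iterate_succ_apply']
    exact hC _
  obtain ⟨ρ, hρ, h₄⟩ := hD (p.evalLF^[(c x).len] (f x))
  have hlen := (c x).len_lt_size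
  refine ⟨⟨_, ?_, .seq h₁ (.seq h₃ (.seq (.assign _ _) h₄))⟩, (ha _).trans (by simp only; omega)⟩
  have : (c x).len ≤ B x.size := by simp only [size_node] at h₂; omega
  have := Nat.mul_le_mul_right (C + 3) this
  simp only
  omega

/-! ### A universal machine -/

/-- Unary numbers. -/
def num : ℕ → BTree
  | 0 => .leaf
  | i + 1 => .node .leaf (num i)

/-- Machine code: an instruction number with its arguments. -/
def op (i : ℕ) (x : BTree) : BTree := .node (num i) x

/-- Code that evaluates an expression and pushes its value. -/
def Expr.code : Expr → BTree
  | .var => op 0 .leaf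
  | .leaf => op 1 .leaf
  | .node a b => op 7 (.node a.code (op 7 (.node b.code (op 2 .leaf))))
  | .left a => op 7 (.node a.code (op 3 .leaf))
  | .right a => op 7 (.node a.code (op 4 .leaf))

/-- Code of a program. -/
def Prog.code : Prog → BTree
  | .assign e => op 7 (.node e.code (op 5 .leaf))
  | .flip => op 6 .leaf
  | .seq p q => op 7 (.node p.code q.code)
  | .ite e p q => op 7 (.node e.code (op 8 (.node p.code q.code)))
  | .loop e p => op 9 (.node e.code p.code)

/-- States of the universal machine: a list of instructions, a stack of values, the content of
the program variable and a list of coins. -/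
def mState (C V s ρ : BTree) : BTree := .node C (.node V (.node s ρ))

/-- Branch on the unary number given by an expression. -/
def Prog.branch : List Prog → Prog → Expr → Prog
  | [], q, _ => q
  | p :: l, q, e => .ite e (branch l q (.right e)) p

/-- `mState` on expressions. -/
def Expr.mState (C V s ρ : Expr) : Expr := .node C (.node V (.node s ρ))

/-- One step of the universal machine. -/
def mProg : Prog :=
  let C : Expr := .left .var
  let V : Expr := .left (.right .var)
  let s : Expr := .left (.right (.right .var))
  let ρ : Expr := .right (.right (.right .var))
  let C' : Expr := .right C
  let x : Expr := .right (.left C)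
  .ite C
    (Prog.branch [
      -- Instructions 0 to 4 evaluate expressions on the stack `V`, 5 assigns its top, 6 consumes a
      -- coin, 7 puts two instructions on the code list, 8 branches on the top of `V`, 9 unfolds a
      -- loop.
      .assign (.mState C' (.node s V) s ρ),
      .assign (.mState C' (.node .leaf V) s ρ),
      .assign (.mState C' (.node (.node (.left (.right V)) (.left V)) (.right (.right V))) s ρ),
      .assign (.mState C' (.node (.left (.left V)) (.right V)) s ρ),
      .assign (.mState C' (.node (.right (.left V)) (.right V)) s ρ),
      .assign (.mState C' (.right V) (.left V) ρ),
      .assign (.mState C' V (.node (.left ρ) s) (.right ρ)),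
      .assign (.mState (.node (.left x) (.node (.right x) C')) V s ρ),
      .ite (.left V) (.assign (.mState (.node (.left x) C') (.right V) s ρ))
        (.assign (.mState (.node (.right x) C') (.right V) s ρ)),
      -- `left C` is the code of the loop itself, which is put back behind its body. Number 10 is
      -- beyond the table and falls to the default branch, which does nothing.
      .assign (.mState (.node (.left x) (.node (.node (.lit (num 8)) (.node
        (.node (.lit (num 7)) (.node (.right x) (.left C))) (.lit (op 10 .leaf)))) C')) V s ρ)]
      (.assign (.mState C' V s ρ)) (.left (.left C)))
    (.assign .var)

/-- The program that reads off the answer: whether the machine has halted with answer `true`. -/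
def mAnswer : Prog :=
  .ite (.left .var) (.assign .leaf) (.ite (.left (.right (.right .var)))
    (.assign (.lit (ofBool true))) (.assign .leaf))

/-- The answer of the universal machine on the given code, input and coins, within as many machine
steps as the length of the clock. -/
def interp (code x ρ clk : BTree) : BTree :=
  mAnswer.evalLF (mProg.evalLF^[clk.len] (mState (.node code .leaf) .leaf x ρ))

/-- Interpreted programs may build trees of exponential size by sharing, so `FP.iterate` does not
apply. Each machine step still takes bounded time, and only one bit is read off at the end. -/
theorem FP.interp {f g h k : BTree → BTree} (hf : FP f) (hg : FP g) (hh : FP h) (hk : FP k) :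
    FP fun x => interp (f x) (g x) (h x) (k x) := by
  refine FP.evalLF_iterate (a := 3) ?_ ?_ ?_ hk
    ((hf.node (const .leaf)).node ((const .leaf).node (hg.node hh)))
  · simp [mProg, Prog.branch, Prog.LoopFree]
  · simp [mAnswer, Prog.LoopFree]
  · intro s
    simp only [mAnswer, Prog.evalLF, Expr.eval, Expr.eval_lit]
    split_ifs <;> simp [ofBool]

/-- Number of machine steps for the evaluation of an expression. -/
def Expr.cost : Expr → ℕ
  | .var => 1
  | .leaf => 1
  | .node a b => a.cost + b.cost + 3
  | .left a => a.cost + 2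
  | .right a => a.cost + 2

/-- Bound for the number of machine steps for one step of a program. -/
def Prog.cost : Prog → ℕ
  | .assign e => e.cost + 2
  | .flip => 1
  | .seq p q => 1 + p.cost + q.cost
  | .ite e p q => e.cost + 2 + p.cost + q.cost
  | .loop e p => e.cost + 3 + p.cost

theorem mProg_op_ite (a p q C V s ρ : BTree) :
    mProg.evalLF (mState (.node (op 8 (.node p q)) C) (.node a V) s ρ) =
      mState (.node (if a.truth then p else q) C) V s ρ := by
  cases a <;> rfl

theorem mProg_iterate_expr (e : Expr) (C V s ρ : BTree) :
    mProg.evalLF^[e.cost] (mState (.node e.code C) V s ρ) =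
      mState C (.node (e.eval s) V) s ρ := by
  induction e generalizing C V with
  | var => rfl
  | leaf => rfl
  | node a b iha ihb =>
    rw [show (Expr.node a b).cost = 1 + (b.cost + (1 + (a.cost + 1))) by simp [Expr.cost]; omega,
      Function.iterate_add_apply, Function.iterate_add_apply _ b.cost,
      Function.iterate_add_apply _ 1 (a.cost + 1), Function.iterate_succ_apply _ a.cost,
      show mProg.evalLF (mState (.node (Expr.node a b).code C) V s ρ) =
        mState (.node a.code (.node (op 7 (.node b.code (op 2 .leaf))) C)) V s ρ from rfl, iha,
      show mProg.evalLF^[1] (mState (.node (op 7 (.node b.code (op 2 .leaf))) C)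
        (.node (a.eval s) V) s ρ) = mState (.node b.code (.node (op 2 .leaf) C))
        (.node (a.eval s) V) s ρ from rfl, ihb]
    rfl
  | left a ih =>
    rw [show (Expr.left a).cost = 1 + (a.cost + 1) by simp [Expr.cost]; omega,
      Function.iterate_add_apply, Function.iterate_succ_apply _ a.cost,
      show mProg.evalLF (mState (.node (Expr.left a).code C) V s ρ) =
        mState (.node a.code (.node (op 3 .leaf) C)) V s ρ from rfl, ih]
    rfl
  | right a ih =>
    rw [show (Expr.right a).cost = 1 + (a.cost + 1) by simp [Expr.cost]; omega,
      Function.iterate_add_apply, Function.iterate_succ_apply _ a.cost,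
      show mProg.evalLF (mState (.node (Expr.right a).code C) V s ρ) =
        mState (.node a.code (.node (op 4 .leaf) C)) V s ρ from rfl, ih]
    rfl

/-- One step of the computation with the coins given in advance. -/
def dstep : Config × List Bool → Config × List Bool
  | (([], s), ρ) => (([], s), ρ)
  | ((.assign e :: c, s), ρ) => ((c, e.eval s), ρ)
  | ((.flip :: c, s), ρ) => ((c, .node (ofBool (ρ.headD false)) s), ρ.tail)
  | ((.seq p q :: c, s), ρ) => ((p :: q :: c, s), ρ)
  | ((.ite e p q :: c, s), ρ) => (if (e.eval s).truth then (p :: c, s) else (q :: c, s), ρ)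
  | ((.loop e p :: c, s), ρ) =>
      (if (e.eval s).truth then (p :: .loop e p :: c, s) else (c, s), ρ)

/-- The state of the universal machine that represents a configuration. -/
def mRepr (x : Config × List Bool) : BTree :=
  mState (ofList (x.1.1.map Prog.code)) .leaf x.1.2 (ofList (x.2.map ofBool))

/-- `K` bounds the cost of everything on the code list. The bound persists because a program costs
at least as much as each program it is replaced by, so the slowdown is a constant depending only on
the initial program. -/
theorem mProg_dstep (K : ℕ) (x : Config × List Bool) (hx : ∀ q ∈ x.1.1, q.cost ≤ K) :
    (∃ n ≤ K, mProg.evalLF^[n] (mRepr x) = mRepr (dstep x)) ∧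
      ∀ q ∈ (dstep x).1.1, q.cost ≤ K := by
  obtain ⟨⟨c, s⟩, ρ⟩ := x
  cases c with
  | nil => exact ⟨⟨0, Nat.zero_le _, rfl⟩, by simp [dstep]⟩
  | cons p c =>
    have hp : p.cost ≤ K := hx p List.mem_cons_self
    have hc : ∀ q ∈ c, q.cost ≤ K := fun q hq => hx q (List.mem_cons_of_mem _ hq)
    cases p with
    | assign e =>
      refine ⟨⟨1 + (e.cost + 1), by simp only [Prog.cost] at hp; omega, ?_⟩, hc⟩
      rw [Function.iterate_add_apply, Function.iterate_succ_apply]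
      exact congrArg mProg.evalLF (mProg_iterate_expr e _ _ _ _)
    | flip =>
      refine ⟨⟨1, by simpa only [Prog.cost] using hp, ?_⟩, hc⟩
      cases ρ <;> rfl
    | seq p q =>
      simp only [Prog.cost] at hp
      refine ⟨⟨1, by omega, rfl⟩, fun r hr => ?_⟩
      simp only [dstep, List.mem_cons] at hr
      rcases hr with rfl | rfl | hr
      · omega
      · omega
      · exact hc r hr
    | ite e p q =>
      simp only [Prog.cost] at hp
      refine ⟨⟨1 + (e.cost + 1), by omega, ?_⟩, fun r hr => ?_⟩
      · rw [Function.iterate_add_apply, Function.iterate_succ_apply]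
        refine (congrArg mProg.evalLF (mProg_iterate_expr e _ _ _ _)).trans
          ((mProg_op_ite (e.eval s) p.code q.code (ofList (c.map Prog.code)) .leaf s
            (ofList (ρ.map ofBool))).trans ?_)
        simp only [dstep]
        cases (e.eval s).truth <;> rfl
      · simp only [dstep] at hr
        split_ifs at hr
        all_goals
          rcases List.mem_cons.1 hr with rfl | hr
          · omega
          · exact hc r hr
    | loop e p =>
      have hp' := hp
      simp only [Prog.cost] at hp
      refine ⟨⟨1 + (1 + (e.cost + 1)), by omega, ?_⟩, fun r hr => ?_⟩
      · rw [Function.iterate_add_apply, Function.iterate_add_apply _ 1,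
          Function.iterate_succ_apply]
        refine (congrArg (fun z => mProg.evalLF (mProg.evalLF z))
          (mProg_iterate_expr e _ _ _ _)).trans ((congrArg mProg.evalLF (mProg_op_ite (e.eval s)
            (op 7 (.node p.code (Prog.loop e p).code)) (op 10 .leaf) (ofList (c.map Prog.code)) .leaf s (ofList (ρ.map ofBool)))).trans ?_)
        simp only [dstep]
        cases (e.eval s).truth <;> rfl
      · simp only [dstep] at hr
        split_ifs at hr
        · simp only [List.mem_cons] at hr
          rcases hr with rfl | rfl | hr
          · omega
          · exact hp'
          · exact hc r hr
        · exact hc r hr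

theorem mProg_dstep_iterate (K T : ℕ) (x : Config × List Bool) (hx : ∀ q ∈ x.1.1, q.cost ≤ K) :
    ∃ n ≤ K * T, mProg.evalLF^[n] (mRepr x) = mRepr (dstep^[T] x) := by
  induction T generalizing x with
  | zero => exact ⟨0, by simp, rfl⟩
  | succ T ih =>
    obtain ⟨⟨n, hn, h₁⟩, h₂⟩ := mProg_dstep K x hx
    obtain ⟨m, hm, h₃⟩ := ih (dstep x) h₂
    refine ⟨m + n, by rw [mul_add, mul_one]; omega, ?_⟩
    rw [Function.iterate_add_apply, h₁, h₃, Function.iterate_succ_apply]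

/-- The universal machine gives the answer of the program. -/
theorem interp_code (P : Prog) (T : ℕ) (x clk : BTree) (ρ : List Bool) (b : Bool)
    (h : answer (dstep^[T] (([P], x), ρ)).1 = some b) (hT : P.cost * T ≤ clk.len) :
    interp P.code x (ofList (ρ.map ofBool)) clk = ofBool b := by
  obtain ⟨n, hn, h₁⟩ := mProg_dstep_iterate P.cost T (([P], x), ρ) (by simp)
  generalize dstep^[T] (([P], x), ρ) = y at h h₁
  obtain ⟨⟨c, s⟩, ρ'⟩ := y
  cases c with
  | cons p c => simp [answer] at h
  | nil =>
    obtain ⟨m, hm⟩ := Nat.exists_eq_add_of_le (hn.trans hT)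
    -- A halted state is fixed by `mProg`, so surplus clock ticks change nothing.
    have hfix : ∀ m, mProg.evalLF^[m] (mRepr (([], s), ρ')) = mRepr (([], s), ρ') :=
      fun m => Function.iterate_fixed rfl m
    have : mProg.evalLF^[clk.len] (mState (.node P.code .leaf) .leaf x (ofList (ρ.map ofBool))) =
        mRepr (([], s), ρ') := by
      rw [hm, add_comm, Function.iterate_add_apply, ← hfix m, ← h₁]
      rfl
    rw [interp, this]
    simp only [answer, Option.some.injEq] at h
    subst h
    cases s <;> rfl

/-! ### Probabilities on finite types -/

open Classical in
/-- The probability of an event under the uniform distribution on a finite type. -/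
noncomputable def pr {Ω : Type*} [Fintype Ω] (p : Ω → Prop) : ℝ :=
  (Finset.univ.filter p).card / Fintype.card Ω

/-- The expectation under the uniform distribution on a finite type. -/
noncomputable def avg {Ω : Type*} [Fintype Ω] (f : Ω → ℝ≥0∞) : ℝ≥0∞ :=
  (∑ ω, f ω) / Fintype.card Ω

section pr

variable {Ω Ω' : Type*} [Fintype Ω] [Fintype Ω']

theorem pr_eq (p : Ω → Prop) [DecidablePred p] :
    pr p = (Finset.univ.filter p).card / Fintype.card Ω := by
  unfold pr
  congr

theorem pr_nonneg (p : Ω → Prop) : 0 ≤ pr p := by unfold pr; positivity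

theorem pr_mono {p q : Ω → Prop} (h : ∀ ω, p ω → q ω) : pr p ≤ pr q := by
  classical
  simp only [pr_eq]
  gcongr with ω
  exact h _

theorem pr_congr {p q : Ω → Prop} (h : ∀ ω, p ω ↔ q ω) : pr p = pr q :=
  le_antisymm (pr_mono fun ω => (h ω).1) (pr_mono fun ω => (h ω).2)

theorem pr_true [Nonempty Ω] : pr (fun _ : Ω => True) = 1 := by
  simp [pr]

theorem pr_le_one (p : Ω → Prop) : pr p ≤ 1 := by
  classical
  simp only [pr_eq]
  exact div_le_one_of_le₀ (by exact_mod_cast Finset.card_le_univ _) (by positivity)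

theorem pr_false : pr (fun _ : Ω => False) = 0 := by simp [pr]

theorem pr_not [Nonempty Ω] (p : Ω → Prop) : pr (fun ω => ¬ p ω) = 1 - pr p := by
  classical
  simp only [pr_eq]
  rw [eq_sub_iff_add_eq, ← add_div, div_eq_one_iff_eq (by simp [Fintype.card_ne_zero]),
    add_comm]
  norm_cast
  rw [← Finset.card_univ]
  exact Finset.card_filter_add_card_filter_not (s := (Finset.univ : Finset Ω)) p

theorem pr_or_le (p q : Ω → Prop) : pr (fun ω => p ω ∨ q ω) ≤ pr p + pr q := by
  classical
  simp only [pr_eq]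
  rw [← add_div, Finset.filter_or]
  gcongr
  exact_mod_cast Finset.card_union_le _ _

theorem pr_exists_le {ι : Type*} (s : Finset ι) (p : ι → Ω → Prop) :
    pr (fun ω => ∃ i ∈ s, p i ω) ≤ ∑ i ∈ s, pr (p i) := by
  classical
  induction s using Finset.induction_on with
  | empty => simp [pr_false]
  | insert a s ha ih =>
    rw [Finset.sum_insert ha]
    refine (pr_mono fun ω h => ?_).trans ((pr_or_le (p a) _).trans (by gcongr))
    simpa using h

theorem pr_equiv (e : Ω ≃ Ω') (p : Ω' → Prop) : pr (fun ω => p (e ω)) = pr p := by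
  classical
  simp only [pr_eq]
  rw [Fintype.card_congr e]
  congr 2
  refine Finset.card_bij (fun ω _ => e ω) (by simp) (by simp) fun ω h => ⟨e.symm ω, by simpa using h⟩

theorem pr_prod (p : Ω → Prop) (q : Ω → Ω' → Prop) {a : ℝ} (ha : ∀ ω, p ω → a ≤ pr (q ω)) :
    pr p * a ≤ pr (fun ω : Ω × Ω' => p ω.1 ∧ q ω.1 ω.2) := by
  classical
  simp only [pr_eq]
  rcases isEmpty_or_nonempty Ω' with h | h
  · have : ∀ ω, p ω → a ≤ 0 := fun ω hω => (ha ω hω).trans (by simp [pr])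
    by_cases hp : ∃ ω, p ω
    · obtain ⟨ω, hω⟩ := hp
      refine (mul_nonpos_of_nonneg_of_nonpos (by positivity) (this ω hω)).trans (by positivity)
    · push Not at hp
      simp [hp]
  have hcard : ((Finset.univ.filter fun ω : Ω × Ω' => p ω.1 ∧ q ω.1 ω.2).card : ℝ) =
      ∑ ω ∈ Finset.univ.filter p, ((Finset.univ.filter (q ω)).card : ℝ) := by
    norm_cast
    rw [← Finset.card_sigma]
    refine Finset.card_bij' (fun ω _ => ⟨ω.1, ω.2⟩) (fun ω _ => (ω.1, ω.2)) ?_ ?_ ?_ ?_ <;> simp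
  have h0 : (0 : ℝ) < Fintype.card Ω' := by exact_mod_cast Fintype.card_pos
  rw [hcard, Fintype.card_prod, Nat.cast_mul, ← div_div, div_mul_eq_mul_div, div_right_comm]
  gcongr
  rw [le_div_iff₀ h0, mul_assoc, ← nsmul_eq_mul]
  refine Finset.card_nsmul_le_sum _ _ _ fun ω hω => ?_
  rw [← le_div_iff₀ h0]
  exact ha ω (by simpa using hω)

theorem pr_pi {ι : Type*} [Fintype ι] [DecidableEq ι] (p : ι → Ω → Prop) :
    pr (fun ω : ι → Ω => ∀ i, p i (ω i)) = ∏ i, pr (p i) := by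
  classical
  simp only [pr_eq]
  rw [Finset.prod_div_distrib]
  congr 1
  · norm_cast
    rw [← Fintype.card_piFinset]
    congr 1
    ext ω
    simp [Fintype.mem_piFinset]
  · simp

theorem avg_const [Nonempty Ω] (a : ℝ≥0∞) : avg (fun _ : Ω => a) = a := by
  simp only [avg, Finset.sum_const, Finset.card_univ, nsmul_eq_mul]
  rw [mul_comm]
  exact ENNReal.mul_div_cancel_right (by simp [Fintype.card_ne_zero]) (by simp)

theorem avg_mono {f g : Ω → ℝ≥0∞} (h : ∀ ω, f ω ≤ g ω) : avg f ≤ avg g := by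
  unfold avg
  gcongr with ω
  exact h ω

theorem avg_equiv (e : Ω ≃ Ω') (f : Ω' → ℝ≥0∞) : avg (fun ω => f (e ω)) = avg f := by
  unfold avg
  rw [Fintype.card_congr e, e.sum_comp]

theorem avg_prod (f : Ω × Ω' → ℝ≥0∞) : avg (fun ω => avg fun ω' => f (ω, ω')) = avg f := by
  unfold avg
  rw [Fintype.sum_prod_type, Fintype.card_prod]
  simp only [div_eq_mul_inv]
  rw [← Finset.sum_mul, Nat.cast_mul, ENNReal.mul_inv (by simp) (by simp), mul_assoc,
    mul_comm (_⁻¹ : ℝ≥0∞)]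

theorem avg_bool (f : Bool → ℝ≥0∞) : avg f = (f true + f false) / 2 := by
  simp [avg]

open Classical in
theorem avg_ite (p : Ω → Prop) [Nonempty Ω] : avg (fun ω => if p ω then 1 else 0) =
    ENNReal.ofReal (pr p) := by
  unfold avg
  rw [pr_eq]
  rw [ENNReal.ofReal_div_of_pos (by exact_mod_cast Fintype.card_pos)]
  simp

end pr

/-! ### Probability of acceptance and reduction of configurations -/

/-- The probability of a given answer within `T` steps. -/
noncomputable def ansProb (T : ℕ) (x : Config) (o : Option Bool) : ℝ≥0∞ := ((run T x).map answer) o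

/-- The probability of the answer `true` within `T` steps. -/
noncomputable def win (T : ℕ) (x : Config) : ℝ≥0∞ := ansProb T x (some true)

open Classical in
theorem ansProb_zero (x : Config) (o : Option Bool) :
    ansProb 0 x o = if answer x = o then 1 else 0 := by
  simp [ansProb, run, PMF.pure_map, PMF.pure_apply, eq_comm]

theorem ansProb_succ_of_pure {x y : Config} (h : step x = PMF.pure y) (T : ℕ) (o : Option Bool) :
    ansProb (T + 1) x o = ansProb T y o := by
  simp [ansProb, run, h]

theorem ansProb_succ_flip (c : List Prog) (s : BTree) (T : ℕ) (o : Option Bool) :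
    ansProb (T + 1) (.flip :: c, s) o =
      avg fun b => ansProb T (c, .node (ofBool b) s) o := by
  simp only [ansProb, run, step, PMF.map_bind, PMF.bind_map, PMF.bind_apply, tsum_bool,
    PMF.uniformOfFintype_apply, Function.comp_apply, avg_bool]
  simp [← mul_add, div_eq_mul_inv]
  ring

theorem ansProb_halted (T : ℕ) (s : BTree) : ansProb T ([], s) (some s.truth) = 1 := by
  induction T with
  | zero => simp [ansProb_zero, answer]
  | succ T ih => rw [ansProb_succ_of_pure (by rfl), ih]

/-- Halted configurations do not change. The restriction to `some b` matters: the probability of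
`none` can decrease with time. -/
theorem ansProb_le_succ (T : ℕ) (x : Config) (b : Bool) :
    ansProb T x (some b) ≤ ansProb (T + 1) x (some b) := by
  induction T generalizing x with
  | zero =>
    obtain ⟨c, s⟩ := x
    rw [ansProb_zero]
    split_ifs with h
    · cases c with
      | nil =>
        simp only [answer, Option.some.injEq] at h
        rw [← h, ansProb_halted]
      | cons p c => simp [answer] at h
    · exact zero_le
  | succ T ih =>
    obtain ⟨c, s⟩ := x
    rcases c with _ | ⟨p, c⟩
    · rw [ansProb_succ_of_pure (by rfl), ansProb_succ_of_pure (by rfl)]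
      exact ih _
    · cases p with
      | flip =>
        rw [ansProb_succ_flip, ansProb_succ_flip]
        exact avg_mono fun b => ih _
      | _ =>
        rw [ansProb_succ_of_pure (by rfl), ansProb_succ_of_pure (by rfl)]
        exact ih _

theorem win_mono {T T' : ℕ} (h : T ≤ T') (x : Config) : win T x ≤ win T' x :=
  monotone_nat_of_le_succ (f := fun T => win T x) (fun T => ansProb_le_succ T x true) h

theorem win_zero_cons (p : Prog) (c : List Prog) (s : BTree) : win 0 (p :: c, s) = 0 := by
  simp [win, ansProb_zero, answer]

/-- From the configuration `x` the machine arrives after exactly `τ` steps at the configuration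
`Y ω`, with `ω` uniformly random, without having halted before. -/
def SReduces {Ω : Type} [Fintype Ω] (τ : ℕ) (x : Config) (Y : Ω → Config) : Prop :=
  (∀ T, win (T + τ) x = avg fun ω => win T (Y ω)) ∧ ∀ T < τ, win T x = 0

/-- From the configuration `x` the machine arrives after exactly `τ` steps at the configuration
`y`, without having halted before. -/
def Reduces (τ : ℕ) (x y : Config) : Prop :=
  (∀ T, win (T + τ) x = win T y) ∧ ∀ T < τ, win T x = 0

theorem Reduces.of_step {p : Prog} {c : List Prog} {s : BTree} {y : Config}
    (h : step (p :: c, s) = PMF.pure y) : Reduces 1 (p :: c, s) y :=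
  ⟨fun T => ansProb_succ_of_pure h T _, fun T hT => by
    obtain rfl : T = 0 := by omega
    exact win_zero_cons _ _ _⟩

theorem Reduces.trans {x y z : Config} {τ σ : ℕ} (h : Reduces τ x y) (h' : Reduces σ y z) :
    Reduces (τ + σ) x z := by
  refine ⟨fun T => ?_, fun T hT => ?_⟩
  · rw [show T + (τ + σ) = T + σ + τ by omega, h.1, h'.1]
  · rcases lt_or_ge T τ with hlt | hge
    · exact h.2 T hlt
    · obtain ⟨T, rfl⟩ := Nat.exists_eq_add_of_le' hge
      rw [h.1, h'.2 T (by omega)]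

theorem Reduces.assign (e : Expr) (c : List Prog) (s : BTree) :
    Reduces 1 (.assign e :: c, s) (c, e.eval s) := .of_step rfl

theorem Reduces.seq (p q : Prog) (c : List Prog) (s : BTree) :
    Reduces 1 (.seq p q :: c, s) (p :: q :: c, s) := .of_step rfl

theorem Reduces.loop_true {e : Expr} {p : Prog} {c : List Prog} {s : BTree}
    (h : (e.eval s).truth = true) : Reduces 1 (.loop e p :: c, s) (p :: .loop e p :: c, s) :=
  .of_step (by simp [step, h])

theorem Reduces.loop_false {e : Expr} {p : Prog} {c : List Prog} {s : BTree}
    (h : (e.eval s).truth = false) : Reduces 1 (.loop e p :: c, s) (c, s) :=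
  .of_step (by simp [step, h])

theorem Ev.reduces {p : Prog} {s s' : BTree} {τ : ℕ} (h : Ev p s s' τ) (c : List Prog) :
    Reduces τ (p :: c, s) (c, s') := by
  induction h generalizing c with
  | assign e s => exact .assign e c s
  | seq _ _ ih₁ ih₂ => exact ((Reduces.seq _ _ _ _).trans (ih₁ _)).trans (ih₂ _)
  | ite_true he _ ih => exact (Reduces.of_step (by simp [step, he])).trans (ih _)
  | ite_false he _ ih => exact (Reduces.of_step (by simp [step, he])).trans (ih _)
  | loop_false he => exact .loop_false he
  | loop_true he _ _ ih₁ ih₂ =>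
    exact ((Reduces.loop_true he).trans (ih₁ _)).trans (ih₂ _)

section SReduces

variable {Ω Ω' : Type} [Fintype Ω] [Fintype Ω']

theorem Reduces.trans_sReduces {x y : Config} {Z : Ω → Config} {τ σ : ℕ} (h : Reduces τ x y)
    (h' : SReduces σ y Z) : SReduces (τ + σ) x Z := by
  refine ⟨fun T => ?_, fun T hT => ?_⟩
  · rw [show T + (τ + σ) = T + σ + τ by omega, h.1, h'.1]
  · rcases lt_or_ge T τ with hlt | hge
    · exact h.2 T hlt
    · obtain ⟨T, rfl⟩ := Nat.exists_eq_add_of_le' hge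
      rw [h.1, h'.2 T (by omega)]

theorem SReduces.trans {x : Config} {Y : Ω → Config} {Z : Ω → Ω' → Config} {τ σ : ℕ}
    (h : SReduces τ x Y) (h' : ∀ ω, SReduces σ (Y ω) (Z ω)) :
    SReduces (τ + σ) x fun ω : Ω × Ω' => Z ω.1 ω.2 := by
  refine ⟨fun T => ?_, fun T hT => ?_⟩
  · rw [show T + (τ + σ) = T + σ + τ by omega, h.1, ← avg_prod]
    simp only [(h' _).1]
  · rcases lt_or_ge T τ with hlt | hge
    · exact h.2 T hlt
    · obtain ⟨T, rfl⟩ := Nat.exists_eq_add_of_le' hge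
      rw [h.1]
      simp [(h' _).2 T (by omega), avg]

theorem SReduces.trans_reduces {x : Config} {Y Z : Ω → Config} {τ σ : ℕ}
    (h : SReduces τ x Y) (h' : ∀ ω, Reduces σ (Y ω) (Z ω)) : SReduces (τ + σ) x Z := by
  refine ⟨fun T => ?_, fun T hT => ?_⟩
  · rw [show T + (τ + σ) = T + σ + τ by omega, h.1]
    simp only [(h' _).1]
  · rcases lt_or_ge T τ with hlt | hge
    · exact h.2 T hlt
    · obtain ⟨T, rfl⟩ := Nat.exists_eq_add_of_le' hge
      rw [h.1]
      simp [(h' _).2 T (by omega), avg]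

theorem SReduces.equiv {x : Config} {Y : Ω → Config} {τ : ℕ} (h : SReduces τ x Y) (e : Ω' ≃ Ω) :
    SReduces τ x fun ω => Y (e ω) :=
  ⟨fun T => by rw [h.1, ← avg_equiv e], h.2⟩

theorem SReduces.flip (c : List Prog) (s : BTree) :
    SReduces 1 (.flip :: c, s) fun b : Bool => (c, .node (ofBool b) s) :=
  ⟨fun T => ansProb_succ_flip c s T _, fun T hT => by
    obtain rfl : T = 0 := by omega
    exact win_zero_cons _ _ _⟩

end SReduces

/-! ### Random arrays -/

/-- Repeat the sampling program `p` while a clock runs, and collect the results in a list. -/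
def Prog.repLoop (p : Prog) : Prog :=
  .loop (.left (.right .var)) (.seq p
    (.assign (.node (.node (.left .var) (.left (.right .var)))
      (.node (.right (.left (.right (.right .var)))) (.right (.right (.right .var)))))))

/-- Repeat the sampling program `p` once for each element of the value of `e`, and attach the list
of the results on the left of the current tree. -/
def Prog.rep (e : Expr) (p : Prog) : Prog :=
  .seq (.assign (.node .leaf (.node e .var)))
    (.seq p.repLoop (.assign (.node (.left .var) (.right (.right .var)))))

theorem SReduces.repLoop {Ω : Type} [Fintype Ω] {p : Prog} {s : BTree} {F : Ω → BTree} {τ : ℕ}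
    (hp : ∀ acc clk c, SReduces τ (p :: c, .node acc (.node clk s))
      fun ω => (c, .node (F ω) (.node acc (.node clk s)))) {m : ℕ} (clk acc : BTree)
    (c : List Prog) (hm : clk.len = m) :
    SReduces (m * (τ + 3) + 1) (p.repLoop :: c, .node acc (.node clk s))
      fun ω : Fin m → Ω => (c, .node (ofList ((List.ofFn fun i => F (ω i)) ++ acc.toList))
        (.node .leaf s)) := by
  induction m generalizing clk acc with
  | zero =>
    cases clk with
    | node a clk => simp at hm
    | leaf =>
      have h : Reduces 1 (p.repLoop :: c, .node acc (.node .leaf s))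
          (c, .node acc (.node .leaf s)) := .loop_false rfl
      refine ⟨fun T => ?_, fun T hT => h.2 T (by simpa using hT)⟩
      simp only [List.ofFn_zero, List.nil_append, ofList_toList]
      rw [avg_const, ← h.1]
      simp
  | succ m ih =>
    cases clk with
    | leaf => simp at hm
    | node a clk =>
      have h₀ : Reduces 1 (p.repLoop :: c, .node acc (.node (.node a clk) s)) _ :=
        Reduces.loop_true rfl
      have h₁ := ((h₀.trans (Reduces.seq _ _ _ _)).trans_sReduces
        (hp acc (.node a clk) (_ :: p.repLoop :: c))).trans_reduces fun ω => Reduces.assign _ _ _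
      -- Results are pushed in front, so the first sample ends up last in the list; hence the last
      -- coordinate is split off.
      have h₂ := (h₁.trans fun ω => ih clk (.node (F ω) acc) (by simpa using hm)).equiv
        (Fin.snocEquiv fun _ : Fin (m + 1) => Ω).symm
      convert h₂ using 1
      · ring
      · funext ω
        rw [List.ofFn_succ', List.concat_eq_append]
        simp [Fin.snocEquiv, Fin.init]

theorem SReduces.rep {Ω : Type} [Fintype Ω] {p : Prog} {s : BTree} {F : Ω → BTree} {τ : ℕ}
    (hp : ∀ acc clk c, SReduces τ (p :: c, .node acc (.node clk s))
      fun ω => (c, .node (F ω) (.node acc (.node clk s)))) {m : ℕ} (e : Expr) (c : List Prog)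
    (hm : (e.eval s).len = m) :
    SReduces (m * (τ + 3) + 5) (.rep e p :: c, s)
      fun ω : Fin m → Ω => (c, .node (ofList (List.ofFn fun i => F (ω i))) s) := by
  have h₀ : Reduces 3 (.rep e p :: c, s) (p.repLoop ::
      .assign (.node (.left .var) (.right (.right .var))) :: c, .node .leaf (.node (e.eval s) s)) :=
    ((Reduces.seq _ _ c s).trans (Reduces.assign _ _ _)).trans (Reduces.seq _ _ _ _)
  have h := h₀.trans_sReduces (SReduces.repLoop hp (e.eval s) .leaf _ hm)
  have h' := h.trans_reduces fun ω => Reduces.assign _ _ _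
  convert h' using 1
  · ring
  · funext ω
    simp [Expr.eval]

/-! ### Coins given in advance -/

/-- The answer of a randomized computation has the distribution of the answer of the computation
with uniformly random coins given in advance. -/
theorem ansProb_eq_pr {T t : ℕ} (h : T ≤ t) (x : Config) (o : Option Bool) :
    ansProb T x o =
      ENNReal.ofReal (pr fun ρ : Fin t → Bool => answer (dstep^[T] (x, List.ofFn ρ)).1 = o) := by
  classical
  rw [← avg_ite]
  induction T generalizing x t with
  | zero =>
    rw [ansProb_zero]
    convert (avg_const (Ω := Fin t → Bool) (if answer x = o then 1 else 0)).symm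
    rfl
  | succ T ih =>
    obtain ⟨c, s⟩ := x
    rcases c with _ | ⟨p, c⟩
    · rw [ansProb_succ_of_pure (by rfl), ih (t := t) (by omega)]
      rfl
    · cases p with
      | flip =>
        -- A step uses at most one coin, so `T ≤ t` guarantees that one is left.
        obtain ⟨t, rfl⟩ : ∃ t', t = t' + 1 := ⟨t - 1, by omega⟩
        rw [ansProb_succ_flip, ← avg_equiv (Fin.consEquiv fun _ : Fin (t + 1) => Bool), ← avg_prod]
        congr 1
        funext b
        rw [ih (t := t) (by omega)]
        congr 1
        funext ρ
        simp [Function.iterate_succ_apply, dstep, Fin.consEquiv, List.ofFn_succ]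
      | _ =>
        rw [ansProb_succ_of_pure (by rfl), ih (t := t) (by omega)]
        rfl

/-! ### The search for a certificate -/

theorem len_num (i : ℕ) : (num i).len = i := by
  induction i with
  | zero => rfl
  | succ i ih => simp [num, ih]

theorem size_num (i : ℕ) : (num i).size = 2 * i + 1 := by
  induction i with
  | zero => rfl
  | succ i ih => simp [num, ih]; omega

theorem toList_num (i : ℕ) : (num i).toList = List.replicate i .leaf := by
  induction i with
  | zero => rfl
  | succ i ih => simp [num, ih, List.replicate_succ]

theorem ofList_replicate (i : ℕ) : ofList (List.replicate i .leaf) = num i := by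
  rw [← toList_num, ofList_toList]

/-- The entry of an adjacency matrix in the row `u` and the column `v`. -/
def adjT (G u v : BTree) : Bool :=
  (ofList ((ofList (G.toList.drop u.len)).left.toList.drop v.len)).left.truth

/-- Whether all vertices in `B` are adjacent to all vertices in `B'`. -/
def blockAdj (G B B' : BTree) : Bool := B.toList.all fun u => B'.toList.all fun v => adjT G u v

/-- The adjacency matrix of the graph of blocks. -/
def blockMatrix (G L : BTree) : BTree :=
  ofList (L.toList.map fun B => ofList (L.toList.map fun B' => ofBool (blockAdj G B B')))

/-- The majority answer of the program with the given code on the input `M`, for the lists of coins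
in `r`. -/
def majority (code M r clk : BTree) : Bool :=
  decide ((ofList (r.toList.filter fun ρ => (ofBool (!(interp code M ρ clk).truth)).truth)).len <
    (ofList (r.toList.filter fun ρ => (interp code M ρ clk).truth)).len)

/-- Discard the first of the remaining blocks if a copy of the pattern remains, and keep it
otherwise. -/
def searchStep (G code r clk y : BTree) : BTree :=
  if (ofBool (majority code (blockMatrix G (ofList (y.left.toList ++ y.right.right.toList)))
    r clk)).truth then .node y.left y.right.right
  else .node (.node y.right.left y.left) y.right.right

/-- A minimal list of blocks that contains a copy of the pattern. -/
def search (G code r clk L : BTree) : BTree :=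
  ((searchStep G code r clk)^[L.len] (.node .leaf L)).left

/-- The unary representation of a binary number, cut off at `cap`. -/
def unary (cap bits : BTree) : BTree :=
  bits.toList.foldl (fun acc b => ofList ((ofList ((ofList (acc.toList ++ acc.toList)).toList ++
    (if b.truth then BTree.node .leaf .leaf else .leaf).toList)).toList.take cap.len)) .leaf

/-- The list of the numbers up to the length of a list. -/
def upTo (G : BTree) : BTree :=
  G.toList.foldl (fun acc _ => .node (.node .leaf acc.left) acc) (.node .leaf .leaf)

/-- Membership of a vertex in a block. -/
def memBlock (u B : BTree) : Bool :=
  B.toList.any fun w => !(ofBool (decide (u.len < w.len))).truth &&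
    !(ofBool (decide (w.len < u.len))).truth

/-- Whether `u` and `v` lie in adjacent blocks. -/
def covered (G L u v : BTree) : Bool :=
  L.toList.any fun B => memBlock u B && L.toList.any fun B' => memBlock v B' && blockAdj G B B'

/-- The list of the pairs of vertices that lie in adjacent blocks. -/
def coveredPairs (G L : BTree) : BTree :=
  ofList ((upTo G).toList.flatMap fun u =>
    (ofList ((upTo G).toList.filter fun v => (ofBool (covered G L u v)).truth)).toList)

/-- A list whose length is the number of covered pairs required of a certificate. -/
def threshold (γ L : BTree) : BTree :=
  ofList ((num 8).toList.flatMap fun _ =>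
    (ofList ((ofList (L.toList.flatMap fun B => (ofList (B.toList.flatMap fun _ =>
      γ.toList)).toList)).toList ++ (ofList (L.toList.flatMap fun _ => L.toList)).toList)).toList)

/-- Verification of a certificate. -/
def certified (G γ L : BTree) : Bool :=
  decide ((threshold γ L).len < (coveredPairs G L).len) &&
    -- The digits of `γ` after a leading 1 must denote a number of at least `n`, which forces `n ≤ 2
    -- ^ (γ.len + 1)`. Otherwise a short guess for `γ` could lower the threshold at will.
    !(ofBool (decide ((unary G (.node (ofBool true) γ)).len < G.len))).truth

/-- The tree with a given postfix notation. -/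
def parse (r : BTree) : BTree :=
  -- A stack machine for postfix notation: a true bit pushes a leaf, a false bit joins the two top
  -- entries.
  (r.toList.foldl (fun st (b : BTree) => if b.truth then BTree.node .leaf st
    else .node (.node st.right.left st.left) st.right.right) .leaf).left

/-- Random blocks of vertices. -/
def blocks (G clk e ell γ r : BTree) : BTree :=
  -- A unary number `e` consists of false digits, so with a leading 1 it denotes `2 ^ e`. The
  -- guessed description thus has length linear in `e`, while the cap keeps the number of blocks
  -- below the clock.
  ofList ((ofList (r.toList.take (unary clk (.node (ofBool true) e)).len)).toList.map fun row =>
    ofList ((ofList (row.toList.take ell.len)).toList.map fun ch =>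
      unary G (ofList (ch.toList.take γ.len))))

/-- The search with given random bits. -/
def accepts (G clk r₁ r₂ r₃ : BTree) : Bool :=
  certified G (parse r₁).right.right.right (search G (parse r₁).left r₃ clk
    (blocks G clk (parse r₁).right.left (parse r₁).right.right.left
      (parse r₁).right.right.right r₂))

/-! ### Arithmetic of unary numbers -/

theorem unary_eq_num (cap bits : BTree) : unary cap bits =
    num (bits.toList.foldl (fun a b => min (2 * a + b.truth.toNat) cap.len) 0) := by
  have : ∀ (l : List BTree) (a : ℕ), l.foldl (fun acc b => ofList ((ofList ((ofList (acc.toList ++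
      acc.toList)).toList ++ (if b.truth then BTree.node .leaf .leaf else .leaf).toList)).toList.take
      cap.len)) (num a) =
      num (l.foldl (fun a b => min (2 * a + b.truth.toNat) cap.len) a) := by
    intro l
    induction l with
    | nil => simp
    | cons b l ih =>
      intro a
      rw [List.foldl_cons, List.foldl_cons, ← ih]
      congr 1
      rw [← ofList_replicate (min _ _)]
      cases h : b.truth
      · simp [toList_num, two_mul, min_comm]
      · rw [show (if true = true then BTree.node .leaf .leaf else .leaf) = num 1 from rfl]
        simp only [toList_num, toList_ofList, List.take_replicate, two_mul, min_comm,
          List.replicate_append_replicate, Bool.toNat_true]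
  exact this bits.toList 0

theorem upTo_eq (G : BTree) :
    upTo G = ofList ((List.range (G.len + 1)).reverse.map num) := by
  have : ∀ (l : List BTree) (i : ℕ), l.foldl (fun acc _ => BTree.node (.node .leaf acc.left) acc)
      (ofList ((List.range (i + 1)).reverse.map num)) =
      ofList ((List.range (i + l.length + 1)).reverse.map num) := by
    intro l
    induction l with
    | nil => simp
    | cons a l ih =>
      intro i
      rw [List.foldl_cons, show i + (a :: l).length + 1 = (i + 1) + l.length + 1 by simp; omega,
        ← ih]
      congr 1
      simp [List.range_succ, num]
  simpa [upTo, len, num] using this G.toList 0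

/-! ### Polynomial running time of the search -/

namespace FP

theorem adjT {f g h : BTree → BTree} (hf : FP f) (hg : FP g) (hh : FP h) :
    FP fun x => ofBool (adjT (f x) (g x) (h x)) := by
  have := ((hh.drop (hg.drop hf).left).left.not).not
  simpa [PatternDetection.adjT] using this

theorem blockAdj {f g h : BTree → BTree} (hf : FP f) (hg : FP g) (hh : FP h) :
    FP fun x => ofBool (blockAdj (f x) (g x) (h x)) :=
  all (F := fun x u => (h x).toList.all fun v => PatternDetection.adjT (f x) u v)
    (all (F := fun z v => PatternDetection.adjT (f z.left) z.right v)
      (adjT (hf.comp FP.id.left.left) FP.id.left.right FP.id.right)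
      (hh.comp FP.id.left)) hg

theorem blockMatrix {f g : BTree → BTree} (hf : FP f) (hg : FP g) :
    FP fun x => blockMatrix (f x) (g x) :=
  map (F := fun x B => ofList ((g x).toList.map fun B' =>
      ofBool (PatternDetection.blockAdj (f x) B B')))
    (map (F := fun z B' => ofBool (PatternDetection.blockAdj (f z.left) z.right B'))
      (blockAdj (hf.comp FP.id.left.left) FP.id.left.right FP.id.right)
      (hg.comp FP.id.left)) hg

theorem majority {f g h k : BTree → BTree} (hf : FP f) (hg : FP g) (hh : FP h) (hk : FP k) :
    FP fun x => ofBool (majority (f x) (g x) (h x) (k x)) := by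
  have hi := interp (hf.comp FP.id.left) (hg.comp FP.id.left) FP.id.right (hk.comp FP.id.left)
  exact (filter (F := fun x ρ => ofBool (!(PatternDetection.interp (f x) (g x) ρ (k x)).truth))
    hi.not hh).len_lt (filter (F := fun x ρ => PatternDetection.interp (f x) (g x) ρ (k x)) hi hh)

/-- A step only moves blocks between the two lists and adds at most four nodes, even on an exhausted
list, so the intermediate states stay small. -/
theorem search {f g h k l : BTree → BTree} (hf : FP f) (hg : FP g) (hh : FP h) (hk : FP k)
    (hl : FP l) : FP fun x => search (f x) (g x) (h x) (k x) (l x) := by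
  obtain ⟨B, hB, hlB⟩ := hl.exists_size_le
  refine (iterate (S := fun x => searchStep (f x) (g x) (h x) (k x)) (c := l)
    (f := fun x => .node .leaf (l x)) ?_ hl ((const .leaf).node hl)
    ⟨fun n => 2 + B n + 4 * B n, ((PolyBdd.const 2).add hB).add ((PolyBdd.const 4).mul hB),
      fun x i hi => ?_⟩).left
  · exact (majority (hg.comp FP.id.left) (blockMatrix (hf.comp FP.id.left)
      (FP.id.right.left.append FP.id.right.right.right)) (hh.comp FP.id.left)
      (hk.comp FP.id.left)).ite (FP.id.right.left.node FP.id.right.right.right)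
      ((FP.id.right.right.left.node FP.id.right.left).node FP.id.right.right.right)
  · have key : ∀ (y : BTree), (searchStep (f x) (g x) (h x) (k x) y).size ≤ y.size + 4 := by
      intro y
      unfold searchStep
      rcases y with _ | ⟨y₁, _ | ⟨y₂, y₃⟩⟩ <;> split_ifs <;> simp <;> omega
    have : ∀ i, ((searchStep (f x) (g x) (h x) (k x))^[i] (.node .leaf (l x))).size ≤
        2 + (l x).size + 4 * i := by
      intro i
      induction i with
      | zero => simp only [Function.iterate_zero, id, size_node, size_leaf]; omega
      | succ i ih =>
        rw [Function.iterate_succ_apply']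
        exact (key _).trans (by omega)
    have h₁ := this i
    have h₂ := hlB x
    have h₃ := (l x).len_lt_size
    simp only
    omega

theorem unary {f g : BTree → BTree} (hf : FP f) (hg : FP g) :
    FP fun x => unary (f x) (g x) := by
  obtain ⟨B, hB, hfB⟩ := hf.exists_size_le
  refine foldl (F := fun x acc b => ofList ((ofList ((ofList (acc.toList ++ acc.toList)).toList ++
    (if b.truth then BTree.node .leaf .leaf else .leaf).toList)).toList.take (f x).len)) (l := g)
    (f := fun _ => .leaf) ((hf.comp FP.id.left).take
    ((FP.id.right.left.append FP.id.right.left).append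
      (FP.id.right.right.ite (const _) (const _)))) hg (const _)
    ⟨fun n => 2 * B n + 1, ((PolyBdd.const 2).mul hB).add (.const 1), fun x l' hl' => ?_⟩
  have h₁ := unary_eq_num (f x) (ofList l')
  rw [PatternDetection.unary, toList_ofList] at h₁
  rw [h₁, size_num]
  have h₂ := hfB x
  have h₃ := (f x).len_lt_size
  have h₄ : l'.foldl (fun a b => min (2 * a + b.truth.toNat) (f x).len) 0 ≤ (f x).len := by
    rcases List.eq_nil_or_concat' l' with rfl | ⟨l, b, rfl⟩
    · simp
    · simp
  simp only
  omega

theorem upTo {f : BTree → BTree} (hf : FP f) : FP fun x => upTo (f x) := by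
  obtain ⟨B, hB, hfB⟩ := hf.exists_size_le
  refine foldl (F := fun _ acc _ => .node (.node .leaf acc.left) acc) (l := f)
    (f := fun _ => .node .leaf .leaf) (((const .leaf).node FP.id.right.left.left).node
    FP.id.right.left) hf (const _) ⟨fun n => (B n + 1) * (2 * B n + 2) + 1,
      ((hB.add (.const 1)).mul (((PolyBdd.const 2).mul hB).add (.const 2))).add (.const 1),
      fun x l' hl' => ?_⟩
  have h₁ := upTo_eq (ofList l')
  rw [PatternDetection.upTo, toList_ofList] at h₁
  rw [h₁, size_ofList]
  have h₂ := hfB x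
  have h₃ := (f x).len_lt_size
  have h₄ : l'.length ≤ (f x).len := hl'.length_le
  rw [len_ofList, List.map_map]
  have h₅ := List.sum_le_card_nsmul (((List.range (l'.length + 1)).reverse.map
    ((fun a => a.size + 1) ∘ num))) (2 * B x.size + 2) (by
      intro a ha
      simp only [List.map_reverse, List.mem_reverse, List.mem_map, List.mem_range,
        Function.comp_apply, size_num] at ha
      obtain ⟨i, hi, rfl⟩ := ha
      omega)
  simp only [List.length_map, List.length_reverse, List.length_range, smul_eq_mul] at h₅
  refine Nat.add_le_add_right (h₅.trans ?_) 1
  gcongr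
  omega

theorem memBlock {f g : BTree → BTree} (hf : FP f) (hg : FP g) :
    FP fun x => ofBool (memBlock (f x) (g x)) := by
  refine any (F := fun x w => !(ofBool (decide ((f x).len < w.len))).truth &&
    !(ofBool (decide (w.len < (f x).len))).truth) ?_ hg
  exact ((hf.comp FP.id.left).len_lt FP.id.right).not.and
    (FP.id.right.len_lt (hf.comp FP.id.left)).not

theorem covered {f g h k : BTree → BTree} (hf : FP f) (hg : FP g) (hh : FP h) (hk : FP k) :
    FP fun x => ofBool (covered (f x) (g x) (h x) (k x)) := by
  refine any (F := fun x B => PatternDetection.memBlock (h x) B && (g x).toList.any fun B' =>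
    PatternDetection.memBlock (k x) B' && PatternDetection.blockAdj (f x) B B') ?_ hg
  refine (memBlock (hh.comp FP.id.left) FP.id.right).and ?_
  refine any (F := fun z B' => PatternDetection.memBlock (k z.left) B' &&
    PatternDetection.blockAdj (f z.left) z.right B') ?_ (hg.comp FP.id.left)
  exact (memBlock (hk.comp FP.id.left.left) FP.id.right).and
    (blockAdj (hf.comp FP.id.left.left) FP.id.left.right FP.id.right)

theorem coveredPairs {f g : BTree → BTree} (hf : FP f) (hg : FP g) :
    FP fun x => coveredPairs (f x) (g x) := by
  refine flatMap (F := fun x u => ofList ((PatternDetection.upTo (f x)).toList.filter fun v =>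
    (ofBool (PatternDetection.covered (f x) (g x) u v)).truth)) ?_ (upTo hf)
  refine filter (F := fun z v => ofBool (PatternDetection.covered (f z.left) (g z.left)
    z.right v)) ?_ (upTo (hf.comp FP.id.left))
  exact covered (hf.comp FP.id.left.left) (hg.comp FP.id.left.left) FP.id.left.right FP.id.right

theorem threshold {f g : BTree → BTree} (hf : FP f) (hg : FP g) :
    FP fun x => threshold (f x) (g x) := by
  refine flatMap (F := fun x _ => ofList ((ofList ((g x).toList.flatMap fun B =>
    (ofList (B.toList.flatMap fun _ => (f x).toList)).toList)).toList ++
      (ofList ((g x).toList.flatMap fun _ => (g x).toList)).toList)) ?_ (const (num 8))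
  refine append ?_ ?_
  · refine flatMap (F := fun z B => ofList (B.toList.flatMap fun _ => (f z.left).toList)) ?_
      (hg.comp FP.id.left)
    exact flatMap (F := fun z _ => f z.left.left) (hf.comp FP.id.left.left.left) FP.id.right
  · exact flatMap (F := fun z _ => g z.left) (hg.comp FP.id.left.left) (hg.comp FP.id.left)

theorem certified {f g h : BTree → BTree} (hf : FP f) (hg : FP g) (hh : FP h) :
    FP fun x => ofBool (certified (f x) (g x) (h x)) :=
  ((threshold hg hh).len_lt (coveredPairs hf hh)).and
    ((unary hf ((const _).node hg)).len_lt hf).not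

theorem parse {f : BTree → BTree} (hf : FP f) : FP fun x => parse (f x) := by
  obtain ⟨B, hB, hfB⟩ := hf.exists_size_le
  refine (foldl (F := fun _ st b => if b.truth then BTree.node .leaf st
    else .node (.node st.right.left st.left) st.right.right) (l := f) (f := fun _ => .leaf)
    (FP.id.right.right.ite ((const .leaf).node FP.id.right.left)
      ((FP.id.right.left.right.left.node FP.id.right.left.left).node
        FP.id.right.left.right.right)) hf (const _)
    ⟨fun n => 4 * B n + 1, ((PolyBdd.const 4).mul hB).add (.const 1), fun x l' hl' => ?_⟩).left
  have key : ∀ (l : List BTree) (st : BTree), (l.foldl (fun st b => if b.truth then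
      BTree.node .leaf st else .node (.node st.right.left st.left) st.right.right) st).size ≤
      4 * l.length + st.size := by
    intro l
    induction l with
    | nil => simp
    | cons b l ih =>
      intro st
      rw [List.foldl_cons]
      refine (ih _).trans ?_
      rcases st with _ | ⟨st₁, _ | ⟨st₂, st₃⟩⟩ <;> split_ifs <;> simp <;> omega
  have h₁ := key l' .leaf
  have h₂ := hfB x
  have h₃ := (f x).len_lt_size
  have h₄ : l'.length ≤ (f x).len := hl'.length_le
  simp only [size_leaf] at *
  omega

theorem blocks {f g h k l m : BTree → BTree} (hf : FP f) (hg : FP g) (hh : FP h) (hk : FP k)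
    (hl : FP l) (hm : FP m) : FP fun x => blocks (f x) (g x) (h x) (k x) (l x) (m x) := by
  refine map (F := fun x row => ofList ((ofList (row.toList.take (k x).len)).toList.map fun ch =>
    PatternDetection.unary (f x) (ofList (ch.toList.take (l x).len)))) ?_
    ((unary hg ((const _).node hh)).take hm)
  refine map (F := fun z ch =>
    PatternDetection.unary (f z.left) (ofList (ch.toList.take (l z.left).len))) ?_
    ((hk.comp FP.id.left).take FP.id.right)
  exact unary (hf.comp FP.id.left.left) ((hl.comp FP.id.left.left).take FP.id.right)

theorem accepts {f g h k l : BTree → BTree} (hf : FP f) (hg : FP g) (hh : FP h) (hk : FP k)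
    (hl : FP l) : FP fun x => ofBool (accepts (f x) (g x) (h x) (k x) (l x)) :=
  have hp := parse hh
  certified hf hp.right.right.right (search hf hp.left hl hg
    (blocks hf hg hp.right.left hp.right.right.left hp.right.right.right hk))

end FP

/-! ### The universal search algorithm -/

/-- A list of bits as a tree. -/
def bits₁ {t : ℕ} (ω : Fin t → Bool) : BTree := ofList (List.ofFn fun i => ofBool (ω i))

/-- A two-dimensional array of bits as a tree. -/
def bits₂ {t : ℕ} (ω : Fin t → Fin t → Bool) : BTree := ofList (List.ofFn fun i => bits₁ (ω i))

/-- A three-dimensional array of bits as a tree. -/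
def bits₃ {t : ℕ} (ω : Fin t → Fin t → Fin t → Bool) : BTree :=
  ofList (List.ofFn fun i => bits₂ (ω i))

/-- Sampling a list of bits of length given by `e`. -/
def sample₁ (e : Expr) : Prog := .rep e .flip

/-- Sampling a two-dimensional array of bits. -/
def sample₂ (e : Expr) : Prog := .rep e (sample₁ (e.subst (.right (.right .var))))

/-- Sampling a three-dimensional array of bits. -/
def sample₃ (e : Expr) : Prog := .rep e (sample₂ (e.subst (.right (.right .var))))

/-- Running time of the sampling of arrays of the given dimension. -/
def sampleTime (t : ℕ) : ℕ → ℕ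
  | 0 => 1
  | d + 1 => t * (sampleTime t d + 3) + 5

theorem SReduces.sample₁ {t : ℕ} {e : Expr} {s : BTree} (h : (e.eval s).len = t) (c : List Prog) :
    SReduces (sampleTime t 1) (sample₁ e :: c, s)
      fun ω : Fin t → Bool => (c, .node (bits₁ ω) s) :=
  SReduces.rep (fun _ _ c => .flip c _) e c h

theorem SReduces.sample₂ {t : ℕ} {e : Expr} {s : BTree} (h : (e.eval s).len = t) (c : List Prog) :
    SReduces (sampleTime t 2) (sample₂ e :: c, s)
      fun ω : Fin t → Fin t → Bool => (c, .node (bits₂ ω) s) :=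
  SReduces.rep (fun _ _ c => .sample₁ (by simpa [Expr.eval_subst, Expr.eval] using h) c) e c h

theorem SReduces.sample₃ {t : ℕ} {e : Expr} {s : BTree} (h : (e.eval s).len = t) (c : List Prog) :
    SReduces (sampleTime t 3) (sample₃ e :: c, s)
      fun ω : Fin t → Fin t → Fin t → Bool => (c, .node (bits₃ ω) s) :=
  SReduces.rep (fun _ _ c => .sample₂ (by simpa [Expr.eval_subst, Expr.eval] using h) c) e c h

theorem size_ofList_ofFn_le {t b : ℕ} {F : Fin t → BTree} (h : ∀ i, (F i).size ≤ b) :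
    (ofList (List.ofFn F)).size ≤ t * (b + 1) + 1 := by
  rw [size_ofList]
  have := List.sum_le_card_nsmul ((List.ofFn F).map fun a => a.size + 1) (b + 1) (by
    intro a ha
    simp only [List.mem_map, List.mem_ofFn] at ha
    obtain ⟨_, ⟨i, rfl⟩, rfl⟩ := ha
    exact Nat.add_le_add_right (h i) 1)
  simpa using this

theorem size_bits₁_le {t : ℕ} (ω : Fin t → Bool) : (bits₁ ω).size ≤ t * 4 + 1 :=
  size_ofList_ofFn_le fun _ => size_ofBool_le _

theorem size_bits₂_le {t : ℕ} (ω : Fin t → Fin t → Bool) :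
    (bits₂ ω).size ≤ t * (t * 4 + 1 + 1) + 1 :=
  size_ofList_ofFn_le fun _ => size_bits₁_le _

theorem size_bits₃_le {t : ℕ} (ω : Fin t → Fin t → Fin t → Bool) :
    (bits₃ ω).size ≤ t * (t * (t * 4 + 1 + 1) + 1 + 1) + 1 :=
  size_ofList_ofFn_le fun _ => size_bits₂_le _

/-- The random bits of one stage. -/
abbrev Coins (t : ℕ) : Type :=
  ((Fin t → Bool) × (Fin t → Fin t → Fin t → Bool)) × (Fin t → Fin t → Bool)

/-- The event that a stage succeeds. -/
def Succeeds (G : BTree) (t : ℕ) (ω : Coins t) : Prop :=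
  accepts G (num t) (bits₁ ω.1.1) (bits₃ ω.1.2) (bits₂ ω.2) = true

/-- The content of the program variable at the beginning of a stage. -/
def stageState (G : BTree) (t : ℕ) : BTree := .node (ofBool true) (.node (num t) G)

/-- The content of the program variable after the random bits of a stage have been sampled. -/
def sampledState (G : BTree) (t : ℕ) (ω : Coins t) : BTree :=
  .node (bits₂ ω.2) (.node (bits₃ ω.1.2) (.node (bits₁ ω.1.1) (stageState G t)))

/-- The deterministic part of a stage. -/
def update (z : BTree) : BTree :=
  if (ofBool (accepts z.right.right.right.right.right z.right.right.right.right.left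
    z.right.right.left z.right.left z.left)).truth then .node .leaf .leaf
  else .node (ofBool true) (.node (.node .leaf z.right.right.right.right.left)
    z.right.right.right.right.right)

theorem FP.update : FP update :=
  (FP.accepts FP.id.right.right.right.right.right FP.id.right.right.right.right.left
    FP.id.right.right.left FP.id.right.left FP.id.left).ite (const _)
    ((const _).node (((const .leaf).node FP.id.right.right.right.right.left).node
      FP.id.right.right.right.right.right))

theorem update_of_succeeds {G : BTree} {t : ℕ} {ω : Coins t} (h : Succeeds G t ω) :
    update (sampledState G t ω) = .node .leaf .leaf := by
  unfold Succeeds at h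
  simp [update, sampledState, stageState, h]

theorem update_of_not_succeeds {G : BTree} {t : ℕ} {ω : Coins t} (h : ¬ Succeeds G t ω) :
    update (sampledState G t ω) = stageState G (t + 1) := by
  unfold Succeeds at h
  simp [update, sampledState, stageState, h, num]

/-- The body of the main loop, without its deterministic part. -/
def sampling : Prog :=
  .seq (sample₁ (.left (.right .var))) (.seq (sample₃ (.left (.right (.right .var))))
    (sample₂ (.left (.right (.right (.right .var))))))

/-- The main loop, for a program `p` for the deterministic part of the stages. -/
def mainLoop (p : Prog) : Prog := .loop (.left .var) (.seq sampling p)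

/-- The running time of the random part of a stage. -/
def samplingTime (t : ℕ) : ℕ := 4 + sampleTime t 1 + sampleTime t 3 + sampleTime t 2

theorem SReduces.sampling (p : Prog) (G : BTree) (t : ℕ) :
    SReduces (samplingTime t) ([mainLoop p], stageState G t)
      fun ω : Coins t => (p :: [mainLoop p], sampledState G t ω) := by
  have h₀ : Reduces 3 ([mainLoop p], stageState G t) (_, stageState G t) :=
    ((Reduces.loop_true rfl).trans (Reduces.seq _ _ _ _)).trans (Reduces.seq _ _ _ _)
  have h₁ := (h₀.trans_sReduces (SReduces.sample₁ (t := t) (by exact len_num t) _)).trans_reduces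
    fun ω => Reduces.seq _ _ _ _
  have h₂ := (h₁.trans fun ω => SReduces.sample₃ (t := t) (by exact len_num t) _).trans
    fun ω => SReduces.sample₂ (t := t) (by exact len_num t) (p :: [mainLoop p])
  convert h₂ using 1
  · simp only [samplingTime]
    ring
  · rfl

/-- Without certificates the algorithm does not halt. -/
theorem win_mainLoop_eq_zero {p : Prog} (hp : ∀ x, ∃ τ, Ev p x (update x) τ) {G : BTree}
    (hG : ∀ t ω, ¬ Succeeds G t ω) (T t : ℕ) : win T ([mainLoop p], stageState G t) = 0 := by
  induction T using Nat.strong_induction_on generalizing t with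
  | _ T ih =>
    have hs := SReduces.sampling p G t
    rcases lt_or_ge T (samplingTime t) with hlt | hge
    · exact hs.2 T hlt
    obtain ⟨T, rfl⟩ := Nat.exists_eq_add_of_le' hge
    rw [hs.1]
    have : ∀ ω : Coins t, win T (p :: [mainLoop p], sampledState G t ω) = 0 := by
      intro ω
      obtain ⟨τ, hτ⟩ := hp (sampledState G t ω)
      have hr := hτ.reduces [mainLoop p]
      rcases lt_or_ge T τ with hlt | hge
      · exact hr.2 T hlt
      · obtain ⟨T, rfl⟩ := Nat.exists_eq_add_of_le' hge
        rw [hr.1, update_of_not_succeeds (hG t ω)]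
        exact ih _ (by simp only [samplingTime]; omega) _
    simp [this, avg]

open Classical in
theorem avg_ofReal_ite {Ω : Type*} [Fintype Ω] [Nonempty Ω] (p : Ω → Prop) {a : ℝ} (ha : 0 ≤ a) :
    avg (fun ω => ENNReal.ofReal (if p ω then 1 else a)) =
      ENNReal.ofReal (pr p + (1 - pr p) * a) := by
  have hcard : (0 : ℝ) < Fintype.card Ω := by exact_mod_cast Fintype.card_pos
  have hc := Finset.card_filter_add_card_filter_not (s := (Finset.univ : Finset Ω)) p
  unfold avg
  rw [← ENNReal.ofReal_sum_of_nonneg (fun ω _ => by split_ifs <;> positivity),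
    ← ENNReal.ofReal_natCast, ← ENNReal.ofReal_div_of_pos hcard, pr_eq, Finset.sum_ite]
  congr 1
  rw [Finset.card_univ] at hc
  rw [← hc]
  rw [← hc] at hcard
  push_cast at hcard ⊢
  field_simp
  simp

/-- One stage of the algorithm. -/
theorem le_win_mainLoop_succ {p : Prog} {G : BTree} {t S T : ℕ} {q a : ℝ}
    (hp : ∀ ω : Coins t, ∃ τ, samplingTime t + τ + 2 ≤ S ∧
      Ev p (sampledState G t ω) (update (sampledState G t ω)) τ)
    (hq : q ≤ pr (Succeeds G t)) (ha₀ : 0 ≤ a) (ha₁ : a ≤ 1)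
    (hwin : ENNReal.ofReal a ≤ win T ([mainLoop p], stageState G (t + 1))) :
    ENNReal.ofReal (q + (1 - q) * a) ≤ win (T + S) ([mainLoop p], stageState G t) := by
  classical
  have hs := SReduces.sampling p G t
  have hS : samplingTime t ≤ S := by
    obtain ⟨τ, hτ, -⟩ := hp ((fun _ => true, fun _ _ _ => true), fun _ _ => true)
    omega
  have key : ∀ ω : Coins t, ENNReal.ofReal (if Succeeds G t ω then 1 else a) ≤
      win (T + (S - samplingTime t)) (p :: [mainLoop p], sampledState G t ω) := by
    intro ω
    obtain ⟨τ, hτ, hev⟩ := hp ω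
    have hr := hev.reduces [mainLoop p]
    rw [show T + (S - samplingTime t) = T + (S - samplingTime t - τ) + τ by omega, hr.1]
    split_ifs with h
    · have hl : Reduces 1 ([mainLoop p], .node .leaf .leaf) ([], .node .leaf .leaf) :=
        .loop_false rfl
      rw [update_of_succeeds h, show T + (S - samplingTime t - τ) =
        T + (S - samplingTime t - τ - 1) + 1 by omega, hl.1]
      exact (ENNReal.ofReal_one.trans (ansProb_halted _ (.node .leaf .leaf)).symm).le
    · rw [update_of_not_succeeds h]
      exact hwin.trans (win_mono (by omega) _)
  rw [show T + S = T + (S - samplingTime t) + samplingTime t by omega, hs.1]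
  refine le_trans ?_ (avg_mono key)
  rw [avg_ofReal_ite _ ha₀]
  refine ENNReal.ofReal_le_ofReal ?_
  nlinarith

/-- The universal search: an algorithm that halts with answer `true` as soon as a stage succeeds,
and does not halt otherwise. -/
theorem exists_universal_search : ∃ (A : Prog) (B : ℕ → ℕ), PolyBdd B ∧
    (∀ G, (∀ t ω, ¬ Succeeds G t ω) → ∀ T, win T ([A], G) = 0) ∧
    ∀ (G : BTree) (t₀ m : ℕ) (q : ℝ), 0 ≤ q → q ≤ 1 →
      (∀ t, t₀ ≤ t → t < t₀ + m → q ≤ pr (Succeeds G t)) →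
      ENNReal.ofReal (1 - (1 - q) ^ m) ≤ win (B (G.size + t₀ + m)) ([A], G) := by
  obtain ⟨p, B, hB, hp⟩ := FP.update
  have hinit : ∀ G, Reduces 2 ([.seq (.assign (.node (.lit (ofBool true)) (.node .leaf .var)))
      (mainLoop p)], G) ([mainLoop p], stageState G 0) := by
    intro G
    have := (Reduces.seq (.assign (.node (.lit (ofBool true)) (.node .leaf .var)))
      (mainLoop p) [] G).trans (Reduces.assign _ _ _)
    exact this
  -- A bound for the size of `sampledState`: the three arrays of bits, the clock and the input
  -- graph.
  let Z : ℕ → ℕ := fun n => (n * (n * 4 + 1 + 1) + 1) + ((n * (n * (n * 4 + 1 + 1) + 1 + 1) + 1) +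
    ((n * 4 + 1) + (3 + ((2 * n + 1) + n + 1) + 1) + 1) + 1) + 1
  let S : ℕ → ℕ := fun n => samplingTime n + B (Z n) + 2
  have hid := PolyBdd.id
  have h₁ : PolyBdd fun n => sampleTime n 1 :=
    (hid.mul ((PolyBdd.const 1).add (.const 3))).add (.const 5)
  have h₂ : PolyBdd fun n => sampleTime n 2 := (hid.mul (h₁.add (.const 3))).add (.const 5)
  have h₃ : PolyBdd fun n => sampleTime n 3 := (hid.mul (h₂.add (.const 3))).add (.const 5)
  have hsamp : PolyBdd samplingTime := (((PolyBdd.const 4).add h₁).add h₃).add h₂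
  have g₁ : PolyBdd fun n => n * 4 + 1 := (hid.mul (.const 4)).add (.const 1)
  have g₂ : PolyBdd fun n => n * (n * 4 + 1 + 1) + 1 :=
    (hid.mul (g₁.add (.const 1))).add (.const 1)
  have g₃ : PolyBdd fun n => n * (n * (n * 4 + 1 + 1) + 1 + 1) + 1 :=
    (hid.mul (g₂.add (.const 1))).add (.const 1)
  have hZ : PolyBdd Z :=
    (g₂.add ((g₃.add ((g₁.add (((PolyBdd.const 3).add (((((PolyBdd.const 2).mul hid).add
      (.const 1)).add hid).add (.const 1))).add (.const 1))).add (.const 1))).add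
      (.const 1))).add (.const 1)
  have hS : PolyBdd S := (hsamp.add (hB.comp hZ)).add (.const 2)
  refine ⟨.seq (.assign (.node (.lit (ofBool true)) (.node .leaf .var))) (mainLoop p),
    fun n => n * S n + 2, (hid.mul hS).add (.const 2), fun G hG T => ?_, ?_⟩
  · rcases lt_or_ge T 2 with hlt | hge
    · exact (hinit G).2 T hlt
    · obtain ⟨T, rfl⟩ := Nat.exists_eq_add_of_le' hge
      rw [(hinit G).1]
      exact win_mainLoop_eq_zero (fun x => (hp x).1.imp fun τ h => h.2) hG _ _
  · intro G t₀ m q hq₀ hq₁ hq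
    have hev : ∀ t ≤ G.size + t₀ + m, ∀ ω : Coins t, ∃ τ,
        samplingTime t + τ + 2 ≤ S (G.size + t₀ + m) ∧
        Ev p (sampledState G t ω) (update (sampledState G t ω)) τ := by
      intro t ht ω
      obtain ⟨⟨τ, hτ, h⟩, -⟩ := hp (sampledState G t ω)
      refine ⟨τ, ?_, h⟩
      have k₁ : (sampledState G t ω).size ≤ Z (G.size + t₀ + m) := by
        have e₁ := (size_bits₁_le ω.1.1).trans (g₁.1 ht)
        have e₂ := (size_bits₂_le ω.2).trans (g₂.1 ht)
        have e₃ := (size_bits₃_le ω.1.2).trans (g₃.1 ht)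
        have e₄ := size_num t
        have e₅ := size_ofBool_le true
        simp only [sampledState, stageState, size_node, Z] at *
        omega
      have k₂ := hB.1 k₁
      have k₃ := hsamp.1 ht
      simp only [S]
      omega
    -- Downward induction on the stage: `j` is the number of stages left before `t₀ + m`, and they
    -- all fail with probability at most `(1 - q) ^ j`.
    have key : ∀ j ≤ m, ENNReal.ofReal (1 - (1 - q) ^ j) ≤
        win (j * S (G.size + t₀ + m)) ([mainLoop p], stageState G (t₀ + m - j)) := by
      intro j
      induction j with
      | zero => simp
      | succ j ih =>
        intro hj
        have e₁ : 0 ≤ (1 - q) ^ j := pow_nonneg (by linarith) _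
        have e₂ : (1 - q) ^ j ≤ 1 := pow_le_one₀ (by linarith) (by linarith)
        have := le_win_mainLoop_succ (a := 1 - (1 - q) ^ j) (hev (t₀ + m - (j + 1)) (by omega))
          (hq _ (by omega) (by omega)) (by linarith) (by linarith)
          (by rw [show t₀ + m - (j + 1) + 1 = t₀ + m - j by omega]; exact ih (by omega))
        convert this using 2
        · ring
        · ring
    -- Nothing is known about the stages before `t₀`. They enter with success probability at least 0
    -- and only cost time.
    have key' : ∀ j ≤ t₀, ENNReal.ofReal (1 - (1 - q) ^ m) ≤
        win ((m + j) * S (G.size + t₀ + m)) ([mainLoop p], stageState G (t₀ - j)) := by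
      intro j
      induction j with
      | zero => intro _; simpa using key m le_rfl
      | succ j ih =>
        intro hj
        have e₁ : 0 ≤ (1 - q) ^ m := pow_nonneg (by linarith) _
        have e₂ : (1 - q) ^ m ≤ 1 := pow_le_one₀ (by linarith) (by linarith)
        have := le_win_mainLoop_succ (a := 1 - (1 - q) ^ m) (hev (t₀ - (j + 1)) (by omega))
          (pr_nonneg _) (by linarith) (by linarith)
          (by rw [show t₀ - (j + 1) + 1 = t₀ - j by omega]; exact ih (by omega))
        convert this using 2
        · ring
        · ring
    have := key' t₀ le_rfl
    rw [Nat.sub_self] at this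
    rw [(hinit G).1]
    refine this.trans (win_mono ?_ _)
    exact Nat.mul_le_mul_right _ (by omega)

/-! ### Uniformly random graphs -/

/-- Markov's inequality for a product of independent variables. -/
theorem pr_le_prod_ge {ι Ω : Type*} [Fintype ι] [DecidableEq ι] [Fintype Ω] (g : ι → Ω → ℝ)
    (hg : ∀ i x, 0 ≤ g i x) {a : ℝ} (ha : 0 < a) :
    pr (fun ω : ι → Ω => a ≤ ∏ i, g i (ω i)) ≤
      (∏ i, (∑ x, g i x) / Fintype.card Ω) / a := by
  classical
  rw [pr_eq, Finset.prod_div_distrib, le_div_iff₀ ha, div_mul_eq_mul_div]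
  simp only [Fintype.card_pi, Finset.prod_const, Finset.card_univ, Nat.cast_pow]
  gcongr
  rw [Finset.prod_univ_sum, ← nsmul_eq_mul]
  have : Finset.univ.filter (fun ω : ι → Ω => a ≤ ∏ i, g i (ω i)) ⊆
      Fintype.piFinset fun _ => Finset.univ := by
    intro ω _
    simp
  refine le_trans ?_ (Finset.sum_le_sum_of_subset_of_nonneg this
    fun ω _ _ => Finset.prod_nonneg fun i _ => hg _ _)
  exact Finset.card_nsmul_le_sum _ _ _ fun ω hω => (Finset.mem_filter.1 hω).2

open Classical in
/-- Graphs as functions on the pairs of vertices. -/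
noncomputable def graphEquiv (V : Type*) :
    SimpleGraph V ≃ ({e : Sym2 V // ¬ e.IsDiag} → Bool) where
  toFun G e := decide (e.1 ∈ G.edgeSet)
  invFun f := SimpleGraph.fromEdgeSet {e | ∃ h, f ⟨e, h⟩ = true}
  left_inv G := by
    ext u v
    simp only [decide_eq_true_eq, SimpleGraph.fromEdgeSet_adj, Set.mem_ofPred_eq,
      SimpleGraph.mem_edgeSet, Sym2.mk_isDiag_iff, exists_prop]
    exact ⟨fun h => h.1.2, fun h => ⟨⟨h.ne, h⟩, h.ne⟩⟩
  right_inv f := by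
    funext ⟨e, he⟩
    induction e using Sym2.ind with
    | _ u v =>
      have : s(u, v) ∈ (SimpleGraph.fromEdgeSet {e | ∃ h, f ⟨e, h⟩ = true}).edgeSet ↔
          f ⟨s(u, v), he⟩ = true :=
        ⟨fun h => h.1.2, fun h => ⟨⟨he, h⟩, by simpa using he⟩⟩
      beta_reduce
      cases hf : f ⟨s(u, v), he⟩ <;> simp only [hf] at this <;> simpa using this

theorem graphEquiv_apply {V : Type*} (G : SimpleGraph V) (e : {e : Sym2 V // ¬ e.IsDiag}) :
    graphEquiv V G e = true ↔ e.1 ∈ G.edgeSet := by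
  simp [graphEquiv]

/-- An edge accounts for at most two ordered pairs, so at least `e` independent edges are
prescribed. A pair on the diagonal makes the event empty. -/
theorem pr_forall_adj_le {V : Type*} [Fintype V] [DecidableEq V] (F : Finset (V × V)) {e : ℕ}
    (he : 2 * e ≤ F.card) :
    pr (fun G : SimpleGraph V => ∀ x ∈ F, G.Adj x.1 x.2) ≤ (1 / 2) ^ e := by
  classical
  by_cases hF : ∃ x ∈ F, x.1 = x.2
  · obtain ⟨x, hx, h⟩ := hF
    refine le_trans (pr_mono (q := fun _ => False) fun G hG => ?_) (by rw [pr_false]; positivity)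
    exact (hG x hx).ne h
  push Not at hF
  let E : Finset {e : Sym2 V // ¬ e.IsDiag} :=
    Finset.univ.filter fun e => ∃ x ∈ F, s(x.1, x.2) = e.1
  have hcard : e ≤ E.card := by
    have h₁ : F.card ≤ 2 * (F.image fun x => s(x.1, x.2)).card := by
      refine Finset.card_le_mul_card_image (f := fun x : V × V => s(x.1, x.2)) F 2 fun e _ => ?_
      induction e using Sym2.ind with
      | _ u v =>
        refine (Finset.card_le_card (t := ({(u, v), (v, u)} : Finset (V × V))) fun x hx => ?_).trans
          (Finset.card_le_two (a := (u, v)) (b := (v, u)))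
        simp only [Finset.mem_filter, Sym2.eq_iff] at hx
        simp only [Finset.mem_insert, Finset.mem_singleton, Prod.ext_iff]
        exact hx.2
    have h₂ : (F.image fun x => s(x.1, x.2)) ⊆ E.image Subtype.val := by
      intro e he
      simp only [Finset.mem_image] at he
      obtain ⟨x, hx, rfl⟩ := he
      simp only [E, Finset.mem_image, Finset.mem_filter, Finset.mem_univ, true_and]
      exact ⟨⟨s(x.1, x.2), by simpa using hF x hx⟩, ⟨x, hx, rfl⟩, rfl⟩
    have h₃ := Finset.card_le_card h₂
    have h₄ : (E.image Subtype.val).card ≤ E.card := Finset.card_image_le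
    omega
  have : pr (fun G : SimpleGraph V => ∀ x ∈ F, G.Adj x.1 x.2) ≤
      pr fun G : SimpleGraph V => ∀ e, (e ∈ E → graphEquiv V G e = true) := by
    refine pr_mono fun G hG e he => ?_
    simp only [E, Finset.mem_filter, Finset.mem_univ, true_and] at he
    obtain ⟨x, hx, h⟩ := he
    rw [graphEquiv_apply, ← h]
    exact hG x hx
  refine this.trans ?_
  rw [pr_equiv (graphEquiv V) (fun f => ∀ e, (e ∈ E → f e = true)),
    pr_pi (fun e b => e ∈ E → b = true)]
  have hone : ∀ e : {e : Sym2 V // ¬ e.IsDiag}, pr (fun b : Bool => e ∈ E → b = true) =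
      if e ∈ E then 1 / 2 else 1 := by
    intro e
    split_ifs with h <;> simp [pr_eq, h, Finset.filter_insert, Finset.filter_singleton]
  simp only [hone]
  rw [Finset.prod_ite, Finset.prod_const_one, mul_one, Finset.prod_const,
    Finset.filter_mem_eq_inter, Finset.univ_inter]
  exact pow_le_pow_of_le_one (by norm_num) (by norm_num) hcard

/-! ### Random graphs have no certificates -/

open Classical in
/-- The pairs of vertices in adjacent blocks. -/
noncomputable def blockPairs {n k : ℕ} (G : SimpleGraph (Fin n)) (B : Fin k → Finset (Fin n)) :
    Finset (Fin n × Fin n) :=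
  Finset.univ.filter fun x => ∃ i j, x.1 ∈ B i ∧ x.2 ∈ B j ∧ ∀ u ∈ B i, ∀ v ∈ B j, G.Adj u v

/-- A certificate: blocks of vertices with unexpectedly many pairs in adjacent blocks. -/
def HasCertificate {n : ℕ} (G : SimpleGraph (Fin n)) : Prop :=
  ∃ (c k : ℕ) (B : Fin k → Finset (Fin n)), n ≤ 2 ^ (c + 1) ∧
    8 * (c * ∑ i, (B i).card + k ^ 2) < (blockPairs G B).card

/-- Let `s` be the total size of the blocks. Union bound over the `2 ^ (k ^ 2)` sets of block pairs
that may be completely joined: more than `8 * (c * s + k ^ 2)` ordered pairs prescribe `4 * (c * s +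
k ^ 2)` edges. The part from `k ^ 2` pays for this choice and leaves `(1 / 8) ^ k ^ 2`. The part
from `c * s` is at most `n ^ (-2 * s)` by `n ≤ 4 ^ c`; one factor `n ^ (-s)` will pay for the choice
of the blocks, and one further `1 / n` remains as the final bound. -/
theorem pr_blockPairs_le {n k c : ℕ} (hn : n ≤ 4 ^ c) (hn' : 1 ≤ n) (B : Fin k → Finset (Fin n)) :
    pr (fun G : SimpleGraph (Fin n) => 8 * (c * ∑ i, (B i).card + k ^ 2) < (blockPairs G B).card) ≤
      (1 / 8) ^ k ^ 2 * (∏ i, (1 / (n : ℝ)) ^ (B i).card) * (1 / n) := by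
  classical
  have hn₀ : (0 : ℝ) < n := by exact_mod_cast hn'
  rcases Nat.eq_zero_or_pos (∑ i, (B i).card) with hs | hs
  · refine le_trans (pr_mono (q := fun _ => False) fun G hG => ?_)
      (by rw [pr_false]; positivity)
    have : blockPairs G B = ∅ := by
      ext x
      simp only [blockPairs, Finset.mem_filter, Finset.mem_univ, true_and, Finset.notMem_empty,
        iff_false]
      rintro ⟨i, j, h, -⟩
      rw [Finset.sum_eq_zero_iff] at hs
      rw [Finset.card_eq_zero.1 (hs i (Finset.mem_univ i))] at h
      simp at h
    simp [this] at hG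
  set s := ∑ i, (B i).card with hsdef
  let cov : Finset (Fin k × Fin k) → Finset (Fin n × Fin n) := fun π =>
    Finset.univ.filter fun x => ∃ y ∈ π, x.1 ∈ B y.1 ∧ x.2 ∈ B y.2
  have h₁ : pr (fun G : SimpleGraph (Fin n) => 8 * (c * s + k ^ 2) < (blockPairs G B).card) ≤
      ∑ π : Finset (Fin k × Fin k), (1 / 2 : ℝ) ^ (4 * (c * s + k ^ 2)) := by
    refine le_trans (pr_mono (q := fun G => ∃ π ∈ (Finset.univ : Finset (Finset (Fin k × Fin k))),
      2 * (4 * (c * s + k ^ 2)) ≤ (cov π).card ∧ ∀ x ∈ cov π, G.Adj x.1 x.2) fun G hG => ?_)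
      ((pr_exists_le _ _).trans (Finset.sum_le_sum fun π _ => ?_))
    · refine ⟨Finset.univ.filter fun y => ∀ u ∈ B y.1, ∀ v ∈ B y.2, G.Adj u v,
        Finset.mem_univ _, ?_, ?_⟩
      · have : blockPairs G B ⊆
            cov (Finset.univ.filter fun y => ∀ u ∈ B y.1, ∀ v ∈ B y.2, G.Adj u v) := by
          intro x hx
          simp only [blockPairs, Finset.mem_filter, Finset.mem_univ, true_and] at hx
          obtain ⟨i, j, hi, hj, h⟩ := hx
          simp only [cov, Finset.mem_filter, Finset.mem_univ, true_and]
          exact ⟨(i, j), h, hi, hj⟩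
        have := Finset.card_le_card this
        omega
      · intro x hx
        simp only [cov, Finset.mem_filter, Finset.mem_univ, true_and] at hx
        obtain ⟨y, hy, h₁, h₂⟩ := hx
        exact hy _ h₁ _ h₂
    · by_cases hπ : 2 * (4 * (c * s + k ^ 2)) ≤ (cov π).card
      · exact (pr_mono fun G hG => hG.2).trans (pr_forall_adj_le _ hπ)
      · refine (pr_mono (q := fun _ => False) fun G hG => hπ hG.1).trans ?_
        rw [pr_false]
        positivity
  refine h₁.trans ?_
  rw [Finset.sum_const, Finset.card_univ, Fintype.card_finset, Fintype.card_prod, Fintype.card_fin,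
    nsmul_eq_mul, Finset.prod_pow_eq_pow_sum, ← hsdef]
  have h₂ : ((1 : ℝ) / 2) ^ (4 * (c * s)) ≤ (1 / n) ^ s * (1 / n) := by
    have e₁ : ((1 : ℝ) / 2) ^ (4 * (c * s)) = (1 / 4 ^ c) ^ (s + s) := by
      rw [show 4 * (c * s) = 2 * c * (s + s) by ring, pow_mul, pow_mul, one_div_pow, one_div_pow]
      norm_num
    have e₂ : (1 : ℝ) / 4 ^ c ≤ 1 / n := by
      apply one_div_le_one_div_of_le hn₀
      exact_mod_cast hn
    have e₃ : (1 : ℝ) / n ≤ 1 := by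
      rw [div_le_one hn₀]
      exact_mod_cast hn'
    calc ((1 : ℝ) / 2) ^ (4 * (c * s)) ≤ (1 / n) ^ (s + s) := by
          rw [e₁]; gcongr
      _ = (1 / n) ^ s * (1 / n) ^ s := pow_add _ _ _
      _ ≤ (1 / n) ^ s * (1 / n) ^ 1 := by
          gcongr ?_ * ?_
          exact pow_le_pow_of_le_one (by positivity) e₃ hs
      _ = _ := by rw [pow_one]
  calc ((2 ^ (k * k) : ℕ) : ℝ) * (1 / 2) ^ (4 * (c * s + k ^ 2))
      = ((1 / 8) ^ k ^ 2) * (1 / 2) ^ (4 * (c * s)) := by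
        rw [mul_add, pow_add, ← pow_two k, pow_mul (1 / 2 : ℝ) 4 (k ^ 2)]
        push_cast
        rw [mul_left_comm, ← mul_pow, mul_comm]
        norm_num
    _ ≤ ((1 / 8) ^ k ^ 2) * ((1 / n) ^ s * (1 / n)) := by gcongr
    _ = _ := by ring

/-- Certificates are unlikely in random graphs. -/
theorem pr_hasCertificate_le {n : ℕ} (hn : 3 ≤ n) :
    pr (fun G : SimpleGraph (Fin n) => HasCertificate G) ≤ 1 / n := by
  classical
  have hn₀ : (0 : ℝ) < n := by exact_mod_cast (by omega : 0 < n)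
  -- The threshold grows with `c`, so the least admissible `c` covers all. As `n ≥ 3`, it is at
  -- least 1, whence `2 ^ (c + 1) ≤ 4 ^ c`.
  obtain ⟨c, hc₁, hc₂⟩ : ∃ c, n ≤ 4 ^ c ∧ ∀ c', n ≤ 2 ^ (c' + 1) → c ≤ c' := by
    have hex : ∃ c, n ≤ 2 ^ (c + 1) :=
      ⟨n, Nat.lt_two_pow_self.le.trans (Nat.pow_le_pow_right (by norm_num) (by omega))⟩
    refine ⟨Nat.find hex, ?_, fun c' hc' => Nat.find_min' hex hc'⟩
    have h₁ := Nat.find_spec hex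
    have h₂ : 1 ≤ Nat.find hex := by
      by_contra h
      rw [show Nat.find hex = 0 by omega] at h₁
      norm_num at h₁
      omega
    refine h₁.trans ?_
    rw [show 4 = 2 ^ 2 by rfl, ← pow_mul]
    exact Nat.pow_le_pow_right (by norm_num) (by omega)
  have h₁ : pr (fun G : SimpleGraph (Fin n) => HasCertificate G) ≤
      ∑ k ∈ Finset.Icc 1 n, ∑ B : Fin k → Finset (Fin n),
        (1 / 8) ^ k ^ 2 * (∏ i, (1 / (n : ℝ)) ^ (B i).card) * (1 / n) := by
    refine le_trans (pr_mono (q := fun G => ∃ k ∈ Finset.Icc 1 n,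
      ∃ B ∈ (Finset.univ : Finset (Fin k → Finset (Fin n))),
      8 * (c * ∑ i, (B i).card + k ^ 2) < (blockPairs G B).card) ?_)
      ((pr_exists_le _ _).trans (Finset.sum_le_sum fun k _ => (pr_exists_le _ _).trans
        (Finset.sum_le_sum fun B _ => pr_blockPairs_le hc₁ (by omega) B)))
    rintro G ⟨c', k, B, h₁, h₂⟩
    have h₃ : 8 * (c * ∑ i, (B i).card + k ^ 2) < (blockPairs G B).card :=
      lt_of_le_of_lt (by gcongr; exact hc₂ _ h₁) h₂
    refine ⟨k, Finset.mem_Icc.2 ⟨?_, ?_⟩, B, Finset.mem_univ _, h₃⟩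
    · by_contra hk
      obtain rfl : k = 0 := by omega
      have : blockPairs G B = ∅ := by
        ext x
        simp [blockPairs]
      simp [this] at h₃
    -- There are at most `n ^ 2` pairs and the threshold exceeds `k ^ 2`, so only `k ≤ n` matters
    -- and the union bound is finite.
    · have h₄ : (blockPairs G B).card ≤ n * n := by
        simpa using Finset.card_le_univ (blockPairs G B)
      have h₅ : k ^ 2 ≤ n ^ 2 := by
        rw [pow_two n]
        omega
      exact (Nat.pow_le_pow_iff_left (by norm_num)).1 h₅
  refine h₁.trans ?_
  -- Summing over all families of blocks, each block contributes `∑ S, n ^ (-|S|) = (1 + 1 / n) ^ n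
  -- ≤ exp 1 ≤ 4`.
  have h₂ : ∀ k, ∑ B : Fin k → Finset (Fin n), ∏ i, (1 / (n : ℝ)) ^ (B i).card ≤ 4 ^ k := by
    intro k
    have e₁ : ∑ S : Finset (Fin n), (1 / (n : ℝ)) ^ S.card = (1 / n + 1) ^ n := by
      have := Fintype.sum_pow_mul_eq_add_pow (Fin n) (1 / (n : ℝ)) 1
      simpa using this
    have e₂ : (1 / (n : ℝ) + 1) ^ n ≤ 4 := by
      calc (1 / (n : ℝ) + 1) ^ n ≤ (Real.exp (1 / n)) ^ n := by
            gcongr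
            exact Real.add_one_le_exp _
        _ = Real.exp 1 := by
            rw [← Real.exp_nat_mul]
            congr 1
            field_simp
        _ ≤ 4 := by linarith [Real.exp_one_lt_d9]
    have e₃ := Finset.prod_univ_sum (fun _ : Fin k => (Finset.univ : Finset (Finset (Fin n))))
      fun _ S => (1 / (n : ℝ)) ^ S.card
    rw [Fintype.piFinset_univ] at e₃
    rw [← e₃, e₁, Finset.prod_const, Finset.card_univ, Fintype.card_fin]
    gcongr
  have h₃ : ∀ k ∈ Finset.Icc 1 n, ∑ B : Fin k → Finset (Fin n),
      (1 / 8) ^ k ^ 2 * (∏ i, (1 / (n : ℝ)) ^ (B i).card) * (1 / n) ≤ (1 / 2) ^ k * (1 / n) := by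
    intro k hk
    rw [Finset.mem_Icc] at hk
    rw [← Finset.sum_mul, ← Finset.mul_sum]
    gcongr
    calc (1 / 8) ^ k ^ 2 * ∑ B : Fin k → Finset (Fin n), ∏ i, (1 / (n : ℝ)) ^ (B i).card
        ≤ (1 / 8) ^ k * 4 ^ k := by
          gcongr ?_ * ?_
          · exact pow_le_pow_of_le_one (by norm_num) (by norm_num) (Nat.le_self_pow (by norm_num) k)
          · exact h₂ k
      _ = (1 / 2) ^ k := by rw [← mul_pow]; norm_num
  refine (Finset.sum_le_sum h₃).trans ?_
  rw [← Finset.sum_mul]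
  have h₄ : ∑ k ∈ Finset.Icc 1 n, (1 / 2 : ℝ) ^ k ≤ 1 := by
    have : ∀ m, ∑ k ∈ Finset.Icc 1 m, (1 / 2 : ℝ) ^ k = 1 - (1 / 2) ^ m := by
      intro m
      induction m with
      | zero => simp
      | succ m ih =>
        rw [Finset.sum_Icc_succ_top (by omega), ih]
        ring
    rw [this]
    have : (0 : ℝ) ≤ (1 / 2) ^ n := by positivity
    linarith
  calc _ ≤ 1 * (1 / (n : ℝ)) := by gcongr
    _ = 1 / n := one_mul _

/-! ### Meaning of the verification -/

open Classical in
theorem toList_encode {n : ℕ} (G : SimpleGraph (Fin n)) :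
    (encode G).toList = List.ofFn fun i =>
      ofList (List.ofFn fun j => ofBool (decide (G.Adj i j))) := by
  rw [encode, toList_ofList]

theorem len_encode {n : ℕ} (G : SimpleGraph (Fin n)) : (encode G).len = n := by
  simp [encode]

theorem left_ofList_drop (l : List BTree) (i : ℕ) :
    (ofList (l.drop i)).left = l.getD i .leaf := by
  induction l generalizing i with
  | nil => simp
  | cons a l ih => cases i <;> simp [ih]

theorem getD_ofFn {n : ℕ} (F : Fin n → BTree) (i : ℕ) :
    (List.ofFn F).getD i .leaf = if h : i < n then F ⟨i, h⟩ else .leaf := by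
  split_ifs with h
  · rw [List.getD_eq_getElem _ _ (by simpa using h), List.getElem_ofFn]
  · rw [List.getD_eq_default _ _ (by simpa using h)]

/-- Numbers from `n` on run off the lists, where the default value is a leaf; they behave as
non-vertices without neighbours. -/
theorem adjT_encode {n : ℕ} (G : SimpleGraph (Fin n)) (u v : BTree) :
    adjT (encode G) u v = true ↔
      ∃ (hu : u.len < n) (hv : v.len < n), G.Adj ⟨u.len, hu⟩ ⟨v.len, hv⟩ := by
  classical
  rw [adjT, left_ofList_drop, left_ofList_drop, toList_encode, getD_ofFn]
  by_cases hu : u.len < n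
  · rw [dif_pos hu, toList_ofList, getD_ofFn]
    by_cases hv : v.len < n
    · simp [hu, hv]
    · simp [hv, truth]
  · simp [hu, truth]

theorem blockAdj_iff (G B B' : BTree) :
    blockAdj G B B' = true ↔ ∀ u ∈ B.toList, ∀ v ∈ B'.toList, adjT G u v = true := by
  simp [blockAdj]

theorem memBlock_iff (u B : BTree) : memBlock u B = true ↔ ∃ w ∈ B.toList, w.len = u.len := by
  simp only [memBlock, truth_ofBool, List.any_eq_true, Bool.and_eq_true, Bool.not_eq_true',
    decide_eq_false_iff_not]
  refine exists_congr fun w => and_congr_right fun _ => ?_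
  omega

theorem covered_iff (G L u v : BTree) : covered G L u v = true ↔ ∃ B ∈ L.toList, ∃ B' ∈ L.toList,
    memBlock u B = true ∧ memBlock v B' = true ∧ blockAdj G B B' = true := by
  simp only [covered, List.any_eq_true, Bool.and_eq_true]
  grind

theorem sum_map_range (f : ℕ → ℕ) (m : ℕ) :
    ((List.range m).map f).sum = ∑ i ∈ Finset.range m, f i := by
  induction m with
  | zero => simp
  | succ m ih => simp [List.range_succ, Finset.sum_range_succ, ih]

theorem length_filter_range (p : ℕ → Bool) (m : ℕ) :
    ((List.range m).filter p).length = ∑ i ∈ Finset.range m, if p i = true then 1 else 0 := by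
  induction m with
  | zero => simp
  | succ m ih =>
    rw [List.range_succ, Finset.sum_range_succ, List.filter_append, List.length_append, ih]
    cases h : p m <;> simp [h]

theorem len_coveredPairs (G L : BTree) : (coveredPairs G L).len =
    ((Finset.range (G.len + 1) ×ˢ Finset.range (G.len + 1)).filter fun x =>
      covered G L (num x.1) (num x.2) = true).card := by
  rw [coveredPairs, len_ofList]
  simp only [toList_ofList, truth_ofBool]
  rw [List.length_flatMap, upTo_eq, toList_ofList, Finset.card_filter, Finset.sum_product,
    List.map_map, List.map_reverse, List.sum_reverse, sum_map_range]
  refine Finset.sum_congr rfl fun u _ => ?_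
  simp only [Function.comp_apply, List.map_reverse, List.filter_reverse, List.length_reverse,
    List.filter_map, List.length_map, length_filter_range]

theorem len_threshold (γ L : BTree) : (threshold γ L).len =
    8 * (γ.len * (L.toList.map fun B => B.len).sum + L.len ^ 2) := by
  simp only [threshold, List.length_flatMap, toList_num, len, toList_ofList, List.length_append,
    List.map_const', List.sum_replicate, List.length_replicate, smul_eq_mul,
    List.sum_map_mul_right]
  ring

theorem unary_len (cap bits : BTree) : (unary cap bits).len =
    bits.toList.foldl (fun a b => min (2 * a + b.truth.toNat) cap.len) 0 := by
  rw [unary_eq_num, len_num]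

/-- A capped value stays at the cap, because `2 * c + b.toNat ≥ c`; capping at each step is
therefore the same as capping at the end. -/
theorem foldl_min (c : ℕ) (l : List Bool) (a : ℕ) :
    l.foldl (fun a b => min (2 * a + b.toNat) c) (min a c) =
      min (l.foldl (fun a b => 2 * a + b.toNat) a) c := by
  induction l generalizing a with
  | nil => rfl
  | cons b l ih =>
    rw [List.foldl_cons, List.foldl_cons, ← ih]
    congr 1
    omega

/-- The number with the given binary digits. -/
def binary (l : List Bool) : ℕ := l.foldl (fun a b => 2 * a + b.toNat) 0

theorem unary_eq_binary (cap bits : BTree) :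
    (unary cap bits).len = min (binary (bits.toList.map truth)) cap.len := by
  rw [unary_len, binary, ← foldl_min, Nat.zero_min, List.foldl_map]

theorem binary_concat (l : List Bool) (b : Bool) : binary (l ++ [b]) = 2 * binary l + b.toNat := by
  simp [binary]

theorem binary_lt (l : List Bool) : binary l < 2 ^ l.length := by
  induction l using List.reverseRecOn with
  | nil => simp [binary]
  | append_singleton l b ih =>
    rw [binary_concat, List.length_append, List.length_singleton, pow_succ]
    have := b.toNat_le
    omega

theorem certified_iff {n : ℕ} (G : SimpleGraph (Fin n)) (γ L : BTree) :
    certified (encode G) γ L = true ↔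
      8 * (γ.len * (L.toList.map fun B => B.len).sum + L.len ^ 2) <
        ((Finset.range (n + 1) ×ˢ Finset.range (n + 1)).filter fun x =>
          covered (encode G) L (num x.1) (num x.2) = true).card ∧
      n ≤ binary (true :: γ.toList.map truth) := by
  rw [certified, Bool.and_eq_true, decide_eq_true_iff, len_threshold, len_coveredPairs]
  simp only [truth_ofBool, Bool.not_eq_true', decide_eq_false_iff_not, not_lt, unary_eq_binary,
    len_encode, toList_node, List.map_cons]
  simp

/-- Soundness, whatever list has been guessed: repeated vertices in a block only raise the
threshold, and a covered pair lies in joined blocks, so adjacency of its entries shows them to be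
smaller than `n`. This also disposes of the number `n`, which is among the candidates counted. -/
theorem HasCertificate.of_certified {n : ℕ} {G : SimpleGraph (Fin n)} {γ L : BTree}
    (h : certified (encode G) γ L = true) : HasCertificate G := by
  classical
  rw [certified_iff] at h
  obtain ⟨h₁, h₂⟩ := h
  let B : Fin L.toList.length → Finset (Fin n) := fun i =>
    Finset.univ.filter fun v => ∃ w ∈ (L.toList[i]).toList, w.len = v.1
  refine ⟨γ.len, L.toList.length, B, ?_, lt_of_le_of_lt ?_ (lt_of_lt_of_le h₁ ?_)⟩
  · have := binary_lt (true :: γ.toList.map truth)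
    simp only [List.length_cons, List.length_map] at this
    exact h₂.trans this.le
  · rw [show L.len = L.toList.length from rfl]
    gcongr
    rw [← Fin.sum_univ_fun_getElem L.toList fun B => B.len]
    refine Finset.sum_le_sum fun i _ => ?_
    have : (B i).image Fin.val ⊆ ((L.toList[i]).toList.map len).toFinset := by
      intro x hx
      simp only [B, Finset.mem_image, Finset.mem_filter, Finset.mem_univ, true_and] at hx
      obtain ⟨v, ⟨w, hw, hwv⟩, rfl⟩ := hx
      simpa using ⟨w, hw, hwv⟩
    rw [← Finset.card_image_of_injective _ Fin.val_injective]
    refine (Finset.card_le_card this).trans ((List.toFinset_card_le _).trans ?_)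
    simp [len]
  · rw [← Finset.card_image_of_injective (blockPairs G B)
      (Function.Injective.prodMap Fin.val_injective Fin.val_injective)]
    refine Finset.card_le_card fun x hx => ?_
    obtain ⟨C, hC, C', hC', hu, hv, hadj⟩ := (covered_iff _ _ _ _).1 (Finset.mem_filter.1 hx).2
    obtain ⟨i, hi, rfl⟩ := List.getElem_of_mem hC
    obtain ⟨j, hj, rfl⟩ := List.getElem_of_mem hC'
    rw [blockAdj_iff] at hadj
    rw [memBlock_iff, len_num] at hu hv
    obtain ⟨u, hu, hux⟩ := hu
    obtain ⟨v, hv, hvx⟩ := hv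
    obtain ⟨hun, hvn, huv⟩ := (adjT_encode G u v).1 (hadj u hu v hv)
    refine Finset.mem_image.2 ⟨(⟨u.len, hun⟩, ⟨v.len, hvn⟩), ?_, by simp [hux, hvx]⟩
    simp only [blockPairs, B, Finset.mem_filter, Finset.mem_univ, true_and]
    refine ⟨⟨i, hi⟩, ⟨j, hj⟩, ⟨u, hu, rfl⟩, ⟨v, hv, rfl⟩, ?_⟩
    rintro u' ⟨w, hw, hwu⟩ v' ⟨w', hw', hwv⟩
    obtain ⟨h₁, h₂, h₃⟩ := (adjT_encode G w w').1 (hadj w hw w' hw')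
    simpa [hwu, hwv] using h₃

/-! ### Correctness of the search -/

theorem blockAdj_symm {n : ℕ} (G : SimpleGraph (Fin n)) {B B' : BTree}
    (h : blockAdj (encode G) B B' = true) : blockAdj (encode G) B' B = true := by
  simp only [blockAdj_iff, adjT_encode] at h ⊢
  intro u hu v hv
  obtain ⟨h₁, h₂, h₃⟩ := h v hv u hu
  exact ⟨h₂, h₁, h₃.symm⟩

theorem blockAdj_irrefl {n : ℕ} (G : SimpleGraph (Fin n)) {B : BTree} (hB : B.toList ≠ []) :
    blockAdj (encode G) B B ≠ true := by
  simp only [blockAdj_iff, adjT_encode, ne_eq]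
  intro h
  obtain ⟨u, hu⟩ := List.exists_mem_of_ne_nil _ hB
  obtain ⟨_, _, h'⟩ := h u hu u hu
  exact G.loopless.irrefl _ h'

/-- The graph of blocks. -/
def blockGraph {n m : ℕ} (G : SimpleGraph (Fin n)) (S : Fin m → BTree) : SimpleGraph (Fin m) where
  Adj i j := i ≠ j ∧ blockAdj (encode G) (S i) (S j) = true
  symm := ⟨fun _ _ h => ⟨h.1.symm, blockAdj_symm G h.2⟩⟩
  loopless := ⟨fun _ h => h.1 rfl⟩

/-- An empty block would be joined to itself and put a true entry on the diagonal, hence `hS`. -/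
theorem blockMatrix_encode {n m : ℕ} (G : SimpleGraph (Fin n)) (S : Fin m → BTree)
    (hS : ∀ i, (S i).toList ≠ []) :
    blockMatrix (encode G) (ofList (List.ofFn S)) = encode (blockGraph G S) := by
  rw [blockMatrix, encode, toList_ofList, List.map_ofFn]
  congr 2
  funext i
  rw [Function.comp_apply, List.map_ofFn]
  congr 2
  funext j
  rw [Function.comp_apply]
  congr 1
  classical
  refine Bool.eq_iff_iff.2 (Iff.trans ?_ decide_eq_true_iff.symm)
  refine ⟨fun h => ⟨?_, h⟩, fun h => h.2⟩
  rintro rfl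
  exact blockAdj_irrefl G (hS i) h

/-- The blocks with indices in `l` contain a copy of `H`. -/
def HasCopy {n k N : ℕ} (G : SimpleGraph (Fin n)) (H : SimpleGraph (Fin k)) (S : Fin N → BTree)
    (l : List (Fin N)) : Prop :=
  ∃ f : Fin k → Fin N, Function.Injective f ∧ (∀ i, f i ∈ l) ∧
    ∀ i j, H.Adj i j → blockAdj (encode G) (S (f i)) (S (f j)) = true

theorem HasCopy.mono {n k N : ℕ} {G : SimpleGraph (Fin n)} {H : SimpleGraph (Fin k)}
    {S : Fin N → BTree} {l l' : List (Fin N)} (h : HasCopy G H S l) (hl : l ⊆ l') :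
    HasCopy G H S l' := by
  obtain ⟨f, hf, hl', hadj⟩ := h
  exact ⟨f, hf, fun i => hl (hl' i), hadj⟩

theorem hasCopy_iff {n k N : ℕ} (G : SimpleGraph (Fin n)) (H : SimpleGraph (Fin k))
    (S : Fin N → BTree) {l : List (Fin N)} (hl : l.Nodup) :
    HasCopy G H S l ↔ H.IsContained (blockGraph G (S ∘ l.get)) := by
  constructor
  · rintro ⟨f, hf, hl', hadj⟩
    choose φ hφ using fun i => List.mem_iff_get.1 (hl' i)
    refine ⟨⟨⟨φ, ?_⟩, ?_⟩⟩
    · intro i j h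
      refine ⟨fun h' => ?_, ?_⟩
      · exact H.ne_of_adj h (hf ((hφ i).symm.trans ((congrArg l.get h').trans (hφ j))))
      · have := hadj i j h
        rwa [← hφ i, ← hφ j] at this
    · intro i j h
      exact hf ((hφ i).symm.trans ((congrArg l.get h).trans (hφ j)))
  · rintro ⟨φ⟩
    refine ⟨fun i => l.get (φ i), fun i j h => ?_, fun i => List.get_mem _ _, fun i j h => ?_⟩
    · exact φ.injective ((List.nodup_iff_injective_get.1 hl) h)
    · exact (φ.toHom.map_adj h).2

/-- Discarding, one after the other, the elements of a list that are not needed for `p`. -/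
noncomputable def prune {α : Type*} (p : List α → Prop) : List α → List α → List α
  | K, [] => K
  | K, a :: R => open Classical in if p (K ++ R) then prune p K R else prune p (a :: K) R

/-- The lists that are tested in `prune`. -/
noncomputable def tested {α : Type*} (p : List α → Prop) : List α → List α → List (List α)
  | _, [] => []
  | K, a :: R => (K ++ R) ::
      (open Classical in if p (K ++ R) then tested p K R else tested p (a :: K) R)

section prune

variable {α : Type*} {p : List α → Prop}

theorem length_tested (K R : List α) : (tested p K R).length = R.length := by
  induction R generalizing K with
  | nil => rfl
  | cons a R ih => rw [tested]; split_ifs <;> simp [ih]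

theorem nodup_prune {K R : List α} (h : (K ++ R).Nodup) : (prune p K R).Nodup := by
  induction R generalizing K with
  | nil => simpa [prune] using h
  | cons a R ih =>
    rw [prune]
    split_ifs
    · exact ih (h.sublist (by simp))
    · exact ih (by simpa using List.nodup_middle.1 h)

theorem tested_prop {K R : List α} (h : (K ++ R).Nodup) {l : List α} (hl : l ∈ tested p K R) :
    l.Nodup ∧ l.length < (K ++ R).length := by
  induction R generalizing K with
  | nil => simp [tested] at hl
  | cons a R ih =>
    rw [tested, List.mem_cons] at hl
    rcases hl with rfl | hl
    · exact ⟨h.sublist (by simp), by simp⟩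
    · split_ifs at hl
      · obtain ⟨h₁, h₂⟩ := ih (h.sublist (by simp)) hl
        exact ⟨h₁, h₂.trans (by simp)⟩
      · obtain ⟨h₁, h₂⟩ := ih (by simpa using List.nodup_middle.1 h) hl
        exact ⟨h₁, h₂.trans_eq (by simp; omega)⟩

/-- A tested list is a list satisfying `p` with one element removed. This will show that tested
lists are nonempty, as the detector is only reliable on graphs with at least one vertex. -/
theorem prop_of_mem_tested (hp : ∀ l l', p l → l ⊆ l' → p l') (P : List α → Prop)
    {K R : List α} (hP : ∀ l a, p (a :: l) → P l) (h : p (K ++ R))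
    {l : List α} (hl : l ∈ tested p K R) : P l := by
  induction R generalizing K with
  | nil => simp [tested] at hl
  | cons a R ih =>
    have h' : p (a :: (K ++ R)) := hp _ _ h (by intro x; simp; tauto)
    rw [tested, List.mem_cons] at hl
    rcases hl with rfl | hl
    · exact hP _ _ h'
    · split_ifs at hl with hc
      · exact ih hc hl
      · exact ih h' hl

/-- Invariant: every kept element is indispensable, in that no list drawn from the current elements
without it satisfies `p`. An element is kept exactly when the list without it fails, and
monotonicity of `p` passes the failure on to everything drawn from that list. -/
theorem prune_spec (hp : ∀ l l', p l → l ⊆ l' → p l') {K R : List α} (h : p (K ++ R))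
    (hK : ∀ a ∈ K, ∀ l, l ⊆ K ++ R → a ∉ l → ¬ p l) :
    p (prune p K R) ∧ ∀ a ∈ prune p K R, ∀ l, l ⊆ prune p K R → a ∉ l → ¬ p l := by
  induction R generalizing K with
  | nil => rw [List.append_nil] at h hK; exact ⟨h, hK⟩
  | cons a R ih =>
    have hsub : K ++ R ⊆ K ++ a :: R := by intro x; simp; tauto
    have hsub' : a :: K ++ R ⊆ K ++ a :: R := by intro x; simp; tauto
    rw [prune]
    split_ifs with hc
    · exact ih hc fun b hb l hl => hK b hb l (List.Subset.trans hl hsub)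
    · refine ih (hp _ _ h (by intro x; simp; tauto)) fun b hb l hl hbl => ?_
      rcases List.mem_cons.1 hb with rfl | hb
      · intro hpl
        refine hc (hp _ _ hpl fun x hx => ?_)
        have := hl hx
        simp only [List.cons_append, List.mem_cons] at this
        rcases this with rfl | this
        · exact absurd hx hbl
        · exact this
      · exact hK b hb l (List.Subset.trans hl hsub') hbl

end prune

theorem search_eq_prune {n N : ℕ} (G : SimpleGraph (Fin n)) (S : Fin N → BTree)
    (p : List (Fin N) → Prop) (code r clk : BTree)
    (h : ∀ l ∈ tested p [] (List.finRange N),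
      (majority code (blockMatrix (encode G) (ofList (l.map S))) r clk = true ↔ p l)) :
    search (encode G) code r clk (ofList (List.ofFn S)) =
      ofList ((prune p [] (List.finRange N)).map S) := by
  have key : ∀ (R K : List (Fin N)), (∀ l ∈ tested p K R,
      (majority code (blockMatrix (encode G) (ofList (l.map S))) r clk = true ↔ p l)) →
      ((searchStep (encode G) code r clk)^[R.length]
        (.node (ofList (K.map S)) (ofList (R.map S)))).left = ofList ((prune p K R).map S) := by
    intro R
    induction R with
    | nil => intro K _; simp [prune]
    | cons a R ih =>
      intro K hK
      have h₁ := hK (K ++ R) (by simp [tested])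
      rw [List.length_cons, Function.iterate_succ_apply, prune]
      rw [tested] at hK
      have h₂ : searchStep (encode G) code r clk (.node (ofList (K.map S))
          (ofList ((a :: R).map S))) = open Classical in if p (K ++ R) then
            .node (ofList (K.map S)) (ofList (R.map S))
          else .node (ofList ((a :: K).map S)) (ofList (R.map S)) := by
        simp only [searchStep, left_node, right_node, toList_ofList, List.map_cons, ofList_cons,
          truth_ofBool, ← List.map_append]
        classical
        exact if_congr h₁ rfl rfl
      rw [h₂]
      split_ifs at hK ⊢ with hc
      · exact ih K fun l hl => hK l (List.mem_cons_of_mem _ hl)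
      · exact ih (a :: K) fun l hl => hK l (List.mem_cons_of_mem _ hl)
  have := key (List.finRange N) [] h
  rw [List.length_finRange, List.map_nil, ← List.ofFn_eq_map] at this
  rw [← this, search, len_ofList, List.length_ofFn]
  rfl

/-- A surviving block outside one chosen copy would be dispensable, so the survivors are exactly the
blocks of that copy. The vote has to be right only on the lists tested by the ideal run, whose
number and form do not depend on the coins for the vote. -/
theorem search_hasCopy {n k N : ℕ} (G : SimpleGraph (Fin n)) (H : SimpleGraph (Fin k))
    (S : Fin N → BTree) (code r clk : BTree) (hcopy : HasCopy G H S (List.finRange N))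
    (h : ∀ l ∈ tested (HasCopy G H S) [] (List.finRange N),
      (majority code (blockMatrix (encode G) (ofList (l.map S))) r clk = true ↔
        HasCopy G H S l)) :
    ∃ f : Fin k → Fin N, Function.Injective f ∧
      (∀ i j, H.Adj i j → blockAdj (encode G) (S (f i)) (S (f j)) = true) ∧
      (search (encode G) code r clk (ofList (List.ofFn S))).toList.Perm
        (List.ofFn fun i => S (f i)) := by
  rw [search_eq_prune G S _ code r clk h, toList_ofList]
  obtain ⟨h₁, h₂⟩ := prune_spec (p := HasCopy G H S) (K := []) (R := List.finRange N)
    (fun l l' h hl => h.mono hl) hcopy (by simp)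
  obtain ⟨f, hf, hfl, hadj⟩ := h₁
  refine ⟨f, hf, hadj, ?_⟩
  rw [show (List.ofFn fun i => S (f i)) = (List.ofFn f).map S by rw [List.map_ofFn]; rfl]
  refine List.Perm.map _ ((List.perm_ext_iff_of_nodup
    (nodup_prune (by simpa using List.nodup_finRange N)) (List.nodup_ofFn.2 hf)).2 fun a =>
    ⟨fun ha => ?_, fun ha => ?_⟩)
  · by_contra hc
    refine h₂ a ha (List.ofFn f) ?_ hc ⟨f, hf, by simp, hadj⟩
    intro x hx
    obtain ⟨i, rfl⟩ := by simpa using hx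
    exact hfl i
  · obtain ⟨i, rfl⟩ := by simpa using ha
    exact hfl i

/-! ### Certificates from copies of the pattern -/

theorem certified_of_perm {n k : ℕ} (G : SimpleGraph (Fin n)) (γ L : BTree) (B : Fin k → BTree)
    {ell : ℕ} (hL : L.toList.Perm (List.ofFn B)) (hB : ∀ i, (B i).len = ell)
    (hn : n ≤ binary (true :: γ.toList.map truth)) (X : Finset (Fin n × Fin n))
    (hX : ∀ x ∈ X, ∃ i j, (∃ u ∈ (B i).toList, u.len = x.1) ∧ (∃ v ∈ (B j).toList, v.len = x.2) ∧
      blockAdj (encode G) (B i) (B j) = true)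
    (hM : 8 * (γ.len * (k * ell) + k ^ 2) < X.card) : certified (encode G) γ L = true := by
  rw [certified_iff]
  refine ⟨?_, hn⟩
  have h₁ : (L.toList.map fun B => B.len).sum = k * ell := by
    rw [(hL.map _).sum_eq, List.map_ofFn, List.sum_ofFn]
    simp [hB]
  have h₂ : L.len = k := by rw [len, hL.length_eq, List.length_ofFn]
  rw [h₁, h₂]
  refine hM.trans_le ?_
  rw [← Finset.card_image_of_injective X
    (Function.Injective.prodMap Fin.val_injective Fin.val_injective)]
  refine Finset.card_le_card fun x hx => ?_
  obtain ⟨y, hy, rfl⟩ := Finset.mem_image.1 hx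
  obtain ⟨i, j, hi, hj, hadj⟩ := hX y hy
  simp only [Finset.mem_filter, Finset.mem_product, Finset.mem_range, Prod.map_fst, Prod.map_snd]
  refine ⟨⟨by omega, by omega⟩, (covered_iff _ _ _ _).2 ⟨B i, ?_, B j, ?_, ?_, ?_, hadj⟩⟩
  · exact hL.mem_iff.2 (by simp)
  · exact hL.mem_iff.2 (by simp)
  · rw [memBlock_iff, len_num]; exact hi
  · rw [memBlock_iff, len_num]; exact hj

/-- All large sets of vertices span many edges. -/
def Dense {k : ℕ} (a : ℕ) (H : SimpleGraph (Fin k)) : Prop :=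
  ∀ W : Finset (Fin k), k ≤ 8 * a * W.card → ∃ F : Finset (Fin k × Fin k),
    (∀ x ∈ F, x.1 ∈ W ∧ x.2 ∈ W ∧ H.Adj x.1 x.2) ∧ W.card ^ 2 ≤ 16 * F.card

/-- Blocks with a large union that form a copy of a dense pattern cover many pairs. -/
theorem Dense.exists_pairs {k a s : ℕ} {H : SimpleGraph (Fin k)} (hH : Dense a H) (hs : 1 ≤ s)
    {β : Type*} [DecidableEq β] (V : Fin k → Finset β) (hV : ∀ i, (V i).card ≤ 4 * a * s)
    (hU : k * s ≤ (Finset.univ.biUnion V).card) :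
    ∃ X : Finset (β × β), (∀ x ∈ X, ∃ i j, H.Adj i j ∧ x.1 ∈ V i ∧ x.2 ∈ V j) ∧
      k ^ 2 * s ^ 2 ≤ 4096 * a ^ 2 * X.card := by
  set U := Finset.univ.biUnion V with hUdef
  -- Each vertex of the union gets one owner among the blocks containing it. The sets `F i` of owned
  -- vertices are disjoint, so different edges of the pattern give disjoint products.
  have hown : ∀ x, ∃ i : Option (Fin k), x ∈ U → ∃ j, i = some j ∧ x ∈ V j := by
    intro x
    by_cases hx : x ∈ U
    · obtain ⟨j, -, hj⟩ := Finset.mem_biUnion.1 hx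
      exact ⟨some j, fun _ => ⟨j, rfl, hj⟩⟩
    · exact ⟨none, fun h => absurd h hx⟩
  choose o ho using hown
  let F : Fin k → Finset β := fun i => U.filter fun x => o x = some i
  have hFV : ∀ i, F i ⊆ V i := by
    intro i x hx
    obtain ⟨hxU, hxo⟩ := Finset.mem_filter.1 hx
    obtain ⟨j, hj, hxj⟩ := ho x hxU
    rw [hxo, Option.some_inj] at hj
    rwa [hj]
  have hsum : ∑ i, (F i).card = U.card := by
    rw [← Finset.card_biUnion]
    · congr 1
      ext x
      simp only [F, Finset.mem_biUnion, Finset.mem_univ, true_and, Finset.mem_filter]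
      refine ⟨fun ⟨i, h, _⟩ => h, fun h => ?_⟩
      obtain ⟨j, hj, -⟩ := ho x h
      exact ⟨j, h, hj⟩
    · intro i _ j _ hij
      refine Finset.disjoint_left.2 ?_
      intro x hx hx'
      have := (Finset.mem_filter.1 hx).2.symm.trans (Finset.mem_filter.1 hx').2
      exact hij (Option.some_inj.1 this)
  -- The blocks owning at least `s / 2` vertices. The others own at most `k * s / 2` in total and a
  -- block has at most `4 * a * s` vertices, so the lower bound for the union forces `k ≤ 8 * a *
  -- W.card`.
  let W : Finset (Fin k) := Finset.univ.filter fun i => s ≤ 2 * (F i).card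
  have hW : k ≤ 8 * a * W.card := by
    have h₁ : ∑ i, 2 * (F i).card ≤ ∑ i, (s + if s ≤ 2 * (F i).card then 8 * a * s else 0) := by
      refine Finset.sum_le_sum fun i _ => ?_
      have := (Finset.card_le_card (hFV i)).trans (hV i)
      split_ifs with h
      · nlinarith
      · omega
    rw [Finset.sum_add_distrib, ← Finset.mul_sum, hsum, ← Finset.sum_filter] at h₁
    simp only [Finset.sum_const, Finset.card_univ, Fintype.card_fin, smul_eq_mul] at h₁
    change 2 * U.card ≤ k * s + W.card * (8 * a * s) at h₁
    have : k * s ≤ 8 * a * W.card * s := by nlinarith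
    exact Nat.le_of_mul_le_mul_right this hs
  obtain ⟨E, hE, hWE⟩ := hH W hW
  refine ⟨E.biUnion fun e => F e.1 ×ˢ F e.2, ?_, ?_⟩
  · intro x hx
    obtain ⟨e, he, hxe⟩ := Finset.mem_biUnion.1 hx
    obtain ⟨h₁, h₂⟩ := Finset.mem_product.1 hxe
    exact ⟨e.1, e.2, (hE e he).2.2, hFV _ h₁, hFV _ h₂⟩
  · rw [Finset.card_biUnion]
    · have h₁ : E.card * s ^ 2 ≤ 4 * ∑ e ∈ E, (F e.1 ×ˢ F e.2).card := by
        rw [Finset.mul_sum, ← smul_eq_mul, ← Finset.sum_const]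
        refine Finset.sum_le_sum fun e he => ?_
        obtain ⟨h₁, h₂, -⟩ := hE e he
        have h₁ := (Finset.mem_filter.1 h₁).2
        have h₂ := (Finset.mem_filter.1 h₂).2
        rw [Finset.card_product]
        nlinarith [Nat.mul_le_mul h₁ h₂]
      have h₂ : k ^ 2 ≤ 64 * a ^ 2 * W.card ^ 2 := by nlinarith [Nat.mul_le_mul hW hW]
      calc k ^ 2 * s ^ 2 ≤ (64 * a ^ 2 * W.card ^ 2) * s ^ 2 := by gcongr
        _ ≤ (64 * a ^ 2 * (16 * E.card)) * s ^ 2 := by gcongr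
        _ = 1024 * a ^ 2 * (E.card * s ^ 2) := by ring
        _ ≤ 1024 * a ^ 2 * (4 * ∑ e ∈ E, (F e.1 ×ˢ F e.2).card) := by gcongr
        _ = _ := by ring
    · intro e _ e' _ hee'
      refine Finset.disjoint_left.2 ?_
      intro x hx hx'
      obtain ⟨h₁, h₂⟩ := Finset.mem_product.1 hx
      obtain ⟨h₁', h₂'⟩ := Finset.mem_product.1 hx'
      refine hee' (Prod.ext ?_ ?_)
      · exact Option.some_inj.1
          ((Finset.mem_filter.1 h₁).2.symm.trans (Finset.mem_filter.1 h₁').2)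
      · exact Option.some_inj.1
          ((Finset.mem_filter.1 h₂).2.symm.trans (Finset.mem_filter.1 h₂').2)

/-! ### Decoding random bits -/

/-- Postfix notation of a tree. -/
def postfixCode : BTree → List Bool
  | .leaf => [true]
  | .node a b => postfixCode a ++ postfixCode b ++ [false]

theorem length_postfixCode (x : BTree) : (postfixCode x).length = x.size := by
  induction x with
  | leaf => rfl
  | node a b ha hb => simp [postfixCode, ha, hb, add_assoc]

/-- Whatever precedes the code of `x` only leaves debris deeper in the stack. -/
theorem parse_append (l : List BTree) (x : BTree) :
    parse (ofList (l ++ (postfixCode x).map ofBool)) = x := by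
  have : ∀ (x st : BTree), ((postfixCode x).map ofBool).foldl (fun st b => if b.truth then
      BTree.node .leaf st else .node (.node st.right.left st.left) st.right.right) st =
      .node x st := by
    intro x
    induction x with
    | leaf => simp [postfixCode]
    | node a b ha hb =>
      intro st
      simp only [postfixCode, List.map_append, List.foldl_append, ha, hb]
      simp
  rw [parse, toList_ofList, List.foldl_append, this, left_node]

theorem take_ofFn {α : Type*} {t N : ℕ} (h : N ≤ t) (F : Fin t → α) :
    (List.ofFn F).take N = List.ofFn fun i : Fin N => F (Fin.castLE h i) := by
  apply List.ext_getElem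
  · simpa using h
  · intro i h₁ h₂
    simp

theorem binary_replicate (e : ℕ) : binary (true :: List.replicate e false) = 2 ^ e := by
  induction e with
  | zero => rfl
  | succ e ih =>
    rw [List.replicate_succ', ← List.cons_append, binary_concat, ih, pow_succ]
    simp [mul_comm]

/-- The vertex given by the random bits `y`. -/
def digits {b : ℕ} (y : Fin b → Bool) : Fin (2 ^ b) :=
  ⟨binary (List.ofFn y), by simpa using binary_lt (List.ofFn y)⟩

/-- A block of vertices, with the numbers that are too large cut off. -/
def block (n : ℕ) {m ell : ℕ} (x : Fin ell → Fin m) : BTree :=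
  ofList (List.ofFn fun j => num (min (x j) n))

/-- The numbers given by a three-dimensional array of random bits. -/
def sampled {t N ell b : ℕ} (hN : N ≤ t) (hell : ell ≤ t) (hb : b ≤ t)
    (r : Fin t → Fin t → Fin t → Bool) : Fin N → Fin ell → Fin (2 ^ b) := fun i j =>
  digits fun c => r (Fin.castLE hN i) (Fin.castLE hell j) (Fin.castLE hb c)

theorem blocks_bits {n t e ell b : ℕ} (G : SimpleGraph (Fin n)) (he : 2 ^ e ≤ t) (hell : ell ≤ t)
    (hb : b ≤ t) (r : Fin t → Fin t → Fin t → Bool) :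
    blocks (encode G) (num t) (num e) (num ell) (num b) (bits₃ r) =
      ofList (List.ofFn fun i => block n (sampled he hell hb r i)) := by
  have h₁ : (unary (num t) (.node (ofBool true) (num e))).len = 2 ^ e := by
    rw [unary_eq_binary, toList_node, toList_num, List.map_cons, List.map_replicate, len_num,
      truth_ofBool, truth_leaf, binary_replicate, min_eq_left he]
  rw [blocks, h₁, bits₃, toList_ofList, toList_ofList, take_ofFn he, List.map_ofFn]
  congr 2
  funext i
  rw [Function.comp_apply, bits₂, toList_ofList, toList_ofList, len_num, len_num, take_ofFn hell,
    List.map_ofFn, block]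
  congr 2
  funext j
  rw [Function.comp_apply, bits₁, toList_ofList, take_ofFn hb]
  have h₂ := unary_eq_binary (encode G) (ofList (List.ofFn fun c : Fin b =>
    ofBool (r (Fin.castLE he i) (Fin.castLE hell j) (Fin.castLE hb c))))
  rw [unary_eq_num, len_num] at h₂
  rw [unary_eq_num, h₂, len_encode, toList_ofList, List.map_ofFn]
  congr 2
  simp [sampled, digits, Function.comp_def]

/-! ### Uniform maps -/

section Unif

variable {Ω Ω' Ω'' : Type*} [Fintype Ω] [Fintype Ω'] [Fintype Ω'']

/-- The map `φ` maps the uniform distribution to the uniform distribution. -/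
def Unif (φ : Ω → Ω') : Prop := ∀ y, pr (fun ω => φ ω = y) = 1 / Fintype.card Ω'

theorem Unif.pr_eq {φ : Ω → Ω'} (h : Unif φ) (p : Ω' → Prop) : pr (fun ω => p (φ ω)) = pr p := by
  classical
  have h₁ : ((Finset.univ.filter fun ω => p (φ ω)).card : ℝ) =
      ∑ y ∈ Finset.univ.filter p, ((Finset.univ.filter fun ω => φ ω = y).card : ℝ) := by
    norm_cast
    rw [Finset.card_eq_sum_card_fiberwise (f := φ) (t := Finset.univ.filter p)
      (fun ω hω => by simpa using hω)]
    refine Finset.sum_congr rfl fun y hy => ?_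
    congr 1
    ext ω
    simp only [Finset.mem_filter, Finset.mem_univ, true_and] at hy ⊢
    exact ⟨fun h => h.2, fun h => ⟨h ▸ hy, h⟩⟩
  rw [PatternDetection.pr_eq, h₁, Finset.sum_div, PatternDetection.pr_eq]
  have h₂ : ∀ y ∈ Finset.univ.filter p, ((Finset.univ.filter fun ω => φ ω = y).card : ℝ) /
      Fintype.card Ω = 1 / Fintype.card Ω' := fun y _ => by
    rw [← h y, PatternDetection.pr_eq]
  rw [Finset.sum_congr rfl h₂, Finset.sum_const, nsmul_eq_mul, mul_one_div]

theorem Unif.comp {ψ : Ω' → Ω''} {φ : Ω → Ω'} (hψ : Unif ψ) (hφ : Unif φ) :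
    Unif fun ω => ψ (φ ω) := fun y => by rw [hφ.pr_eq fun z => ψ z = y, hψ]

theorem pr_eq_singleton (y : Ω) : pr (fun ω => ω = y) = 1 / Fintype.card Ω := by
  classical
  rw [PatternDetection.pr_eq, Finset.filter_eq' Finset.univ y]
  simp

theorem Unif.of_bijective {φ : Ω → Ω'} (h : Function.Bijective φ) : Unif φ := fun y => by
  rw [← pr_eq_singleton y, ← pr_equiv (Equiv.ofBijective φ h)]
  rfl

theorem Unif.pi {ι : Type*} [Fintype ι] [DecidableEq ι] {φ : Ω → Ω'} (h : Unif φ) :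
    Unif fun (ω : ι → Ω) i => φ (ω i) := fun y => by
  simp only [funext_iff]
  rw [pr_pi fun i ω => φ ω = y i]
  simp [h _]

theorem Unif.restrict {ι ι' : Type*} [Fintype ι] [DecidableEq ι] [Fintype ι'] [DecidableEq ι']
    [Nonempty Ω] {f : ι' → ι} (hf : Function.Injective f) :
    Unif fun (ω : ι → Ω) i => ω (f i) := fun y => by
  have h₁ : pr (fun ω : ι → Ω => (fun i => ω (f i)) = y) =
      pr fun ω : ι → Ω => ∀ j, ∀ i, f i = j → ω j = y i :=
    pr_congr fun ω => by
      rw [funext_iff]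
      exact ⟨fun h j i hij => hij ▸ h i, fun h i => h (f i) i rfl⟩
  rw [h₁, pr_pi fun j ω => ∀ i, f i = j → ω = y i,
    ← Finset.prod_subset (Finset.subset_univ (Finset.univ.image f)),
    Finset.prod_image fun _ _ _ _ h => hf h]
  · rw [Finset.prod_congr rfl (g := fun _ => 1 / (Fintype.card Ω : ℝ))]
    · simp
    · intro i _
      rw [← pr_eq_singleton (y i)]
      refine pr_congr fun ω => ⟨fun h => h i rfl, fun h j hj => ?_⟩
      rw [h, hf hj]
  · intro j _ hj
    rw [← pr_true (Ω := Ω)]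
    refine pr_congr fun ω => iff_of_true (fun i hi => ?_) trivial
    exact absurd (Finset.mem_image.2 ⟨i, Finset.mem_univ _, hi⟩) hj

end Unif

/-! ### Uniformity of the decoded data -/

theorem binary_injective {l l' : List Bool} (h : l.length = l'.length)
    (hb : binary l = binary l') : l = l' := by
  induction l using List.reverseRecOn generalizing l' with
  | nil => exact (List.length_eq_zero_iff.1 h.symm).symm
  | append_singleton l b ih =>
    rcases List.eq_nil_or_concat' l' with rfl | ⟨l', b', rfl⟩
    · simp at h
    · rw [binary_concat, binary_concat] at hb
      have h₁ : binary l = binary l' ∧ b = b' := by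
        cases b <;> cases b' <;> simp at hb ⊢ <;> omega
      rw [ih (by simpa using h) h₁.1, h₁.2]

theorem unif_digits (b : ℕ) : Unif (digits (b := b)) := by
  refine Unif.of_bijective ((Fintype.bijective_iff_injective_and_card _).2 ⟨fun y y' h => ?_, ?_⟩)
  · exact List.ofFn_injective (binary_injective (by simp) (congrArg Fin.val h))
  · simp

theorem unif_sampled {t N ell b : ℕ} (hN : N ≤ t) (hell : ell ≤ t) (hb : b ≤ t) :
    Unif (sampled hN hell hb) := by
  have h₁ : Unif fun (y : Fin t → Bool) => digits fun c => y (Fin.castLE hb c) :=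
    (unif_digits b).comp (Unif.restrict (Fin.castLE_injective hb))
  have h₂ := (h₁.pi (ι := Fin ell)).comp
    (Unif.restrict (Ω := Fin t → Bool) (Fin.castLE_injective hell))
  exact (h₂.pi (ι := Fin N)).comp
    (Unif.restrict (Ω := Fin t → Fin t → Bool) (Fin.castLE_injective hN))

/-- Only the last `x.size` bits matter, by `parse_append`. -/
theorem pr_parse {t : ℕ} (x : BTree) (ht : x.size ≤ t) :
    (1 / 2 : ℝ) ^ x.size ≤ pr fun ω : Fin t → Bool => parse (bits₁ ω) = x := by
  obtain ⟨s, rfl⟩ := Nat.exists_eq_add_of_le' ht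
  have h₁ : (1 / 2 : ℝ) ^ x.size = pr fun ω : Fin (s + x.size) → Bool =>
      (fun i => ω (Fin.natAdd s i)) =
        fun i : Fin x.size => (postfixCode x)[i]'(by rw [length_postfixCode]; exact i.2) := by
    rw [Unif.restrict (Fin.natAdd_injective _ s) _]
    simp
  rw [h₁]
  refine pr_mono fun ω hω => ?_
  rw [bits₁, List.ofFn_add]
  rw [show (List.ofFn fun i => ofBool (ω (Fin.natAdd s i))) = (postfixCode x).map ofBool from ?_,
    parse_append]
  simp only [funext_iff] at hω
  apply List.ext_getElem
  · simp [length_postfixCode]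
  · intro i h₁ h₂
    have := hω ⟨i, by simpa using h₁⟩
    rw [List.getElem_ofFn, List.getElem_map]
    exact congrArg ofBool this

/-! ### The events of a successful stage -/

/-- Bernoulli's inequality together with `(1 - q) * (1 + q) ≤ 1`. It is used as `(1 - q) ^ N ≤ 1 /
(1 + N * q)`: `N` trials of success probability `q` are unlikely to fail all. -/
theorem one_sub_pow_mul_le {q : ℝ} (h₀ : 0 ≤ q) (h₁ : q ≤ 1) (N : ℕ) :
    (1 - q) ^ N * (1 + N * q) ≤ 1 := by
  calc (1 - q) ^ N * (1 + N * q) ≤ (1 - q) ^ N * (1 + q) ^ N := by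
        refine mul_le_mul_of_nonneg_left ?_ (pow_nonneg (by linarith) _)
        exact one_add_mul_le_pow (by linarith) N
    _ = ((1 - q) * (1 + q)) ^ N := (mul_pow _ _ _).symm
    _ ≤ 1 := pow_le_one₀ (mul_nonneg (by linarith) (by linarith)) (by nlinarith)

theorem pr_mem {m : ℕ} (C : Finset (Fin m)) : pr (fun x => x ∈ C) = C.card / m := by
  classical
  rw [pr_eq]
  simp

theorem pr_forall_mem {m ell : ℕ} (C : Finset (Fin m)) :
    pr (fun x : Fin ell → Fin m => ∀ j, x j ∈ C) = ((C.card : ℝ) / m) ^ ell := by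
  rw [pr_pi fun _ x => x ∈ C]
  simp [pr_mem, div_pow]

/-- A random block is likely to be contained in a given large set. -/
theorem pr_no_block {N ell m : ℕ} [NeZero m] (C : Finset (Fin m)) :
    pr (fun x : Fin N → Fin ell → Fin m => ¬ ∃ i, ∀ j, x i j ∈ C) *
      (1 + N * ((C.card : ℝ) / m) ^ ell) ≤ 1 := by
  have h₁ : pr (fun x : Fin N → Fin ell → Fin m => ¬ ∃ i, ∀ j, x i j ∈ C) =
      (1 - ((C.card : ℝ) / m) ^ ell) ^ N := by
    simp only [not_exists]
    rw [pr_pi fun _ (y : Fin ell → Fin m) => ¬ ∀ j, y j ∈ C, pr_not, pr_forall_mem]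
    simp
  rw [h₁, ← pr_forall_mem]
  exact one_sub_pow_mul_le (pr_nonneg _) (pr_le_one _) N

/-- A few random blocks are unlikely to have a small union. -/
theorem pr_small_union {N ell m k u : ℕ} [NeZero m] (hu : 1 ≤ u) :
    pr (fun x : Fin N → Fin ell → Fin m => ∃ f : Fin k → Fin N, Function.Injective f ∧
      (Finset.univ.biUnion fun i => Finset.univ.image (x (f i))).card ≤ u) ≤
      (N : ℝ) ^ k * m ^ u * ((u : ℝ) / m) ^ (ell * k) := by
  classical
  have h₁ : ∀ (f : Fin k → Fin N) (C : Finset (Fin m)), Function.Injective f →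
      pr (fun x : Fin N → Fin ell → Fin m => ∀ i j, x (f i) j ∈ C) =
        ((C.card : ℝ) / m) ^ (ell * k) := by
    intro f C hf
    rw [(Unif.restrict (Ω := Fin ell → Fin m) hf).pr_eq fun y => ∀ i j, y i j ∈ C,
      pr_pi fun _ (y : Fin ell → Fin m) => ∀ j, y j ∈ C, pr_forall_mem, Finset.prod_const, Finset.card_univ,
      Fintype.card_fin, pow_mul]
  -- Small sets are enclosed in images of maps `Fin u → Fin m`; the union bound over these maps
  -- gives the factor `m ^ u`.
  have h₂ : ∀ U : Finset (Fin m), U.card ≤ u →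
      ∃ σ : Fin u → Fin m, U ⊆ Finset.univ.image σ := by
    intro U hU
    rcases U.eq_empty_or_nonempty with rfl | ⟨y, -⟩
    · exact ⟨fun _ => 0, by simp⟩
    · refine ⟨fun i => if h : i.1 < U.card then U.equivFin.symm ⟨i, h⟩ else y, fun z hz => ?_⟩
      refine Finset.mem_image.2 ⟨⟨U.equivFin ⟨z, hz⟩, (U.equivFin ⟨z, hz⟩).2.trans_le hU⟩,
        Finset.mem_univ _, ?_⟩
      simp
  refine le_trans (pr_mono (q := fun x => ∃ f ∈ (Finset.univ : Finset (Fin k → Fin N)),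
    ∃ σ ∈ (Finset.univ : Finset (Fin u → Fin m)), Function.Injective f ∧
      ∀ i j, x (f i) j ∈ Finset.univ.image σ) ?_) ?_
  · rintro x ⟨f, hf, hfu⟩
    obtain ⟨σ, hσ⟩ := h₂ _ hfu
    exact ⟨f, Finset.mem_univ _, σ, Finset.mem_univ _, hf, fun i j => hσ (by simp)⟩
  · refine (pr_exists_le _ _).trans ((Finset.sum_le_sum fun f _ => (pr_exists_le _ _).trans
      (Finset.sum_le_sum (g := fun _ => ((u : ℝ) / m) ^ (ell * k)) fun σ _ => ?_)).trans_eq ?_)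
    · by_cases hf : Function.Injective f
      · refine (pr_mono fun x hx => hx.2).trans ((h₁ f _ hf).trans_le ?_)
        gcongr
        exact Finset.card_image_le.trans (by simp)
      · refine (pr_mono (q := fun _ => False) fun x hx => hf hx.1).trans ?_
        rw [pr_false]
        positivity
    · simp [mul_assoc]

/-- A majority vote among independent trials is unlikely to go wrong. -/
theorem pr_majority_le {Ω : Type*} [Fintype Ω] [Nonempty Ω] (t : ℕ) (right : Ω → Prop)
    [DecidablePred right] (h : 2 / 3 ≤ pr right) :
    pr (fun ω : Fin t → Ω => (Finset.univ.filter fun i => right (ω i)).card ≤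
      (Finset.univ.filter fun i => ¬ right (ω i)).card) ≤ (17 / 18) ^ t := by
  -- The product of the weights is at least 1 unless the right trials form a strict majority, and
  -- each mean is at most `2 / 3 * (2 / 3) + 1 / 3 * (3 / 2) = 17 / 18`.
  have key := pr_le_prod_ge (ι := Fin t) (Ω := Ω) (fun _ x => if right x then 2 / 3 else 3 / 2)
    (fun _ x => by split_ifs <;> norm_num) (a := 1) one_pos
  have hc : (0 : ℝ) < Fintype.card Ω := by exact_mod_cast Fintype.card_pos
  refine le_trans (pr_mono fun ω hω => ?_) (key.trans ?_)
  · rw [Finset.prod_ite, Finset.prod_const, Finset.prod_const]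
    calc (1 : ℝ) = (2 / 3) ^ (Finset.univ.filter fun i => right (ω i)).card *
          (3 / 2) ^ (Finset.univ.filter fun i => right (ω i)).card := by
          rw [← mul_pow]; norm_num
      _ ≤ _ := by
          gcongr
          norm_num
  · rw [div_one, Finset.prod_const, Finset.card_univ, Fintype.card_fin]
    refine pow_le_pow_left₀ (div_nonneg (Finset.sum_nonneg fun x _ => ?_) hc.le) ?_ t
    · split_ifs <;> norm_num
    · rw [div_le_iff₀ hc, Finset.sum_ite, Finset.sum_const, Finset.sum_const, nsmul_eq_mul,
        nsmul_eq_mul]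
      have h₁ := Finset.card_filter_add_card_filter_not (s := (Finset.univ : Finset Ω)) right
      have h₂ : ((Finset.univ.filter right).card : ℝ) +
          (Finset.univ.filter fun x => ¬ right x).card = Fintype.card Ω := by
        exact_mod_cast h₁
      rw [pr_eq, le_div_iff₀ hc] at h
      linarith

theorem length_filter_ofFn {t : ℕ} (F : Fin t → BTree) (p : BTree → Bool) :
    ((List.ofFn F).filter p).length = (Finset.univ.filter fun i => p (F i) = true).card := by
  rw [List.ofFn_eq_map, List.filter_map, List.length_map,
    ← List.toFinset_card_of_nodup ((List.nodup_finRange t).filter _), List.toFinset_filter]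
  congr 1
  ext i
  simp

open Classical in
theorem pr_majority_ne {k n T t : ℕ} (P : Prog) (H : SimpleGraph (Fin k)) (Γ : SimpleGraph (Fin n))
    (h : 2 / 3 ≤ output P T (encode Γ) (some (decide (H.IsContained Γ)))) (hT : T ≤ t)
    (hcost : P.cost * T ≤ t) :
    pr (fun ω : Fin t → Fin t → Bool =>
      ¬ (majority P.code (encode Γ) (bits₂ ω) (num t) = true ↔ H.IsContained Γ)) ≤
        (17 / 18) ^ t := by
  set b := decide (H.IsContained Γ) with hb
  let I : (Fin t → Bool) → Bool := fun ρ => (interp P.code (encode Γ) (bits₁ ρ) (num t)).truth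
  have h₁ : 2 / 3 ≤ pr fun ρ : Fin t → Bool => I ρ = b := by
    have e₁ : output P T (encode Γ) (some b) = ansProb T ([P], encode Γ) (some b) := rfl
    rw [e₁, ansProb_eq_pr hT] at h
    have e₂ : (2 / 3 : ℝ≥0∞) = ENNReal.ofReal (2 / 3) := by
      rw [ENNReal.ofReal_div_of_pos (by norm_num)]
      simp
    rw [e₂, ENNReal.ofReal_le_ofReal_iff (pr_nonneg _)] at h
    refine h.trans (pr_mono fun ρ hρ => ?_)
    have := interp_code P T (encode Γ) (num t) (List.ofFn ρ) b hρ (by rwa [len_num])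
    rw [List.map_ofFn] at this
    change interp P.code (encode Γ) (bits₁ ρ) (num t) = ofBool b at this
    simp [I, this]
  refine le_trans (pr_mono fun ω hω => ?_) (pr_majority_le t _ h₁)
  have e₁ : (H.IsContained Γ) ↔ b = true := by simp [hb]
  rw [e₁, ← Bool.eq_iff_iff, majority, len_ofList, len_ofList, bits₂, toList_ofList,
    length_filter_ofFn, length_filter_ofFn] at hω
  simp only [truth_ofBool, Bool.not_eq_true'] at hω
  change ¬ decide ((Finset.univ.filter fun i => I (ω i) = false).card <
    (Finset.univ.filter fun i => I (ω i) = true).card) = b at hω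
  clear_value b
  cases b
  · simpa using (lt_of_not_ge fun h' => hω (decide_eq_false (not_lt.2 h'))).le
  · simpa using le_of_not_gt fun h' => hω (decide_eq_true h')

/-! ### The success probability of a stage -/

theorem mem_block {n m ell : ℕ} (x : Fin ell → Fin m) (w : BTree) :
    w ∈ (block n x).toList ↔ ∃ j, num (min (x j) n) = w := by
  simp [block]

theorem blockAdj_block {n m ell : ℕ} (G : SimpleGraph (Fin n)) (x y : Fin ell → Fin m) :
    blockAdj (encode G) (block n x) (block n y) = true ↔
      ∀ i j, ∃ (h : (x i : ℕ) < n) (h' : (y j : ℕ) < n), G.Adj ⟨x i, h⟩ ⟨y j, h'⟩ := by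
  rw [blockAdj_iff]
  simp only [mem_block, forall_exists_index, forall_apply_eq_imp_iff, adjT_encode, len_num]
  refine forall_congr' fun i => forall_congr' fun j => ⟨?_, ?_⟩
  · rintro ⟨h₁, h₂, h⟩
    have h₁' : (x i : ℕ) < n := by omega
    have h₂' : (y j : ℕ) < n := by omega
    simp only [min_eq_left h₁'.le, min_eq_left h₂'.le] at h
    exact ⟨h₁', h₂', h⟩
  · rintro ⟨h₁, h₂, h⟩
    simp only [min_eq_left h₁.le, min_eq_left h₂.le]
    exact ⟨h₁, h₂, h⟩

/-- Copies of a dense pattern among blocks yield certificates. -/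
theorem Dense.certified {n k a s b : ℕ} (G : SimpleGraph (Fin n)) {H : SimpleGraph (Fin k)}
    (hH : Dense a H) (hs : 1 ≤ s) (hn : n ≤ 2 ^ b)
    (hnum : 32768 * a ^ 2 * (4 * a * b * s + k) < k * s ^ 2)
    (x : Fin k → Fin (4 * a * s) → Fin (2 ^ b))
    (hx : k * s ≤ (Finset.univ.biUnion fun i => Finset.univ.image (x i)).card)
    (hadj : ∀ i j, H.Adj i j → blockAdj (encode G) (block n (x i)) (block n (x j)) = true)
    (L : BTree) (hL : L.toList.Perm (List.ofFn fun i => block n (x i))) :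
    PatternDetection.certified (encode G) (num b) L = true := by
  classical
  obtain ⟨X, hX, hcard⟩ := hH.exists_pairs hs (fun i => Finset.univ.image (x i))
    (fun i => Finset.card_image_le.trans (by simp)) hx
  let Y : Finset (Fin n × Fin n) := Finset.univ.filter fun y =>
    (Fin.castLE hn y.1, Fin.castLE hn y.2) ∈ X
  refine certified_of_perm G (num b) L _ hL (ell := 4 * a * s) (fun i => by simp [block]) ?_ Y ?_ ?_
  · rw [toList_num, List.map_replicate, truth_leaf, binary_replicate]
    exact hn
  · intro y hy
    obtain ⟨i, j, hij, h₁, h₂⟩ := hX _ (Finset.mem_filter.1 hy).2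
    obtain ⟨c, -, hc⟩ := Finset.mem_image.1 h₁
    obtain ⟨d, -, hd⟩ := Finset.mem_image.1 h₂
    refine ⟨i, j, ⟨num (min (x i c) n), (mem_block _ _).2 ⟨c, rfl⟩, ?_⟩,
      ⟨num (min (x j d) n), (mem_block _ _).2 ⟨d, rfl⟩, ?_⟩, hadj i j hij⟩
    · rw [len_num, hc]
      simp
    · rw [len_num, hd]
      simp
  -- `X` consists of pairs of numbers below `2 ^ b`. They lie in joined blocks, so all of them are
  -- pairs of vertices of `G`.
  · have h₁ : X.card ≤ Y.card := by
      refine (Finset.card_le_card (t := Y.image fun y => (Fin.castLE hn y.1, Fin.castLE hn y.2))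
        fun z hz => ?_).trans Finset.card_image_le
      obtain ⟨i, j, hij, h₁, h₂⟩ := hX z hz
      obtain ⟨c, -, hc⟩ := Finset.mem_image.1 h₁
      obtain ⟨d, -, hd⟩ := Finset.mem_image.1 h₂
      obtain ⟨hc', hd', -⟩ := (blockAdj_block G _ _).1 (hadj i j hij) c d
      rw [hc] at hc'
      rw [hd] at hd'
      have e : (Fin.castLE hn ⟨z.1, hc'⟩, Fin.castLE hn ⟨z.2, hd'⟩) = z := by
        ext <;> simp
      refine Finset.mem_image.2 ⟨(⟨z.1, hc'⟩, ⟨z.2, hd'⟩), ?_, e⟩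
      simp only [Y, Finset.mem_filter, Finset.mem_univ, true_and, e, hz]
    refine lt_of_lt_of_le ?_ h₁
    rw [len_num]
    have hk : 0 < k := by
      rcases Nat.eq_zero_or_pos k with rfl | h
      · simp at hnum
      · exact h
    have h₂ := Nat.mul_lt_mul_of_pos_left hnum hk
    -- The factor is the loss in `Dense.exists_pairs`; times the 8 of the threshold it gives the
    -- 32768 of `hnum`.
    refine lt_of_mul_lt_mul_left (a := 4096 * a ^ 2) ?_ (Nat.zero_le _)
    calc 4096 * a ^ 2 * (8 * (b * (k * (4 * a * s)) + k ^ 2))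
        = k * (32768 * a ^ 2 * (4 * a * b * s + k)) := by ring
      _ < k * (k * s ^ 2) := h₂
      _ = k ^ 2 * s ^ 2 := by ring
      _ ≤ _ := hcard

/-- The parameters of a successful stage. -/
def params (P : Prog) (e ell b : ℕ) : BTree :=
  .node P.code (.node (num e) (.node (num ell) (num b)))

theorem succeeds_of {n k a s b e t : ℕ} (G : SimpleGraph (Fin n)) {H : SimpleGraph (Fin k)}
    (P : Prog) (hH : Dense a H) (ha : 1 ≤ a) (hs : 1 ≤ s) (hn : n ≤ 2 ^ b)
    (hnum : 32768 * a ^ 2 * (4 * a * b * s + k) < k * s ^ 2)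
    (he : 2 ^ e ≤ t) (hell : 4 * a * s ≤ t) (hb : b ≤ t) {ω : Coins t}
    (hparse : parse (bits₁ ω.1.1) = params P e (4 * a * s) b)
    (hcopy : HasCopy G H (fun i => block n (sampled he hell hb ω.1.2 i)) (List.finRange (2 ^ e)))
    (hunion : ¬ ∃ f : Fin k → Fin (2 ^ e), Function.Injective f ∧ (Finset.univ.biUnion fun i =>
      Finset.univ.image (sampled he hell hb ω.1.2 (f i))).card ≤ k * s)
    (hmaj : ∀ l ∈ tested (HasCopy G H fun i => block n (sampled he hell hb ω.1.2 i)) []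
      (List.finRange (2 ^ e)), (majority P.code (encode (blockGraph G
        ((fun i => block n (sampled he hell hb ω.1.2 i)) ∘ l.get))) (bits₂ ω.2) (num t) = true ↔
        H.IsContained (blockGraph G ((fun i => block n (sampled he hell hb ω.1.2 i)) ∘ l.get)))) :
    Succeeds (encode G) t ω := by
  set S : Fin (2 ^ e) → BTree := fun i => block n (sampled he hell hb ω.1.2 i) with hS
  have hS' : ∀ i, (S i).toList ≠ [] := by
    intro i
    have : (S i).toList.length = 4 * a * s := by simp [S, block]
    intro h
    rw [h, List.length_nil] at this
    have : 0 < 4 * a * s := by positivity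
    omega
  rw [Succeeds, accepts, hparse]
  simp only [params, left_node, right_node]
  rw [blocks_bits G he hell hb]
  obtain ⟨f, hf, hadj, hperm⟩ := search_hasCopy G H S P.code (bits₂ ω.2) (num t) hcopy (by
    intro l hl
    have h₁ : l.map S = List.ofFn (S ∘ l.get) := by
      rw [← List.map_ofFn, List.ofFn_get]
    rw [h₁, blockMatrix_encode G (S ∘ l.get) fun i => hS' _, hmaj l hl, hasCopy_iff]
    exact (tested_prop (by simpa using List.nodup_finRange _) hl).1)
  refine hH.certified G hs hn hnum (fun i => sampled he hell hb ω.1.2 (f i)) ?_ hadj _ hperm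
  by_contra hc
  exact hunion ⟨f, hf, by omega⟩

/-- Blocks inside disjoint parts of a clique contain a copy of every pattern. -/
theorem hasCopy_of_clique {n k N m ell : ℕ} (G : SimpleGraph (Fin n)) (H : SimpleGraph (Fin k))
    (hell : 1 ≤ ell) (K : Finset (Fin n)) (hK : G.IsClique (K : Set (Fin n)))
    (C : Fin k → Finset (Fin m)) (hC : ∀ i, ∀ x ∈ C i, ∃ h : (x : ℕ) < n, ⟨x, h⟩ ∈ K)
    (hdisj : ∀ i j, i ≠ j → Disjoint (C i) (C j)) (x : Fin N → Fin ell → Fin m)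
    (hx : ∀ i, ∃ c, ∀ j, x c j ∈ C i) :
    HasCopy G H (fun i => block n (x i)) (List.finRange N) := by
  choose f hf using hx
  refine ⟨f, fun i j hij => ?_, by simp, fun i j hij => (blockAdj_block G _ _).2 fun c d => ?_⟩
  · by_contra hne
    refine Finset.disjoint_left.1 (hdisj i j hne) (hf i ⟨0, hell⟩) ?_
    rw [hij]
    exact hf j _
  · obtain ⟨h₁, h₁'⟩ := hC i _ (hf i c)
    obtain ⟨h₂, h₂'⟩ := hC j _ (hf j d)
    refine ⟨h₁, h₂, hK h₁' h₂' fun h => ?_⟩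
    refine Finset.disjoint_left.1 (hdisj i j (H.ne_of_adj hij)) (hf i c) ?_
    rw [Fin.ext (Fin.mk.inj_iff.1 h)]
    exact hf j d

theorem exists_parts {n m k κ : ℕ} (hn : n ≤ m) (K : Finset (Fin n)) (hK : k * κ ≤ K.card) :
    ∃ C : Fin k → Finset (Fin m), (∀ i, (C i).card = κ) ∧
      (∀ i, ∀ x ∈ C i, ∃ h : (x : ℕ) < n, ⟨x, h⟩ ∈ K) ∧ ∀ i j, i ≠ j → Disjoint (C i) (C j) := by
  classical
  let φ : Fin k × Fin κ → Fin m := fun p =>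
    Fin.castLE hn (K.equivFin.symm (Fin.castLE hK (finProdFinEquiv p)))
  have hφ : Function.Injective φ :=
    (Fin.castLE_injective hn).comp (Subtype.val_injective.comp (K.equivFin.symm.injective.comp
      ((Fin.castLE_injective hK).comp finProdFinEquiv.injective)))
  refine ⟨fun i => Finset.univ.image fun c => φ (i, c), fun i => ?_, fun i x hx => ?_,
    fun i j hij => ?_⟩
  · rw [Finset.card_image_of_injective _ fun c d h => (Prod.ext_iff.1 (hφ h)).2]
    simp
  · obtain ⟨c, -, rfl⟩ := Finset.mem_image.1 hx
    exact ⟨(K.equivFin.symm _).1.2, (K.equivFin.symm (Fin.castLE hK (finProdFinEquiv (i, c)))).2⟩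
  · refine Finset.disjoint_left.2 fun x hx hx' => ?_
    obtain ⟨c, -, rfl⟩ := Finset.mem_image.1 hx
    obtain ⟨d, -, h⟩ := Finset.mem_image.1 hx'
    exact hij (Prod.ext_iff.1 (hφ h)).1.symm

theorem le_pr_of_not_le {Ω : Type*} [Fintype Ω] [Nonempty Ω] {p : Ω → Prop} {a : ℝ}
    (h : pr (fun ω => ¬ p ω) ≤ a) : 1 - a ≤ pr p := by
  rw [pr_not] at h
  linarith

/-- Here `c = 4 * a - 2` and `m ^ (c * s)` is the number of blocks: the left side is the expected
number of blocks inside a set of `κ` vertices. -/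
theorem mul_div_pow_eq {a c s : ℕ} (hc : 4 * a = c + 2) {m : ℝ} (hm : m ≠ 0) (κ : ℝ) :
    m ^ (c * s) * (κ / m) ^ (4 * a * s) = (κ ^ (2 * a) / m) ^ (2 * s) := by
  rw [div_pow, div_pow, ← pow_mul, show 2 * a * (2 * s) = 4 * a * s by ring, hc,
    show (c + 2) * s = c * s + 2 * s by ring, pow_add m]
  field_simp

/-- The bound of `pr_small_union` for the same number of blocks. The choice of `c` leaves a positive
power of `m` in the denominator both here and for the blocks inside a clique only if `κ ^ (2 * a)`
outweighs `m`, which a clique of the assumed size provides. -/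
theorem pow_mul_pow_mul_div_pow_eq {a c s k : ℕ} (hc : 4 * a = c + 2) {m : ℝ} (hm : m ≠ 0)
    (u : ℝ) : (m ^ (c * s)) ^ k * m ^ (k * s) * (u / m) ^ (4 * a * s * k) =
      (u ^ (4 * a) / m) ^ (k * s) := by
  rw [div_pow, div_pow, ← pow_mul, ← pow_mul, show 4 * a * s * k = 4 * a * (k * s) by ring, hc,
    show (c + 2) * (k * s) = c * s * k + k * s + k * s by ring, pow_add m, pow_add m]
  field_simp

/-- With good probability, random blocks contain a copy of every pattern in the graph of blocks, and
no few of them have a small union. -/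
theorem pr_blocks_good {n k a s b κ : ℕ} (G : SimpleGraph (Fin n)) (H : SimpleGraph (Fin k))
    (ha : 1 ≤ a) (hs : 1 ≤ s) (hk : 1 ≤ k) (hn : n ≤ 2 ^ b) (K : Finset (Fin n))
    (hK : G.IsClique (K : Set (Fin n))) (hκ : k * κ ≤ K.card) (hκ' : 8 * k * 2 ^ b ≤ κ ^ (2 * a))
    (hu : 8 * (k * s) ^ (4 * a) ≤ 2 ^ b) :
    3 / 4 ≤ pr fun x : Fin (2 ^ (b * ((4 * a - 2) * s))) → Fin (4 * a * s) → Fin (2 ^ b) =>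
      HasCopy G H (fun i => block n (x i)) (List.finRange _) ∧
      ¬ ∃ f : Fin k → Fin (2 ^ (b * ((4 * a - 2) * s))), Function.Injective f ∧
        (Finset.univ.biUnion fun i => Finset.univ.image (x (f i))).card ≤ k * s := by
  classical
  obtain ⟨c, hc⟩ : ∃ c, 4 * a = c + 2 := ⟨4 * a - 2, by omega⟩
  have hc' : 4 * a - 2 = c := by omega
  rw [hc']
  set N := 2 ^ (b * (c * s)) with hN
  set m := 2 ^ b with hm
  have hm₀ : (0 : ℝ) < m := by rw [hm]; positivity
  have hNm : N = m ^ (c * s) := by rw [hN, hm, pow_mul]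
  obtain ⟨C, hC₁, hC₂, hC₃⟩ := exists_parts hn K hκ
  have hell : 1 ≤ 4 * a * s := Nat.mul_pos (by omega) hs
  have h₁ : ∀ i, pr (fun x : Fin N → Fin (4 * a * s) → Fin m => ¬ ∃ c, ∀ j, x c j ∈ C i) ≤
      1 / (8 * k) := by
    intro i
    have e₁ := pr_no_block (N := N) (ell := 4 * a * s) (C i)
    rw [hC₁] at e₁
    have e₂ : (8 * k : ℝ) ≤ N * ((κ : ℝ) / m) ^ (4 * a * s) := by
      have e₃ : (N : ℝ) * ((κ : ℝ) / m) ^ (4 * a * s) = ((κ : ℝ) ^ (2 * a) / m) ^ (2 * s) := by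
        rw [hNm, Nat.cast_pow, mul_div_pow_eq hc hm₀.ne']
      rw [e₃]
      have e₄ : (8 * k : ℝ) ≤ (κ : ℝ) ^ (2 * a) / m := by
        rw [le_div_iff₀ hm₀]
        exact_mod_cast hκ'
      have e₅ : (1 : ℝ) ≤ 8 * k := by
        have : (1 : ℝ) ≤ k := by exact_mod_cast hk
        linarith
      exact e₄.trans (le_self_pow₀ (e₅.trans e₄) (by omega))
    have e₃ : (0 : ℝ) < 8 * k := by positivity
    rw [le_div_iff₀ e₃]
    refine le_trans ?_ e₁
    gcongr
    · exact pr_nonneg _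
    · linarith
  have h₂ : pr (fun x : Fin N → Fin (4 * a * s) → Fin m => ∃ f : Fin k → Fin N,
      Function.Injective f ∧
        (Finset.univ.biUnion fun i => Finset.univ.image (x (f i))).card ≤ k * s) ≤ 1 / 8 := by
    refine (pr_small_union (Nat.mul_pos hk hs)).trans ?_
    have e₁ : (N : ℝ) ^ k * m ^ (k * s) * (((k * s : ℕ) : ℝ) / m) ^ (4 * a * s * k) =
        (((k * s : ℕ) : ℝ) ^ (4 * a) / m) ^ (k * s) := by
      rw [hNm, Nat.cast_pow, pow_mul_pow_mul_div_pow_eq hc hm₀.ne']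
    rw [e₁]
    have e₂ : ((k * s : ℕ) : ℝ) ^ (4 * a) / m ≤ 1 / 8 := by
      rw [div_le_div_iff₀ hm₀ (by norm_num), one_mul, mul_comm]
      exact_mod_cast hu
    calc (((k * s : ℕ) : ℝ) ^ (4 * a) / m) ^ (k * s) ≤ (1 / 8) ^ (k * s) := by gcongr
      _ ≤ 1 / 8 := pow_le_of_le_one (by norm_num) (by norm_num) (Nat.mul_pos hk hs).ne'
  have h₃ : pr (fun x : Fin N → Fin (4 * a * s) → Fin m => ¬
      (HasCopy G H (fun i => block n (x i)) (List.finRange N) ∧ ¬ ∃ f : Fin k → Fin N,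
      Function.Injective f ∧
        (Finset.univ.biUnion fun i => Finset.univ.image (x (f i))).card ≤ k * s)) ≤ 1 / 4 := by
    refine le_trans (pr_mono (q := fun x => (∃ i ∈ (Finset.univ : Finset (Fin k)),
      ¬ ∃ c, ∀ j, x c j ∈ C i) ∨ ∃ f : Fin k → Fin N, Function.Injective f ∧
        (Finset.univ.biUnion fun i => Finset.univ.image (x (f i))).card ≤ k * s) ?_) ?_
    · intro x hx
      by_contra hc
      rw [not_or] at hc
      refine hx ⟨hasCopy_of_clique G H hell K hK C hC₂ hC₃ x fun i => ?_, hc.2⟩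
      by_contra hi
      exact hc.1 ⟨i, Finset.mem_univ _, hi⟩
    · refine (pr_or_le _ _).trans ?_
      have e₁ := (pr_exists_le (Finset.univ : Finset (Fin k)) fun i
        (x : Fin N → Fin (4 * a * s) → Fin m) => ¬ ∃ c, ∀ j, x c j ∈ C i).trans
        (Finset.sum_le_sum fun i _ => h₁ i)
      have e₂ : ∑ _i : Fin k, 1 / (8 * (k : ℝ)) = 1 / 8 := by
        have : (0 : ℝ) < k := by exact_mod_cast hk
        simp only [Finset.sum_const, Finset.card_univ, Fintype.card_fin, nsmul_eq_mul]
        field_simp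
      rw [e₂] at e₁
      linarith
  have := le_pr_of_not_le h₃
  linarith

open Classical in
/-- The success probability of a stage. -/
theorem pr_succeeds_ge {n k a s b κ t : ℕ} (G : SimpleGraph (Fin n)) {H : SimpleGraph (Fin k)}
    (P : Prog) (hH : Dense a H) (ha : 1 ≤ a) (hs : 1 ≤ s) (hk : 2 ≤ k) (hn : n ≤ 2 ^ b)
    (hnum : 32768 * a ^ 2 * (4 * a * b * s + k) < k * s ^ 2)
    (K : Finset (Fin n)) (hK : G.IsClique (K : Set (Fin n))) (hκ : k * κ ≤ K.card)
    (hκ' : 8 * k * 2 ^ b ≤ κ ^ (2 * a)) (hu : 8 * (k * s) ^ (4 * a) ≤ 2 ^ b)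
    (hP : ∀ m, 1 ≤ m → m ≤ 2 ^ (b * ((4 * a - 2) * s)) → ∀ Γ : SimpleGraph (Fin m), ∃ T, T ≤ t ∧
      P.cost * T ≤ t ∧ 2 / 3 ≤ output P T (encode Γ) (some (decide (H.IsContained Γ))))
    (he : 72 * 2 ^ (b * ((4 * a - 2) * s)) ≤ t) (hell : 4 * a * s ≤ t) (hb : b ≤ t)
    (hsize : (params P (b * ((4 * a - 2) * s)) (4 * a * s) b).size ≤ t) :
    (1 / 2) ^ (params P (b * ((4 * a - 2) * s)) (4 * a * s) b).size * (1 / 2) ≤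
      pr (Succeeds (encode G) t) := by
  have h₁ := pr_blocks_good G H ha hs (by omega) hn K hK hκ hκ' hu
  set e := b * ((4 * a - 2) * s)
  have he' : 2 ^ e ≤ t := by omega
  rw [← (unif_sampled he' hell hb).pr_eq] at h₁
  have h₂ := pr_parse (params P e (4 * a * s) b) hsize
  let S : (Fin t → Fin t → Fin t → Bool) → Fin (2 ^ e) → BTree :=
    fun r i => block n (sampled he' hell hb r i)
  let good : (Fin t → Fin t → Fin t → Bool) → Prop := fun r =>
    HasCopy G H (S r) (List.finRange (2 ^ e)) ∧ ¬ ∃ f : Fin k → Fin (2 ^ e),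
      Function.Injective f ∧ (Finset.univ.biUnion fun i =>
        Finset.univ.image (sampled he' hell hb r (f i))).card ≤ k * s
  let right : (Fin t → Fin t → Fin t → Bool) → List (Fin (2 ^ e)) → (Fin t → Fin t → Bool) →
      Prop := fun r l ω => (majority P.code (encode (blockGraph G (S r ∘ l.get))) (bits₂ ω) (num t) =
        true ↔ H.IsContained (blockGraph G (S r ∘ l.get)))
  have h₃ : ∀ r, good r → 3 / 4 ≤ pr fun ω : Fin t → Fin t → Bool =>
      ∀ l ∈ tested (HasCopy G H (S r)) [] (List.finRange (2 ^ e)), right r l ω := by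
    intro r hr
    have e₁ : pr (fun ω : Fin t → Fin t → Bool => ¬ ∀ l ∈ tested (HasCopy G H (S r)) []
        (List.finRange (2 ^ e)), right r l ω) ≤ 1 / 4 := by
      refine le_trans (pr_mono (q := fun ω => ∃ l ∈ (tested (HasCopy G H (S r)) []
        (List.finRange (2 ^ e))).toFinset, ¬ right r l ω) fun ω hω => ?_) ?_
      · push Not at hω
        obtain ⟨l, hl, h⟩ := hω
        exact ⟨l, by simpa using hl, h⟩
      · refine (pr_exists_le _ _).trans ((Finset.sum_le_sum (g := fun _ => (17 / 18 : ℝ) ^ t)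
          fun l hl => ?_).trans ?_)
        · rw [List.mem_toFinset] at hl
          have hl₁ := (tested_prop (by simpa using List.nodup_finRange _) hl).2
          -- A copy uses `k ≥ 2` blocks, so removing one element never empties the list.
          have hl₂ : l ≠ [] := by
            refine prop_of_mem_tested (p := HasCopy G H (S r)) (fun _ _ h h' => h.mono h')
              (fun l => l ≠ []) ?_ (K := []) hr.1 hl
            rintro l i ⟨f, hf, hfl, -⟩ rfl
            have := hf (a₁ := ⟨0, by omega⟩) (a₂ := ⟨1, by omega⟩)
              ((List.mem_singleton.1 (hfl _)).trans (List.mem_singleton.1 (hfl _)).symm)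
            simp at this
          obtain ⟨T, hT, hcost, hout⟩ := hP l.length (List.length_pos_iff.2 hl₂)
            (by simpa using hl₁.le) (blockGraph G (S r ∘ l.get))
          exact pr_majority_ne P H _ hout hT hcost
        · rw [Finset.sum_const, nsmul_eq_mul]
          have e₂ : ((tested (HasCopy G H (S r)) [] (List.finRange (2 ^ e))).toFinset.card : ℝ) ≤
              2 ^ e := by
            have := List.toFinset_card_le (tested (HasCopy G H (S r)) [] (List.finRange (2 ^ e)))
            rw [length_tested, List.length_finRange] at this
            exact_mod_cast this
          -- There are at most `2 ^ e ≤ t / 72` votes, each wrong with probability at most `(17 /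
          -- 18) ^ t ≤ 1 / (1 + t / 18)`; in total this is at most `1 / 4`.
          have e₃ := one_sub_pow_mul_le (q := 1 / 18) (by norm_num) (by norm_num) t
          have e₄ : (72 * 2 ^ e : ℝ) ≤ t := by exact_mod_cast he
          have e₅ : (0 : ℝ) ≤ (17 / 18) ^ t := by positivity
          rw [show (1 - 1 / 18 : ℝ) = 17 / 18 by norm_num] at e₃
          have e₆ : ((tested (HasCopy G H (S r)) [] (List.finRange (2 ^ e))).toFinset.card : ℝ) *
              (17 / 18) ^ t ≤ t / 72 * (17 / 18) ^ t := by
            gcongr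
            linarith
          linarith
    have := le_pr_of_not_le e₁
    linarith
  -- The three sources of bits are independent, and `3 / 4 * (3 / 4) ≥ 1 / 2`.
  have h₄ := pr_prod (fun r₁ : Fin t → Bool => parse (bits₁ r₁) = params P e (4 * a * s) b)
    (fun _ r => good r) fun _ _ => h₁
  have h₅ := pr_prod (fun ω : (Fin t → Bool) × (Fin t → Fin t → Fin t → Bool) =>
    parse (bits₁ ω.1) = params P e (4 * a * s) b ∧ good ω.2)
    (fun ω ω' => ∀ l ∈ tested (HasCopy G H (S ω.2)) [] (List.finRange (2 ^ e)), right ω.2 l ω')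
    fun ω hω => h₃ ω.2 hω.2
  have h₆ : pr (fun ω : Coins t => (parse (bits₁ ω.1.1) = params P e (4 * a * s) b ∧ good ω.1.2) ∧
      ∀ l ∈ tested (HasCopy G H (S ω.1.2)) [] (List.finRange (2 ^ e)), right ω.1.2 l ω.2) ≤
      pr (Succeeds (encode G) t) :=
    pr_mono fun ω hω => succeeds_of G P hH ha hs hn hnum he' hell hb hω.1.1 hω.1.2.1 hω.1.2.2 hω.2
  have h₇ := h₅.trans h₆
  have h₈ : (0 : ℝ) ≤ (1 / 2) ^ (params P e (4 * a * s) b).size := by positivity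
  linarith

/-! ### Random patterns are dense -/

open Classical in
-- Markov's inequality for a product with weight `(4 / 5) ^ 3` for each edge and `5 / 4` for each
-- non-edge inside `W`: it is at least 1 when there are three times as many non-edges as edges, and
-- each mean is `0.881 ≤ 9 / 10`. Counting ordered pairs overestimates the number of edges, which is
-- harmless here.
theorem pr_sparse_le {V : Type*} [Fintype V] [DecidableEq V] (W : Finset V) :
    pr (fun H : SimpleGraph V =>
      4 * ((W ×ˢ W).filter fun x => H.Adj x.1 x.2).card ≤ W.card.choose 2) ≤
      (9 / 10) ^ W.card.choose 2 := by
  let E : Finset {e : Sym2 V // ¬ e.IsDiag} :=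
    Finset.univ.filter fun e => e.1 ∈ W.offDiag.image Sym2.mk.uncurry
  have hE : E.card = W.card.choose 2 := by
    rw [← Sym2.card_image_offDiag, ← Finset.card_image_of_injective E Subtype.val_injective]
    congr 1
    ext e
    simp only [E, Finset.mem_image, Finset.mem_filter, Finset.mem_univ, true_and, Subtype.exists,
      exists_and_right, exists_eq_right]
    refine ⟨fun ⟨_, h⟩ => h, fun h => ⟨?_, h⟩⟩
    obtain ⟨x, hx, rfl⟩ := h
    have := (Finset.mem_offDiag.1 hx).2.2
    obtain ⟨u, v⟩ := x
    simpa using this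
  let g : {e : Sym2 V // ¬ e.IsDiag} → Bool → ℝ := fun e b =>
    if e ∈ E then (if b then (4 / 5) ^ 3 else 5 / 4) else 1
  have key := pr_le_prod_ge g (fun e b => by simp only [g]; split_ifs <;> norm_num) (a := 1) one_pos
  rw [← pr_equiv (graphEquiv V)] at key
  refine le_trans (pr_mono fun H hH => ?_) (key.trans ?_)
  · simp only [g]
    rw [Finset.prod_ite, Finset.prod_const_one, mul_one, Finset.filter_mem_eq_inter,
      Finset.univ_inter, Finset.prod_ite, Finset.prod_const, Finset.prod_const]
    set X := (E.filter fun e => graphEquiv V H e = true).card with hX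
    have h₁ := Finset.card_filter_add_card_filter_not (s := E) fun e => graphEquiv V H e = true
    have h₂ : X ≤ ((W ×ˢ W).filter fun x => H.Adj x.1 x.2).card := by
      rw [hX, ← Finset.card_image_of_injective _ Subtype.val_injective]
      refine (Finset.card_le_card (t := ((W ×ˢ W).filter fun x => H.Adj x.1 x.2).image Sym2.mk.uncurry)
        fun e he => ?_).trans Finset.card_image_le
      obtain ⟨e', he', rfl⟩ := Finset.mem_image.1 he
      obtain ⟨h₃, h₄⟩ := Finset.mem_filter.1 he'
      obtain ⟨x, hx, hxe⟩ := Finset.mem_image.1 (Finset.mem_filter.1 h₃).2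
      rw [graphEquiv_apply, ← hxe] at h₄
      have hx' := Finset.mem_offDiag.1 hx
      refine Finset.mem_image.2 ⟨x, Finset.mem_filter.2 ⟨Finset.mem_product.2 ⟨hx'.1, hx'.2.1⟩,
        ?_⟩, hxe⟩
      exact h₄
    have h₃ : 3 * X ≤ (E.filter fun e => ¬ graphEquiv V H e = true).card := by omega
    rw [← pow_mul]
    calc (1 : ℝ) = (4 / 5) ^ (3 * X) * (5 / 4) ^ (3 * X) := by
          rw [← mul_pow]; norm_num
      _ ≤ _ := by
          gcongr
          norm_num
  · have h₁ : ∀ e, (∑ x, g e x) / (Fintype.card Bool : ℝ) ≤ if e ∈ E then 9 / 10 else 1 := by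
      intro e
      simp only [g, Fintype.sum_bool, Fintype.card_bool]
      split_ifs <;> norm_num
    rw [div_one, ← hE]
    refine (Finset.prod_le_prod (fun e _ => ?_) fun e _ => h₁ e).trans_eq ?_
    · refine div_nonneg (Finset.sum_nonneg fun b _ => ?_) (by positivity)
      simp only [g]
      split_ifs <;> norm_num
    · rw [Finset.prod_ite, Finset.prod_const_one, mul_one, Finset.filter_mem_eq_inter,
        Finset.univ_inter, Finset.prod_const]

/-- For the sets `W` in question, `W.card.choose 2 ≥ k ^ 2 / (256 * a ^ 2) ≥ 14 * k`, as `3584 = 256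
* 14`. Since `(9 / 10) ^ 14 ≤ 1 / 4`, this beats the number `2 ^ k` of sets. -/
theorem pr_not_dense_le {a k : ℕ} (ha : 1 ≤ a) (hk : 3584 * a ^ 2 ≤ k) :
    pr (fun H : SimpleGraph (Fin k) => ¬ Dense a H) ≤ (1 / 2) ^ k := by
  classical
  have key : ∀ W : Finset (Fin k), k ≤ 8 * a * W.card →
      14 * k ≤ W.card.choose 2 ∧ W.card ^ 2 ≤ 4 * W.card.choose 2 := by
    intro W hW
    have h₁ : 2 ≤ W.card := by
      by_contra hc
      have : 8 * a * W.card ≤ 8 * a * 1 := by gcongr; omega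
      nlinarith
    obtain ⟨w, hw⟩ : ∃ w, W.card = w + 1 := ⟨W.card - 1, by omega⟩
    have h₂ : 2 * W.card.choose 2 = W.card * (W.card - 1) := by
      rw [Nat.choose_two_right, Nat.mul_div_cancel' (Nat.even_mul_pred_self _).two_dvd]
    rw [hw, Nat.add_sub_cancel] at h₂
    rw [hw] at h₁ hW ⊢
    have h₃ : (w + 1) ^ 2 ≤ 4 * (w + 1).choose 2 := by nlinarith
    refine ⟨?_, h₃⟩
    have h₄ : k * k ≤ 256 * a ^ 2 * (w + 1).choose 2 := by
      nlinarith [Nat.mul_le_mul hW hW]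
    have h₅ : 256 * a ^ 2 * (14 * k) ≤ 256 * a ^ 2 * (w + 1).choose 2 := by nlinarith
    exact Nat.le_of_mul_le_mul_left h₅ (by positivity)
  refine le_trans (pr_mono (q := fun H => ∃ W ∈ Finset.univ.filter fun W : Finset (Fin k) =>
    k ≤ 8 * a * W.card, 4 * ((W ×ˢ W).filter fun x => H.Adj x.1 x.2).card ≤ W.card.choose 2) ?_) ?_
  · intro H hH
    simp only [Dense, not_forall] at hH
    obtain ⟨W, hW, hF⟩ := hH
    refine ⟨W, by simpa using hW, ?_⟩
    by_contra hc
    refine hF ⟨(W ×ˢ W).filter fun x => H.Adj x.1 x.2, fun x hx => ?_, ?_⟩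
    · simpa [and_assoc] using hx
    · have := (key W hW).2
      omega
  · refine (pr_exists_le _ _).trans ((Finset.sum_le_sum (g := fun _ => (1 / 4 : ℝ) ^ k)
      fun W hW => ?_).trans ?_)
    · refine (pr_sparse_le W).trans ?_
      calc ((9 / 10 : ℝ)) ^ W.card.choose 2 ≤ (9 / 10) ^ (14 * k) :=
            pow_le_pow_of_le_one (by norm_num) (by norm_num)
              (key W (Finset.mem_filter.1 hW).2).1
        _ = ((9 / 10) ^ 14) ^ k := pow_mul _ _ _
        _ ≤ (1 / 4) ^ k := by gcongr; norm_num
    · rw [Finset.sum_const, nsmul_eq_mul]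
      calc _ ≤ (2 : ℝ) ^ k * (1 / 4) ^ k := by
            gcongr
            have := Finset.card_filter_le (Finset.univ : Finset (Finset (Fin k)))
              fun W => k ≤ 8 * a * W.card
            rw [Finset.card_univ, Fintype.card_finset, Fintype.card_fin] at this
            exact_mod_cast this
        _ = (1 / 2) ^ k := by rw [← mul_pow]; norm_num

/-! ### Running time -/

theorem size_encode_le {n : ℕ} (G : SimpleGraph (Fin n)) : (encode G).size ≤ 8 * n ^ 2 + 1 := by
  have h : ∀ l : List BTree, ∀ M, (∀ x ∈ l, x.size ≤ M) →
      (ofList l).size ≤ l.length * (M + 1) + 1 := by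
    intro l M hl
    rw [size_ofList]
    have := List.sum_le_card_nsmul (l.map fun a => a.size + 1) (M + 1) (by
      intro x hx
      obtain ⟨y, hy, rfl⟩ := List.mem_map.1 hx
      exact Nat.succ_le_succ (hl y hy))
    simp only [List.length_map, smul_eq_mul] at this
    omega
  classical
  have h₁ := h (encode G).toList (n * 4 + 1) (by
    intro x hx
    rw [toList_encode, List.mem_ofFn] at hx
    obtain ⟨i, rfl⟩ := hx
    refine (h _ 3 ?_).trans (by simp)
    intro y hy
    obtain ⟨j, rfl⟩ := List.mem_ofFn.1 hy
    exact size_ofBool_le _)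
  rw [ofList_toList, show (encode G).toList.length = n from len_encode G] at h₁
  refine h₁.trans ?_
  rcases Nat.eq_zero_or_pos n with rfl | hn
  · simp
  · nlinarith

theorem size_params (P : Prog) (e ell b : ℕ) :
    (params P e ell b).size = P.code.size + 6 + 2 * e + 2 * ell + 2 * b := by
  simp only [params, size_node, size_num]
  omega

/-- The number of stages after which the search for a certificate is efficient. -/
noncomputable def startStage (P : Prog) (φ γ e ell b : ℕ) : ℕ :=
  72 * 2 ^ e + ell + b + (params P e ell b).size + (P.cost + 1) * (φ * 2 ^ (e * γ))

/-- `M` does not depend on the block parameters, hence not on `n`. In the exponent, 6 comes from `2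
* e + 2 * ell + 2 * b` in the size of the description, and `γ` from running the detector on up to `2
^ e` vertices. -/
theorem total_le (P : Prog) (φ γ : ℕ) : ∃ M : ℕ, 1 ≤ M ∧ ∀ e ell b Z, e ≤ Z → ell ≤ Z → b ≤ Z →
    8 * (2 ^ b) ^ 2 + 1 + startStage P φ γ e ell b + 4 * 2 ^ (params P e ell b).size + 2 ≤
      M * 2 ^ ((6 + γ) * Z) := by
  refine ⟨85 + 5 * 2 ^ (P.code.size + 6) + (P.cost + 1) * φ, by omega, ?_⟩
  intro e ell b Z he hell hb
  have hpow : ∀ i j : ℕ, i ≤ j → 2 ^ i ≤ 2 ^ j := fun i j h => Nat.pow_le_pow_right (by norm_num) h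
  set Y := 2 ^ ((6 + γ) * Z) with hY
  have hZ : Z ≤ (6 + γ) * Z := Nat.le_mul_of_pos_left _ (by omega)
  have h6 : 6 * Z ≤ (6 + γ) * Z := Nat.mul_le_mul_right _ (by omega)
  have h₀ : 1 ≤ Y := Nat.one_le_two_pow
  have h₁ : (2 ^ b) ^ 2 ≤ Y := by
    rw [← pow_mul]
    exact hpow _ _ (by omega)
  have h₂ : 2 ^ e ≤ Y := hpow _ _ (by omega)
  have h₃ : Z ≤ Y := Nat.lt_two_pow_self.le.trans (hpow _ _ hZ)
  have h₄ : 2 ^ (params P e ell b).size ≤ 2 ^ (P.code.size + 6) * Y := by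
    rw [size_params, ← pow_add]
    exact hpow _ _ (by omega)
  have h₅ : (params P e ell b).size ≤ 2 ^ (P.code.size + 6) * Y := Nat.lt_two_pow_self.le.trans h₄
  have h₆ : (P.cost + 1) * (φ * 2 ^ (e * γ)) ≤ (P.cost + 1) * φ * Y := by
    rw [mul_assoc]
    gcongr
    refine hpow _ _ ?_
    calc e * γ ≤ Z * γ := by gcongr
      _ ≤ (6 + γ) * Z := by nlinarith
  rw [startStage]
  nlinarith

/-- Both `f` and `g` may be negative, hence the absolute values. -/
theorem floor_time_le (f g : ℝ) {m e : ℕ} (hm : 1 ≤ m) (hme : m ≤ 2 ^ e) :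
    ⌊f * (m : ℝ) ^ g⌋₊ ≤ ⌈|f|⌉₊ * 2 ^ (e * ⌈|g|⌉₊) := by
  refine Nat.floor_le_of_le ?_
  have hm' : (1 : ℝ) ≤ m := by exact_mod_cast hm
  have h₁ : (m : ℝ) ^ g ≤ 2 ^ (e * ⌈|g|⌉₊) := by
    calc (m : ℝ) ^ g ≤ (m : ℝ) ^ ((⌈|g|⌉₊ : ℕ) : ℝ) :=
          Real.rpow_le_rpow_of_exponent_le hm' ((le_abs_self g).trans (Nat.le_ceil _))
      _ = (m : ℝ) ^ ⌈|g|⌉₊ := Real.rpow_natCast _ _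
      _ ≤ (2 ^ e) ^ ⌈|g|⌉₊ := by
          gcongr
          exact_mod_cast hme
      _ = _ := (pow_mul _ _ _).symm
  have h₂ : (0 : ℝ) ≤ (m : ℝ) ^ g := by positivity
  push_cast
  calc f * (m : ℝ) ^ g ≤ |f| * (m : ℝ) ^ g := by gcongr; exact le_abs_self f
    _ ≤ ⌈|f|⌉₊ * 2 ^ (e * ⌈|g|⌉₊) := by
        gcongr
        exact Nat.le_ceil _

/-- The size of the blocks, up to a constant factor. -/
def blockSize (a k b : ℕ) : ℕ := 262144 * a ^ 3 * (b / k + 1)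

/-- Each of the two terms on the left takes less than or at most half of the right side: `262144 = 2
* 4 * 32768` serves the term with `b`, and the other follows from `65536 * a ^ 2 < s ^ 2`, with `s`
the block size. -/
theorem blockSize_spec {a k b : ℕ} (ha : 1 ≤ a) (hk : 1 ≤ k) :
    32768 * a ^ 2 * (4 * a * b * blockSize a k b + k) < k * blockSize a k b ^ 2 := by
  set s := blockSize a k b with hs
  have h₁ : 262144 * a ^ 3 * b ≤ k * s := by
    have := (Nat.lt_mul_div_succ b (show 0 < k by omega)).le
    calc 262144 * a ^ 3 * b ≤ 262144 * a ^ 3 * (k * (b / k + 1)) := by gcongr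
      _ = k * s := by rw [hs, blockSize]; ring
  have h₂ : 262144 * a ^ 3 ≤ s := Nat.le_mul_of_pos_right _ (Nat.succ_pos _)
  have h₃ : 262144 * a ^ 3 * b * s ≤ k * s * s := Nat.mul_le_mul_right _ h₁
  have h₄ : 65536 * a ^ 2 < s * s := by
    have e₁ : 1 ≤ a ^ 3 := Nat.one_le_pow _ _ ha
    have e₂ : a ^ 2 ≤ a ^ 3 := Nat.pow_le_pow_right ha (by norm_num)
    nlinarith
  have h₅ : k * (65536 * a ^ 2) < k * (s * s) := Nat.mul_lt_mul_of_pos_left h₄ (by omega)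
  nlinarith

/-- For fixed `a` and `k`, the product `k * blockSize a k b` is `O(b)`, and a power of it loses
against `2 ^ b`. -/
theorem eventually_le_two_pow (a k : ℕ) :
    ∀ᶠ b : ℕ in atTop, 8 * (k * blockSize a k b) ^ (4 * a) ≤ 2 ^ b := by
  have h₁ := tendsto_pow_const_div_const_pow_of_one_lt (4 * a) (r := 2) (by norm_num)
  set D : ℝ := 8 * (524288 * (a : ℝ) ^ 3) ^ (4 * a) with hD
  have h₂ : ∀ᶠ b : ℕ in atTop, (b : ℝ) ^ (4 * a) / 2 ^ b < 1 / (D + 1) :=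
    h₁.eventually (gt_mem_nhds (by positivity))
  filter_upwards [h₂, eventually_ge_atTop k] with b hb hkb
  have h₃ : k * blockSize a k b ≤ 524288 * a ^ 3 * b := by
    have : k * (b / k) ≤ b := Nat.mul_div_le b k
    calc k * blockSize a k b = 262144 * a ^ 3 * (k * (b / k) + k) := by rw [blockSize]; ring
      _ ≤ 262144 * a ^ 3 * (b + b) := by gcongr
      _ = _ := by ring
  have h₄ : 8 * (k * blockSize a k b) ^ (4 * a) ≤ 8 * (524288 * a ^ 3 * b) ^ (4 * a) := by
    gcongr
  refine h₄.trans ?_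
  rw [div_lt_div_iff₀ (by positivity) (by positivity), one_mul] at hb
  have h₅ : ((8 * (524288 * a ^ 3 * b) ^ (4 * a) : ℕ) : ℝ) ≤ ((2 ^ b : ℕ) : ℝ) := by
    push_cast
    rw [mul_pow, ← mul_assoc, ← hD]
    have : (0 : ℝ) ≤ (b : ℝ) ^ (4 * a) := by positivity
    linarith
  exact_mod_cast h₅

/-- One of `k` parts of the clique is smaller by a factor of at most `2 * k`. As `κ ^ (2 * a) ≥ n ^
2` while only a multiple of `n` is needed, large `n` absorbs the loss. -/
theorem clique_part_large {a k n b κ : ℕ} (hk : 1 ≤ k) (hn : n ≤ κ ^ a) (hb : 2 ^ b ≤ 2 * n)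
    (h₁ : k ^ a < n) (h₂ : 16 * k * (2 * k) ^ (2 * a) ≤ n) :
    8 * k * 2 ^ b ≤ (κ / k) ^ (2 * a) := by
  have h₃ : k ≤ κ := by
    by_contra hc
    have : κ ^ a ≤ k ^ a := Nat.pow_le_pow_left (by omega) a
    omega
  have h₄ : κ ≤ 2 * k * (κ / k) := by
    have e₁ := Nat.lt_mul_div_succ κ (show 0 < k by omega)
    have e₂ : 1 ≤ κ / k := (Nat.one_le_div_iff (by omega)).2 h₃
    nlinarith
  have h₅ : n * n ≤ (2 * k) ^ (2 * a) * (κ / k) ^ (2 * a) := by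
    calc n * n ≤ κ ^ a * κ ^ a := Nat.mul_le_mul hn hn
      _ = κ ^ (2 * a) := by ring
      _ ≤ (2 * k * (κ / k)) ^ (2 * a) := Nat.pow_le_pow_left h₄ _
      _ = _ := mul_pow _ _ _
  have h₆ : 0 < (2 * k) ^ (2 * a) := by positivity
  refine Nat.le_of_mul_le_mul_left (le_trans ?_ h₅) h₆
  calc (2 * k) ^ (2 * a) * (8 * k * 2 ^ b) ≤ (2 * k) ^ (2 * a) * (8 * k * (2 * n)) := by gcongr
    _ = 16 * k * (2 * k) ^ (2 * a) * n := by ring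
    _ ≤ n * n := by gcongr

/-- Within `τ` steps, `A` accepts with probability at least `2 / 3` every graph on `n` vertices that
contains a clique of size at least `n ^ (1 / a)`. -/
def DetectsCliques (A : Prog) (a n τ : ℕ) : Prop :=
  ∀ (G : SimpleGraph (Fin n)) (K : Finset (Fin n)), G.IsClique (K : Set (Fin n)) →
    n ≤ K.card ^ a → 2 / 3 ≤ win τ ([A], encode G)

theorem eventually_quadratic_le {A B D ε : ℝ} (h : A < ε) :
    ∀ᶠ x : ℝ in atTop, A * x ^ 2 + B * x + D ≤ ε * x ^ 2 := by
  filter_upwards [eventually_ge_atTop 1, eventually_ge_atTop ((|B| + |D|) / (ε - A))] with x h₁ h₂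
  rw [div_le_iff₀ (by linarith)] at h₂
  have h₃ : |D| ≤ |D| * x := le_mul_of_one_le_right (abs_nonneg _) h₁
  have h₄ : B * x ≤ |B| * x := by gcongr; exact le_abs_self B
  have h₅ := le_abs_self D
  nlinarith

/-- With `x = log n`, the exponent `4 * a * blockSize a k b * b` is `O(b ^ 2 / k + b)` and `b =
O(x)`. What matters is that the coefficient of `x ^ 2` decays like `1 / k`. -/
theorem log_total_le {a k b d γ M : ℕ} (hk : 1 ≤ k) (hM : 1 ≤ M) {x : ℝ} (hx : 2 ≤ x)
    (hb : (b : ℝ) ≤ 2 * x) {τ : ℕ}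
    (hτ : τ ≤ (M * 2 ^ ((6 + γ) * (4 * a * blockSize a k b * b))) ^ d) :
    Real.log (τ + 1) ≤ (16777216 * a ^ 4 * d * (6 + γ) / k) * x ^ 2 +
      (16777216 * a ^ 4 * d * (6 + γ)) * x + (1 + d * Real.log M) := by
  set Z := 4 * a * blockSize a k b * b with hZ
  have hk' : (0 : ℝ) < k := by exact_mod_cast hk
  have hM' : (1 : ℝ) ≤ M := by exact_mod_cast hM
  have h₁ : ((τ : ℝ) + 1) ≤ 2 * ((M : ℝ) * 2 ^ ((6 + γ) * Z)) ^ d := by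
    have e₁ : (τ : ℝ) ≤ ((M : ℝ) * 2 ^ ((6 + γ) * Z)) ^ d := by exact_mod_cast hτ
    have e₂ : (1 : ℝ) ≤ ((M : ℝ) * 2 ^ ((6 + γ) * Z)) ^ d :=
      one_le_pow₀ (one_le_mul_of_one_le_of_one_le hM' (one_le_pow₀ (by norm_num)))
    linarith
  have hlog2 : Real.log 2 ≤ 1 := by linarith [Real.log_two_lt_d9]
  have hlog2' : 0 ≤ Real.log 2 := Real.log_nonneg (by norm_num)
  have h₂ : Real.log (τ + 1) ≤
      Real.log 2 + d * (Real.log M + ((6 + γ) * Z : ℝ) * Real.log 2) := by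
    refine (Real.log_le_log (by positivity) h₁).trans_eq ?_
    rw [Real.log_mul (by norm_num) (by positivity), Real.log_pow,
      Real.log_mul (by positivity) (by positivity), Real.log_pow]
    push_cast
    ring
  have h₃ : (Z : ℝ) ≤ 1048576 * a ^ 4 * (4 * x ^ 2 / k + 2 * x) := by
    have e₁ : ((b / k : ℕ) : ℝ) ≤ b / k := Nat.cast_div_le
    have e₂ : (Z : ℝ) = 1048576 * a ^ 4 * (((b / k : ℕ) : ℝ) + 1) * b := by
      rw [hZ, blockSize]
      push_cast
      ring
    rw [e₂, mul_assoc]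
    gcongr
    have e₃ : ((b / k : ℕ) : ℝ) ≤ 2 * x / k := e₁.trans (by gcongr)
    calc (((b / k : ℕ) : ℝ) + 1) * b ≤ (2 * x / k + 1) * (2 * x) := by gcongr
      _ = 4 * x ^ 2 / k + 2 * x := by ring
  have h₄ : ((6 + γ) * Z : ℝ) * Real.log 2 ≤
      (6 + γ) * (1048576 * a ^ 4 * (4 * x ^ 2 / k + 2 * x)) := by
    calc ((6 + γ) * Z : ℝ) * Real.log 2 ≤ ((6 + γ) * Z : ℝ) * 1 := by gcongr
      _ ≤ _ := by rw [mul_one]; gcongr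
  have h₅ : (0 : ℝ) ≤ 1048576 * a ^ 4 * d * (6 + γ) * (12 * x ^ 2 / k + 14 * x) := by positivity
  calc Real.log (τ + 1) ≤ 1 + d * (Real.log M +
        (6 + γ) * (1048576 * a ^ 4 * (4 * x ^ 2 / k + 2 * x))) := by
        refine h₂.trans (add_le_add hlog2 ?_)
        gcongr
    _ ≤ 1 + d * (Real.log M + (6 + γ) * (1048576 * a ^ 4 * (4 * x ^ 2 / k + 2 * x))) +
        1048576 * a ^ 4 * d * (6 + γ) * (12 * x ^ 2 / k + 14 * x) := le_add_of_nonneg_right h₅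
    _ = _ := by ring

/-- If a dense pattern can be detected fast, so can cliques. -/
theorem exists_detectsCliques (a : ℕ) (ha : 1 ≤ a) : ∃ (A : Prog) (c : ℝ), 0 ≤ c ∧
    (∀ G, (∀ t ω, ¬ Succeeds G t ω) → ∀ T, win T ([A], G) = 0) ∧
    (∀ (k : ℕ), 2 ≤ k → ∀ (H : SimpleGraph (Fin k)), Dense a H → ∀ (f g : ℝ) (P : Prog),
      SolvesPattern P H (fun n : ℕ => f * (n : ℝ) ^ g) → ∀ ε, c * (1 + |g|) / k < ε →
      ∀ᶠ n : ℕ in atTop, ∃ τ : ℕ, Real.log (τ + 1) ≤ ε * Real.log n ^ 2 ∧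
        DetectsCliques A a n τ) := by
  obtain ⟨A, B, hB, hsound, hcomp⟩ := exists_universal_search
  obtain ⟨hmono, d, hd⟩ := hB
  -- The program and the constant are fixed before `k`, `H`, `P` and `ε`; the exponent `d` belongs
  -- to the universal search. The 7 covers `6 + ⌈|g|⌉₊ ≤ 7 * (1 + |g|)`.
  refine ⟨A, 16777216 * a ^ 4 * d * 7, by positivity, hsound, ?_⟩
  intro k hk H hH f g P hP ε hε
  set φ := ⌈|f|⌉₊ with hφ
  set γ := ⌈|g|⌉₊ with hγ
  obtain ⟨M, hM, htotal⟩ := total_le P φ γ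
  have hb_tendsto : Tendsto (fun n : ℕ => Nat.clog 2 n) atTop atTop := by
    refine tendsto_atTop.2 fun i => ?_
    filter_upwards [eventually_ge_atTop (2 ^ i)] with n hn
    exact (Nat.pow_le_pow_iff_right (by norm_num)).1
      (hn.trans (Nat.le_pow_clog (by norm_num) n))
  have hlog_tendsto : Tendsto (fun n : ℕ => Real.log n) atTop atTop :=
    Real.tendsto_log_atTop.comp tendsto_natCast_atTop_atTop
  have hε' : (16777216 * a ^ 4 * d * (6 + γ) / k : ℝ) < ε := by
    refine lt_of_le_of_lt ?_ hε
    have e₁ : (γ : ℝ) ≤ |g| + 1 := (Nat.ceil_lt_add_one (abs_nonneg g)).le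
    have e₂ : (6 + γ : ℝ) ≤ 7 * (1 + |g|) := by linarith [abs_nonneg g]
    rw [mul_assoc _ (7 : ℝ)]
    gcongr
  filter_upwards [hb_tendsto.eventually (eventually_le_two_pow a k),
    eventually_gt_atTop (k ^ a), eventually_ge_atTop (16 * k * (2 * k) ^ (2 * a)),
    eventually_ge_atTop 2, hlog_tendsto.eventually (eventually_ge_atTop 2),
    hlog_tendsto.eventually (eventually_quadratic_le
      (B := 16777216 * a ^ 4 * d * (6 + γ)) (D := 1 + d * Real.log M) hε')]
    with n hu hn₁ hn₂ hn₃ hx hquad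
  set b := Nat.clog 2 n with hb
  set s := blockSize a k b with hs
  set e := b * ((4 * a - 2) * s) with he
  set ell := 4 * a * s with hell
  have hs₁ : 1 ≤ s := 
    Nat.mul_pos (Nat.mul_pos (by norm_num) (Nat.pow_pos ha)) (Nat.succ_pos _)
  have hb₁ : 1 ≤ b := Nat.clog_pos (by norm_num) hn₃
  have hnb : n ≤ 2 ^ b := Nat.le_pow_clog (by norm_num) n
  have hbn : 2 ^ b ≤ 2 * n := by
    have := Nat.pow_pred_clog_lt_self (b := 2) (by norm_num) (x := n) (by omega)
    obtain ⟨b', hb'⟩ : ∃ b', b = b' + 1 := ⟨b - 1, by omega⟩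
    rw [← hb, hb', Nat.pred_succ] at this
    rw [hb', pow_succ]
    omega
  have hell₁ : 1 ≤ ell := by rw [hell]; exact Nat.mul_pos (by omega) hs₁
  set Z := 4 * a * s * b with hZ
  have he_le : e ≤ Z := by
    rw [he, hZ, mul_comm b]
    gcongr
    omega
  have hell_le : ell ≤ Z := Nat.le_mul_of_pos_right _ hb₁
  have hb_le : b ≤ Z := Nat.le_mul_of_pos_left _ hell₁
  have htot := htotal e ell b Z he_le hell_le hb_le
  set t₀ := startStage P φ γ e ell b with ht₀
  -- This is `2 / q` for the success probability `q` of a stage, so all `m` stages fail with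
  -- probability at most `1 / (1 + 2)`.
  set m := 4 * 2 ^ (params P e ell b).size with hm
  refine ⟨B (8 * n ^ 2 + 1 + t₀ + m), ?_, ?_⟩
  · refine le_trans (log_total_le (a := a) (k := k) (b := b) (d := d) (γ := γ) (M := M) (by omega)
      hM hx ?_ ?_) hquad
    · have e₁ : (b : ℝ) * Real.log 2 ≤ Real.log 2 + Real.log n := by
        rw [← Real.log_pow, ← Real.log_mul (by norm_num) (by positivity)]
        refine Real.log_le_log (by positivity) ?_
        exact_mod_cast hbn
      nlinarith [Real.log_two_gt_d9]
    · refine (hd _).trans (Nat.pow_le_pow_left (le_trans ?_ htot) d)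
      have : n ^ 2 ≤ (2 ^ b) ^ 2 := Nat.pow_le_pow_left hnb 2
      omega
  · intro G K hK hKn
    set q : ℝ := (1 / 2) ^ (params P e ell b).size * (1 / 2) with hq
    have hq₀ : 0 ≤ q := by positivity
    have hq₁ : q ≤ 1 := by
      have : (1 / 2 : ℝ) ^ (params P e ell b).size ≤ 1 := pow_le_one₀ (by norm_num) (by norm_num)
      rw [hq]
      linarith
    have key := hcomp (encode G) t₀ m q hq₀ hq₁ (by
      intro t ht _
      have ht' : 72 * 2 ^ e + ell + b + (params P e ell b).size +
        (P.cost + 1) * (φ * 2 ^ (e * γ)) ≤ t := ht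
      have ht₁ : 72 * 2 ^ e ≤ t := by omega
      have ht₂ : ell ≤ t := by omega
      have ht₃ : b ≤ t := by omega
      have ht₄ : (params P e ell b).size ≤ t := by omega
      refine pr_succeeds_ge (κ := K.card / k) G P hH ha hs₁ hk hnb
        (blockSize_spec ha (by omega)) K hK (Nat.mul_div_le _ _)
        (clique_part_large (by omega) hKn hbn hn₁ hn₂) hu ?_ ht₁ ht₂ ht₃ ht₄
      · intro m' hm₁ hm₂ Γ
        have e₁ : ⌊f * (m' : ℝ) ^ g⌋₊ ≤ φ * 2 ^ (e * γ) := floor_time_le f g hm₁ hm₂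
        have e₂ : (P.cost + 1) * (φ * 2 ^ (e * γ)) ≤ t := by omega
        have e₃ := (Nat.mul_le_mul_left (P.cost + 1) e₁).trans e₂
        exact ⟨⌊f * (m' : ℝ) ^ g⌋₊, (Nat.le_mul_of_pos_left _ (Nat.succ_pos _)).trans e₃,
          (Nat.mul_le_mul_right _ (Nat.le_succ _)).trans e₃, hP m' hm₁ Γ⟩)
    refine le_trans ?_ (key.trans (win_mono (hmono ?_) _))
    · have e₁ : (m : ℝ) * q = 2 := by
        rw [hm, hq]
        push_cast
        rw [show (4 : ℝ) * 2 ^ (params P e ell b).size * ((1 / 2) ^ (params P e ell b).size *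
          (1 / 2)) = 2 * (2 ^ (params P e ell b).size * (1 / 2) ^ (params P e ell b).size) by ring,
          ← mul_pow]
        norm_num
      have e₂ := one_sub_pow_mul_le hq₀ hq₁ m
      rw [e₁] at e₂
      rw [show (2 / 3 : ℝ≥0∞) = ENNReal.ofReal (2 / 3) by
        rw [ENNReal.ofReal_div_of_pos (by norm_num)]; simp]
      exact ENNReal.ofReal_le_ofReal (by linarith)
    · have := size_encode_le G
      omega

/-! ### The planted clique problem -/

theorem DetectsCliques.mono {A : Prog} {a n τ τ' : ℕ} (h : DetectsCliques A a n τ) (hτ : τ ≤ τ') :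
    DetectsCliques A a n τ' :=
  fun G K hK hn => (h G K hK hn).trans (win_mono hτ _)

theorem isClique_addClique {n : ℕ} (G : SimpleGraph (Fin n)) (S : Finset (Fin n)) :
    (addClique G S).IsClique (S : Set (Fin n)) := by
  intro u hu v hv huv
  refine Or.inr ?_
  rw [SimpleGraph.fromRel_adj]
  exact ⟨huv, Or.inl ⟨hu, hv⟩⟩

/-- Every graph in the support contains the clique, so the randomness of the graph plays no role. -/
theorem le_plantedClique {A : Prog} {a n κ τ : ℕ} (hκ : κ ≤ n) (h : DetectsCliques A a n τ)
    (hn : n ≤ κ ^ a) :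
    2 / 3 ≤ ((plantedClique n κ hκ).bind fun G => output A τ (encode G)) (some true) := by
  rw [PMF.bind_apply]
  calc (2 / 3 : ℝ≥0∞) = ∑' G, plantedClique n κ hκ G * (2 / 3) := by
        rw [ENNReal.tsum_mul_right, PMF.tsum_coe, one_mul]
    _ ≤ _ := by
        refine ENNReal.tsum_le_tsum fun G => ?_
        by_cases hG : G ∈ (plantedClique n κ hκ).support
        · gcongr
          simp only [plantedClique, PMF.mem_support_bind_iff, PMF.mem_support_map_iff,
            PMF.mem_support_uniformOfFinset_iff, Finset.mem_powersetCard] at hG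
          obtain ⟨G', -, S, ⟨-, hS⟩, rfl⟩ := hG
          exact h _ S (isClique_addClique G' S) (by rwa [hS])
        · rw [PMF.mem_support_iff, not_not] at hG
          simp [hG]

/-- Without a certificate `A` never accepts, for any time bound, and certificates occur with
probability at most `1 / n ≤ 1 / 3`. -/
theorem erdosRenyi_le {A : Prog} (hA : ∀ G, (∀ t ω, ¬ Succeeds G t ω) → ∀ T, win T ([A], G) = 0)
    {n : ℕ} (hn : 3 ≤ n) (τ : ℕ) :
    ((erdosRenyi n).bind fun G => output A τ (encode G)) (some true) ≤ 1 / 3 := by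
  classical
  rw [PMF.bind_apply, tsum_fintype]
  have h₁ : ∀ G : SimpleGraph (Fin n), erdosRenyi n G * output A τ (encode G) (some true) ≤
      (Fintype.card (SimpleGraph (Fin n)) : ℝ≥0∞)⁻¹ * if HasCertificate G then 1 else 0 := by
    intro G
    rw [erdosRenyi, PMF.uniformOfFintype_apply]
    gcongr
    split_ifs with hG
    · exact PMF.coe_le_one _ _
    · refine le_of_eq (hA _ (fun t ω hs => hG ?_) τ)
      exact HasCertificate.of_certified hs
  have h₂ : avg (fun G : SimpleGraph (Fin n) => if HasCertificate G then 1 else 0) ≤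
      ENNReal.ofReal (1 / 3) := by
    rw [avg_ite]
    refine ENNReal.ofReal_le_ofReal ((pr_hasCertificate_le hn).trans ?_)
    gcongr
    exact_mod_cast hn
  refine (Finset.sum_le_sum fun G _ => h₁ G).trans (le_trans ?_ (h₂.trans ?_))
  · rw [← Finset.mul_sum, avg, mul_comm, div_eq_mul_inv]
  · rw [ENNReal.ofReal_div_of_pos (by norm_num)]
    simp

/-- Distinguishing planted cliques in time `n ^ o(log n)`. -/
theorem not_spch_of_detectsCliques {A : Prog} {a : ℕ} {δ : ℝ} (h₀ : 0 < δ) (h₁ : δ < 1 / 2)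
    (ha : 1 ≤ δ * a)
    (hA : ∀ G, (∀ t ω, ¬ Succeeds G t ω) → ∀ T, win T ([A], G) = 0)
    (hfast : ∀ ε > 0, ∀ᶠ n : ℕ in atTop, ∃ τ : ℕ, Real.log (τ + 1) ≤ ε * Real.log n ^ 2 ∧
      DetectsCliques A a n τ) :
    ∃ (A : Prog) (h : ℕ → ℝ), h =o[atTop] (fun n : ℕ => Real.log n) ∧ ∀ᶠ n : ℕ in atTop,
      2 / 3 ≤ ((plantedClique n ⌈(n : ℝ) ^ δ⌉₊ (ceil_rpow_le n h₀ h₁)).bind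
        fun G => output A ⌊(n : ℝ) ^ h n⌋₊ (encode G)) (some true) ∧
      ((erdosRenyi n).bind
        fun G => output A ⌊(n : ℝ) ^ h n⌋₊ (encode G)) (some true) ≤ 1 / 3 := by
  classical
  -- The least detection time frees the time bound from `ε`: a single sequence is eventually below
  -- each of the bounds in `hfast`.
  have hτ : ∀ n, ∃ τ, (∃ τ', DetectsCliques A a n τ') →
      DetectsCliques A a n τ ∧ ∀ τ', DetectsCliques A a n τ' → τ ≤ τ' := by
    intro n
    by_cases h : ∃ τ', DetectsCliques A a n τ'
    · exact ⟨Nat.find h, fun _ => ⟨Nat.find_spec h, fun τ' h' => Nat.find_min' h h'⟩⟩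
    · exact ⟨0, fun h' => absurd h' h⟩
  choose τ hτ using hτ
  refine ⟨A, fun n => Real.log (τ n + 1) / Real.log n, ?_, ?_⟩
  · refine isLittleO_iff.2 fun ε hε => ?_
    filter_upwards [hfast ε hε, eventually_ge_atTop 2] with n hn hn₂
    obtain ⟨σ, hσ, hdet⟩ := hn
    have hlog : 0 < Real.log n := Real.log_pos (by exact_mod_cast hn₂)
    have h₂ : (τ n : ℝ) ≤ σ := by exact_mod_cast (hτ n ⟨σ, hdet⟩).2 σ hdet
    have h₃ : Real.log (τ n + 1) ≤ Real.log (σ + 1) :=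
      Real.log_le_log (by positivity) (by linarith)
    have h₄ : 0 ≤ Real.log ((τ n : ℝ) + 1) := Real.log_nonneg (by simp)
    rw [Real.norm_of_nonneg (div_nonneg h₄ hlog.le), Real.norm_of_nonneg hlog.le,
      div_le_iff₀ hlog]
    nlinarith
  · filter_upwards [hfast 1 one_pos, eventually_ge_atTop 3] with n hn hn₃
    obtain ⟨σ, -, hdet⟩ := hn
    have hn₀ : (1 : ℝ) < n := by exact_mod_cast (by omega : 1 < n)
    -- The exponent is chosen so that the time bound is exactly `τ n + 1`; the summand 1 keeps the
    -- logarithm nonnegative.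
    have h₂ : (n : ℝ) ^ (Real.log (τ n + 1) / Real.log n) = τ n + 1 := by
      rw [Real.rpow_def_of_pos (by linarith), mul_div_cancel₀ _ (Real.log_pos hn₀).ne',
        Real.exp_log (by positivity)]
    have h₃ : ⌊(n : ℝ) ^ (Real.log (τ n + 1) / Real.log n)⌋₊ = τ n + 1 := by
      rw [h₂]
      exact_mod_cast Nat.floor_natCast (τ n + 1)
    rw [h₃]
    refine ⟨le_plantedClique _ ((hτ n ⟨σ, hdet⟩).1.mono (Nat.le_succ _)) ?_, erdosRenyi_le hA hn₃ _⟩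
    have h₄ : (n : ℝ) ≤ ((⌈(n : ℝ) ^ δ⌉₊ : ℕ) : ℝ) ^ a := by
      calc (n : ℝ) = (n : ℝ) ^ (1 : ℝ) := (Real.rpow_one _).symm
        _ ≤ (n : ℝ) ^ (δ * a) := Real.rpow_le_rpow_of_exponent_le hn₀.le ha
        _ = ((n : ℝ) ^ δ) ^ a := by rw [Real.rpow_mul (by linarith), Real.rpow_natCast]
        _ ≤ _ := by
            gcongr
            exact Nat.le_ceil _
    exact_mod_cast h₄

/-- Under the hypothesis, no dense pattern can be detected fast. -/
theorem SPCH.eventually_not_solvesPattern (h : SPCH) : ∃ a : ℕ, 1 ≤ a ∧ ∀ f g : ℕ → ℝ,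
    g =o[atTop] (fun k : ℕ => (k : ℝ)) → ∀ᶠ k : ℕ in atTop, ∀ H : SimpleGraph (Fin k),
      Dense a H → ¬ ∃ P : Prog, SolvesPattern P H (fun n : ℕ => f k * (n : ℝ) ^ g k) := by
  obtain ⟨δ, h₀, h₁, hno⟩ := h
  obtain ⟨a, ha⟩ := exists_nat_ge (1 / δ)
  rw [div_le_iff₀ h₀, mul_comm] at ha
  have ha₁ : 1 ≤ a := by
    rcases Nat.eq_zero_or_pos a with rfl | h
    · norm_num at ha
    · exact h
  refine ⟨a, ha₁, fun f g hg => ?_⟩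
  by_contra hcon
  obtain ⟨A, c, hc, hsound, hA⟩ := exists_detectsCliques a ha₁
  refine hno (not_spch_of_detectsCliques h₀ h₁ ha hsound fun ε hε => ?_)
  have h₂ : ∀ᶠ k : ℕ in atTop, c * (1 + |g k|) / k < ε := by
    have e₁ : ∀ᶠ k : ℕ in atTop, ‖g k‖ ≤ ε / (2 * (c + 1)) * ‖(k : ℝ)‖ :=
      isLittleO_iff.1 hg (by positivity)
    filter_upwards [e₁, eventually_gt_atTop ⌈2 * c / ε⌉₊] with k hk hk'
    have hk₀ : (0 : ℝ) < k := by exact_mod_cast (by omega : 0 < k)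
    have hk'' : 2 * c / ε < k := Nat.lt_of_ceil_lt hk'
    rw [div_lt_iff₀ hε] at hk''
    rw [Real.norm_eq_abs, Real.norm_of_nonneg hk₀.le, div_mul_eq_mul_div,
      le_div_iff₀ (by positivity)] at hk
    rw [div_lt_iff₀ hk₀]
    nlinarith [abs_nonneg (g k)]
  obtain ⟨k, hk, hkε, hk₂⟩ := ((not_eventually.1 hcon).and_eventually
    (h₂.and (eventually_ge_atTop 2))).exists
  push Not at hk
  obtain ⟨H, hH, P, hP⟩ := hk
  exact hA k hk₂ H hH (f k) (g k) P hP ε hkε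

theorem toOuterMeasure_erdosRenyi (k : ℕ) (p : SimpleGraph (Fin k) → Prop) :
    (erdosRenyi k).toOuterMeasure {H | p H} = ENNReal.ofReal (pr p) := by
  classical
  rw [← avg_ite, PMF.toOuterMeasure_apply, tsum_fintype, avg, div_eq_mul_inv, Finset.sum_mul]
  refine Finset.sum_congr rfl fun H _ => ?_
  simp [Set.indicator_apply, erdosRenyi]

end PatternDetection

/-- Under the Strongish Planted Clique Hypothesis, for every function `f` and every `g k = o(k)`:
with probability tending to `1` over a random `k`-vertex pattern `H`, no algorithm (even one
designed for that `H`) solves not-necessarily-induced detection of `H` in `n`-vertex graphs in time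
`f k * n ^ g k`. -/
theorem mainTheorem5 (hSPCH : PatternDetection.SPCH) (f : ℕ → ℝ) (g : ℕ → ℝ)
    (hg : g =o[atTop] (fun k : ℕ => (k : ℝ))) :
    Tendsto
      (fun k : ℕ => (PatternDetection.erdosRenyi k).toOuterMeasure
        {H | ¬ ∃ P : PatternDetection.Prog,
          PatternDetection.SolvesPattern P H (fun n : ℕ => f k * (n : ℝ) ^ g k)})
      atTop (𝓝 1) := by
  obtain ⟨a, ha, h⟩ := hSPCH.eventually_not_solvesPattern
  have h₁ : Tendsto (fun k : ℕ => ENNReal.ofReal (1 - (1 / 2) ^ k)) atTop (𝓝 1) := by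
    have := (tendsto_pow_atTop_nhds_zero_of_lt_one (r := (1 / 2 : ℝ)) (by norm_num)
      (by norm_num)).const_sub 1
    simpa using ENNReal.tendsto_ofReal this
  refine tendsto_of_tendsto_of_tendsto_of_le_of_le' h₁ tendsto_const_nhds ?_ ?_
  · filter_upwards [h f g hg, eventually_ge_atTop (3584 * a ^ 2)] with k hk hk'
    rw [PatternDetection.toOuterMeasure_erdosRenyi]
    refine ENNReal.ofReal_le_ofReal ((PatternDetection.le_pr_of_not_le
      (PatternDetection.pr_not_dense_le ha hk')).trans ?_)
    exact PatternDetection.pr_mono hk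
  · refine Eventually.of_forall fun k => ?_
    rw [PatternDetection.toOuterMeasure_erdosRenyi]
    exact (ENNReal.ofReal_le_ofReal (PatternDetection.pr_le_one _)).trans_eq ENNReal.ofReal_one
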